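/- Let $d\ge 1$ be a fixed integer. A box in $\mathbb{R}^d$ is an axis-aligned closed hyper-rectangle. A coverage kernel of a set $\mathcal{B}$ of boxes is a subset $\mathcal{K}\subseteq\mathcal{B}$ whose union equals the union of all the boxes of $\mathcal{B}$; let $\mathrm{OPT}$ denote the minimum size of a coverage kernel of $\mathcal{B}$. There is a deterministic algorithm that, given any set $\mathcal{B}$ of $n\ge 2$ boxes in $\mathbb{R}^d$, computes a coverage kernel of $\mathcal{B}$ of size $O(\mathrm{OPT}\cdot\log n)$ in time $O(\mathrm{OPT}\cdot n^{\frac d2+1}\log^2 n)$. Here the constants hidden in the $O$-notation depend only on $d$, and time is the number of steps on a real RAM, that is, a random access machine that performs exact arithmetic operations and comparisons on real numbers, and integer arithmetic and indirect addressing on words of $O(\log n)$ bits, at unit cost each. -/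

import Mathlib

/-! ### Boxes and coverage kernels -/

/-- A `d`-dimensional box: a nonempty axis-aligned closed hyper-rectangle
`[lo 0, hi 0] × ⋯ × [lo (d-1), hi (d-1)]`, where `lo = b.fst ≤ hi = b.snd` coordinatewise.
Its coercion to a set is `Set.Icc b.fst b.snd`. -/
abbrev Box (d : ℕ) : Type := NonemptyInterval (Fin d → ℝ)

/-- The region covered by the boxes of `B` whose indices lie in `K`. -/
def coveredRegion {d n : ℕ} (B : Fin n → Box d) (K : Finset (Fin n)) : Set (Fin d → ℝ) :=
  ⋃ i ∈ K, (B i : Set (Fin d → ℝ))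

/-- `K` (a set of indices) is a coverage kernel of `B`: it covers the same region as all of `B`. -/
def IsCoverageKernel {d n : ℕ} (B : Fin n → Box d) (K : Finset (Fin n)) : Prop :=
  coveredRegion B K = coveredRegion B Finset.univ

/-- The size of a minimum coverage kernel of `B` (the set of sizes always contains `n`). -/
noncomputable def minKernelSize {d n : ℕ} (B : Fin n → Box d) : ℕ :=
  sInf {k | ∃ K : Finset (Fin n), IsCoverageKernel B K ∧ K.card = k}

/-! ### The real RAM

A random access machine with finitely many arrays of `w`-bit words and finitely many arrays of
real numbers (a program can name only finitely many of them).  Array cells are addressed by words.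
Words support unit-cost integer arithmetic modulo `2 ^ w`, reals support exact unit-cost
arithmetic and comparisons.  Reals cannot be rounded or converted to words, and the only real
constants are those obtained from words. -/

namespace RealRAM

/-- Memory: `word a i` and `real a i` are the `i`-th cells of the `a`-th word and real array. -/
structure State where
  word : ℕ → ℕ → ℕ
  real : ℕ → ℕ → ℝ

/-- Store the word `v` in cell `i` of the word array `a`. -/
def State.setWord (s : State) (a i v : ℕ) : State :=
  { s with word := Function.update s.word a (Function.update (s.word a) i v) }

/-- Store the real `v` in cell `i` of the real array `a`. -/
def State.setReal (s : State) (a i : ℕ) (v : ℝ) : State :=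
  { s with real := Function.update s.real a (Function.update (s.real a) i v) }

/-- Word-valued expressions. -/
inductive WordExpr : Type
  | lit (k : ℕ)
  | read (a : ℕ) (i : WordExpr)
  | add (x y : WordExpr)
  | sub (x y : WordExpr)
  | mul (x y : WordExpr)
  | div (x y : WordExpr)
  | mod (x y : WordExpr)

/-- Value of a word expression for word length `w`.  Subtraction is truncated at `0`. -/
def WordExpr.eval (w : ℕ) (s : State) : WordExpr → ℕ
  | .lit k => k % 2 ^ w
  | .read a i => s.word a (i.eval w s)
  | .add x y => (x.eval w s + y.eval w s) % 2 ^ w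
  | .sub x y => x.eval w s - y.eval w s
  | .mul x y => (x.eval w s * y.eval w s) % 2 ^ w
  | .div x y => x.eval w s / y.eval w s
  | .mod x y => x.eval w s % y.eval w s

/-- Number of elementary operations needed to evaluate a word expression. -/
def WordExpr.cost : WordExpr → ℕ
  | .lit _ => 1
  | .read _ i => i.cost + 1
  | .add x y => x.cost + y.cost + 1
  | .sub x y => x.cost + y.cost + 1
  | .mul x y => x.cost + y.cost + 1
  | .div x y => x.cost + y.cost + 1
  | .mod x y => x.cost + y.cost + 1

/-- Real-valued expressions. -/
inductive RealExpr : Type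
  | ofWord (x : WordExpr)
  | read (a : ℕ) (i : WordExpr)
  | add (x y : RealExpr)
  | sub (x y : RealExpr)
  | mul (x y : RealExpr)
  | div (x y : RealExpr)

/-- Value of a real expression for word length `w`.  Division by `0` returns `0`, which a program
could also obtain by comparing the divisor with `0` first. -/
noncomputable def RealExpr.eval (w : ℕ) (s : State) : RealExpr → ℝ
  | .ofWord x => (x.eval w s : ℝ)
  | .read a i => s.real a (i.eval w s)
  | .add x y => x.eval w s + y.eval w s
  | .sub x y => x.eval w s - y.eval w s
  | .mul x y => x.eval w s * y.eval w s
  | .div x y => x.eval w s / y.eval w s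

/-- Number of elementary operations needed to evaluate a real expression. -/
def RealExpr.cost : RealExpr → ℕ
  | .ofWord x => x.cost + 1
  | .read _ i => i.cost + 1
  | .add x y => x.cost + y.cost + 1
  | .sub x y => x.cost + y.cost + 1
  | .mul x y => x.cost + y.cost + 1
  | .div x y => x.cost + y.cost + 1

/-- Tests. -/
inductive Test : Type
  | wordLt (x y : WordExpr)
  | wordEq (x y : WordExpr)
  | realLt (x y : RealExpr)
  | realEq (x y : RealExpr)
  | not (b : Test)
  | and (b c : Test)

/-- Truth of a test for word length `w`. -/
def Test.holds (w : ℕ) (s : State) : Test → Prop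
  | .wordLt x y => x.eval w s < y.eval w s
  | .wordEq x y => x.eval w s = y.eval w s
  | .realLt x y => x.eval w s < y.eval w s
  | .realEq x y => x.eval w s = y.eval w s
  | .not b => ¬ b.holds w s
  | .and b c => b.holds w s ∧ c.holds w s

/-- Number of elementary operations needed to evaluate a test. -/
def Test.cost : Test → ℕ
  | .wordLt x y => x.cost + y.cost + 1
  | .wordEq x y => x.cost + y.cost + 1
  | .realLt x y => x.cost + y.cost + 1
  | .realEq x y => x.cost + y.cost + 1
  | .not b => b.cost + 1
  | .and b c => b.cost + c.cost + 1

/-- Programs: `setWord a i e` is the assignment `word a i := e`, `setReal a i e` is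
`real a i := e`, and `loop b p` is `while b do p`. -/
inductive Program : Type
  | skip
  | setWord (a : ℕ) (i e : WordExpr)
  | setReal (a : ℕ) (i : WordExpr) (e : RealExpr)
  | seq (p q : Program)
  | ite (b : Test) (p q : Program)
  | loop (b : Test) (p : Program)

/-- `Exec w p s t s'`: on a machine with `w`-bit words, the program `p` started in the state `s`
halts after exactly `t` elementary steps in the state `s'`. -/
inductive Exec (w : ℕ) : Program → State → ℕ → State → Prop
  | skip (s : State) : Exec w .skip s 1 s
  | setWord (a : ℕ) (i e : WordExpr) (s : State) :
      Exec w (.setWord a i e) s (i.cost + e.cost + 1)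
        (s.setWord a (i.eval w s) (e.eval w s))
  | setReal (a : ℕ) (i : WordExpr) (e : RealExpr) (s : State) :
      Exec w (.setReal a i e) s (i.cost + e.cost + 1)
        (s.setReal a (i.eval w s) (e.eval w s))
  | seq {p q : Program} {s s₁ s₂ : State} {t₁ t₂ : ℕ} :
      Exec w p s t₁ s₁ → Exec w q s₁ t₂ s₂ → Exec w (.seq p q) s (t₁ + t₂) s₂
  | iteTrue {b : Test} {p q : Program} {s s₁ : State} {t : ℕ} :
      b.holds w s → Exec w p s t s₁ → Exec w (.ite b p q) s (b.cost + t) s₁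
  | iteFalse {b : Test} {p q : Program} {s s₁ : State} {t : ℕ} :
      ¬ b.holds w s → Exec w q s t s₁ → Exec w (.ite b p q) s (b.cost + t) s₁
  | loopDone {b : Test} {p : Program} {s : State} :
      ¬ b.holds w s → Exec w (.loop b p) s b.cost s
  | loopStep {b : Test} {p : Program} {s s₁ s₂ : State} {t₁ t₂ : ℕ} :
      b.holds w s → Exec w p s t₁ s₁ → Exec w (.loop b p) s₁ t₂ s₂ →
        Exec w (.loop b p) s (b.cost + t₁ + t₂) s₂

/-- The initial state on the input `B`: the first cell of word array `0` holds `n`, and cell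
`d * i + j` of the real arrays `0` and `1` holds the lower and the upper end, respectively, of the
`j`-th side of the `i`-th box.  All other cells are zero. -/
noncomputable def inputState {d n : ℕ} (B : Fin n → Box d) : State where
  word a k := if a = 0 ∧ k = 0 then n else 0
  real a k :=
    if h : k < n * d then
      if a = 0 then (B (Fin.divNat ⟨k, h⟩)).fst (Fin.modNat ⟨k, h⟩)
      else if a = 1 then (B (Fin.divNat ⟨k, h⟩)).snd (Fin.modNat ⟨k, h⟩)
      else 0
    else 0

/-- In the state `s` the machine outputs the set `K` of indices: the first cell of word array `0`
holds the size `m` of `K`, and the first `m` cells of word array `1` list the elements of `K`,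
each of them once. -/
def State.Outputs {n : ℕ} (s : State) (K : Finset (Fin n)) : Prop :=
  s.word 0 0 = K.card ∧
    (Finset.range K.card).image (s.word 1) = K.map Fin.valEmbedding

end RealRAM

/-! For `d ≥ 2` the algorithm is greedy set cover on a finite grid. In each dimension the `2n` box
ends are replaced by their ranks, so that a box becomes a product of half-open intervals of ranks. A
rank has weight one if it is the last among equal ends of the same kind; such ranks stand for the
combinatorially distinct positions of a real coordinate. Hence a subfamily is a kernel exactly when
it covers all weighted grid points of all boxes (`Tables.Describes.isCoverageKernel_iff`).

An optimal kernel covers the `U` points still uncovered with OPT boxes, so the best box gains at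
least `U / OPT` of them and `U` shrinks at least by the factor `exp (-1 / OPT)` (`greedy_step`). At
most `(2n)^d` points are there at the start, so `O(OPT * log n)` boxes are chosen.

Each round recomputes, for every box, its number of uncovered points. The grid is split into
`O(√n)^d` cells in such a way that no box has ends strictly inside two sides of the same cell. Sides
are cut at multiples of about `√n` and, in dimension `j`, also at the ends of those boxes that cut
an earlier side of the cell; ranks are distinct, so there are only `O(√n)` such boxes
(`Tables.card_cutSet_le`). Inside a cell every box that meets it is a slab, the uncovered set is a
product of one-dimensional sets, and the count for a box is a product of differences of prefix
counts (`Tables.card_free_cell`). A cell costs `O(n)`, a round `O(n^(d/2+1))` (`runs_walk`,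
`roundTime_le`). The ranks are found by comparing all pairs of boxes, in time `O(n^2)`, which is
affordable for `d ≥ 2`.

For `d = 1` quadratic time is too much. There a sweep repeatedly takes the farthest reaching
interval, in `O(n)` per choice, and yields a minimum kernel: it is accompanied by equally many
points no two of which lie in a common interval (`SweepState.step`, `SweepState.card_le`).

The rest is program verification. `Runs` is a total-correctness triple with a time bound, loops are
treated by invariants, straight-line code is evaluated symbolically, and `word_length` shows that
words of `O(log n)` bits never wrap. -/

namespace RealRAM

/-! ### Timed execution -/

/-- `p` halts from `s` within `T` steps in a state satisfying `Q`. -/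
def Runs (w : ℕ) (p : Program) (s : State) (T : ℕ) (Q : State → Prop) : Prop :=
  ∃ t s', Exec w p s t s' ∧ t ≤ T ∧ Q s'

theorem Runs.mono {w : ℕ} {p : Program} {s : State} {T T' : ℕ} {Q Q' : State → Prop}
    (h : Runs w p s T Q) (hT : T ≤ T') (hQ : ∀ s', Q s' → Q' s') : Runs w p s T' Q' := by
  obtain ⟨t, s', he, ht, hq⟩ := h
  exact ⟨t, s', he, ht.trans hT, hQ _ hq⟩

theorem Runs.seq {w : ℕ} {p q : Program} {s : State} {T₁ T₂ : ℕ} {Q₁ Q₂ : State → Prop}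
    (h₁ : Runs w p s T₁ Q₁) (h₂ : ∀ s₁, Q₁ s₁ → Runs w q s₁ T₂ Q₂) :
    Runs w (.seq p q) s (T₁ + T₂) Q₂ := by
  obtain ⟨t₁, s₁, e₁, l₁, q₁⟩ := h₁
  obtain ⟨t₂, s₂, e₂, l₂, q₂⟩ := h₂ s₁ q₁
  exact ⟨_, _, .seq e₁ e₂, by omega, q₂⟩

/-- The measure drops in every iteration, so its initial bound `m` also bounds the number of
iterations; the last summand pays for the failing test. -/
theorem Runs.loop {w : ℕ} {b : Test} {p : Program} {T : ℕ} (I : State → Prop) (μ : State → ℕ)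
    (hbody : ∀ s, I s → b.holds w s → Runs w p s T (fun s' => I s' ∧ μ s' < μ s)) :
    ∀ (m : ℕ) (s : State), I s → μ s ≤ m →
      Runs w (.loop b p) s ((b.cost + T) * m + b.cost) (fun s' => I s' ∧ ¬ b.holds w s') := by
  intro m
  induction m with
  | zero =>
    intro s hI hm
    by_cases hb : b.holds w s
    · obtain ⟨t, s', -, -, -, h⟩ := hbody s hI hb
      omega
    · exact ⟨_, _, .loopDone hb, by omega, hI, hb⟩
  | succ m ih =>
    intro s hI hm
    by_cases hb : b.holds w s
    · obtain ⟨t, s', he, ht, hI', h⟩ := hbody s hI hb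
      obtain ⟨t', s'', he', ht', hq⟩ := ih s' hI' (by omega)
      refine ⟨_, _, .loopStep hb he he', ?_, hq⟩
      rw [Nat.mul_succ]
      omega
    · exact ⟨_, _, .loopDone hb, by omega, hI, hb⟩

/-- Programs without loops. -/
def Program.LoopFree : Program → Prop
  | .skip => True
  | .setWord _ _ _ => True
  | .setReal _ _ _ => True
  | .seq p q => p.LoopFree ∧ q.LoopFree
  | .ite _ p q => p.LoopFree ∧ q.LoopFree
  | .loop _ _ => False

/-- An upper bound for the running time of a program without loops. -/
def Program.bound : Program → ℕ
  | .skip => 1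
  | .setWord _ i e => i.cost + e.cost + 1
  | .setReal _ i e => i.cost + e.cost + 1
  | .seq p q => p.bound + q.bound
  | .ite b p q => b.cost + p.bound + q.bound
  | .loop _ _ => 0

open Classical in
/-- The final state of a program without loops. -/
noncomputable def Program.run (w : ℕ) : Program → State → State
  | .skip, s => s
  | .setWord a i e, s => s.setWord a (i.eval w s) (e.eval w s)
  | .setReal a i e, s => s.setReal a (i.eval w s) (e.eval w s)
  | .seq p q, s => q.run w (p.run w s)
  | .ite b p q, s => if b.holds w s then p.run w s else q.run w s
  | .loop _ _, s => s

/-- Reduces loop-free code to the computation of a term: later proofs simplify `Program.run` and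
charge `Program.bound`, which adds up both branches of a conditional. -/
theorem exec_run (w : ℕ) (p : Program) (hp : p.LoopFree) (s : State) :
    ∃ t, Exec w p s t (p.run w s) ∧ t ≤ p.bound := by
  induction p generalizing s with
  | skip => exact ⟨_, .skip s, le_rfl⟩
  | setWord a i e => exact ⟨_, .setWord a i e s, le_rfl⟩
  | setReal a i e => exact ⟨_, .setReal a i e s, le_rfl⟩
  | seq p q ihp ihq =>
    obtain ⟨t₁, e₁, l₁⟩ := ihp hp.1 s
    obtain ⟨t₂, e₂, l₂⟩ := ihq hp.2 (p.run w s)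
    exact ⟨_, .seq e₁ e₂, Nat.add_le_add l₁ l₂⟩
  | ite b p q ihp ihq =>
    by_cases hb : b.holds w s
    · obtain ⟨t₁, e₁, l₁⟩ := ihp hp.1 s
      refine ⟨_, ?_, (Nat.add_le_add_left l₁ b.cost).trans (Nat.le_add_right _ q.bound)⟩
      simpa only [Program.run, if_pos hb] using Exec.iteTrue hb e₁
    · obtain ⟨t₁, e₁, l₁⟩ := ihq hp.2 s
      refine ⟨b.cost + t₁, ?_, ?_⟩
      · simpa only [Program.run, if_neg hb] using Exec.iteFalse hb e₁
      · simp only [Program.bound]; omega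
  | loop b p => exact hp.elim

theorem runs_of_loopFree {w : ℕ} {p : Program} (hp : p.LoopFree) {s : State} {Q : State → Prop}
    (h : Q (p.run w s)) : Runs w p s p.bound Q := by
  obtain ⟨t, e, l⟩ := exec_run w p hp s
  exact ⟨t, _, e, l, h⟩

/-! ### Memory layout -/

/-- Array number `j` of the `k`-th family of arrays. -/
def reg (k j : ℕ) : ℕ := Nat.pair k j

-- Pairing keeps the families of arrays disjoint. Moreover `reg 0 0` is `0` and `reg 0 1` is `1`,
-- the arrays used for input and output.
@[simp] theorem reg_inj {k j k' j' : ℕ} : reg k j = reg k' j' ↔ k = k' ∧ j = j' :=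
  Nat.pair_eq_pair

theorem setWord_word (s : State) (a i v b x : ℕ) :
    (s.setWord a i v).word b x = if b = a ∧ x = i then v else s.word b x := by
  simp only [State.setWord, Function.update_apply]
  by_cases h : b = a
  · subst h; by_cases h' : x = i <;> simp [h']
  · simp [h]

theorem setWord_word_ne (s : State) {a b : ℕ} (i v : ℕ) (h : b ≠ a) :
    (s.setWord a i v).word b = s.word b := by
  simp [State.setWord, h]

@[simp] theorem setWord_real (s : State) (a i v : ℕ) : (s.setWord a i v).real = s.real := rfl

@[simp] theorem setReal_word (s : State) (a i : ℕ) (v : ℝ) : (s.setReal a i v).word = s.word := rfl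

theorem setReal_real (s : State) (a i : ℕ) (v : ℝ) (b x : ℕ) :
    (s.setReal a i v).real b x = if b = a ∧ x = i then v else s.real b x := by
  simp only [State.setReal, Function.update_apply]
  by_cases h : b = a
  · subst h; by_cases h' : x = i <;> simp [h']
  · simp [h]

/-- The scalar word variable `reg k j`. -/
def WordExpr.var (k j : ℕ) : WordExpr := .read (reg k j) (.lit 0)

@[simp] theorem eval_var (w : ℕ) (s : State) (k j : ℕ) :
    (WordExpr.var k j).eval w s = s.word (reg k j) 0 := by
  simp [WordExpr.var, WordExpr.eval]

/-- `for v := 0 to lim - 1 do p`. -/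
def forLoop (v lim : ℕ) (p : Program) : Program :=
  .seq (.setWord (reg v 0) (.lit 0) (.lit 0))
    (.loop (.wordLt (.var v 0) (.var lim 0))
      (.seq p (.setWord (reg v 0) (.lit 0) (.add (.var v 0) (.lit 1)))))

/-- The invariant `I k` speaks of states whose counter already holds `k`. The constant 11 is the
test (5) plus the increment (6), and 8 is the initialisation (3) plus the failing test (5). -/
theorem Runs.forLoop {w v lim m T : ℕ} {p : Program} (hm : m < 2 ^ w) (I : ℕ → State → Prop)
    (hv : ∀ k s, I k s → s.word (reg v 0) 0 = k ∧ s.word (reg lim 0) 0 = m)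
    (hbody : ∀ k s, k < m → I k s →
      Runs w p s T (fun s' => s'.word (reg v 0) 0 = k ∧ I (k + 1) (s'.setWord (reg v 0) 0 (k + 1))))
    {s : State} (h0 : I 0 (s.setWord (reg v 0) 0 0)) :
    Runs w (forLoop v lim p) s ((T + 11) * m + 8) (I m) := by
  refine Runs.mono (T := 3 + ((5 + (T + 6)) * m + 5))
    (Runs.seq (Q₁ := fun s' => I 0 s') ⟨3, _, .setWord _ _ _ _, le_rfl, ?_⟩ ?_) ?_ (fun _ h => h)
  · simpa [WordExpr.eval] using h0
  · intro s₁ h₁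
    refine Runs.mono (Runs.loop (b := .wordLt (.var v 0) (.var lim 0)) (T := T + 6)
      (fun s => ∃ k, k ≤ m ∧ I k s) (fun s => m - s.word (reg v 0) 0) ?_ m s₁
      ⟨0, Nat.zero_le _, h₁⟩ (by omega)) le_rfl ?_
    · rintro s₂ ⟨k, hk, hI⟩ hb
      obtain ⟨e1, e2⟩ := hv k s₂ hI
      simp only [Test.holds, eval_var, e1, e2] at hb
      refine Runs.seq (hbody k s₂ hb hI) ?_
      rintro s₃ ⟨e3, hI'⟩
      refine ⟨6, _, .setWord _ _ _ _, le_rfl, ?_⟩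
      have e4 : (WordExpr.add (.var v 0) (.lit 1)).eval w s₃ = k + 1 := by
        have h1 : 1 % 2 ^ w = 1 := Nat.mod_eq_of_lt (by omega)
        simp only [WordExpr.eval, eval_var, e3, h1]
        exact Nat.mod_eq_of_lt (by omega)
      have e5 : (WordExpr.lit 0).eval w s₃ = 0 := by simp [WordExpr.eval]
      rw [e4, e5]
      refine ⟨⟨k + 1, hb, hI'⟩, ?_⟩
      rw [setWord_word, if_pos ⟨rfl, rfl⟩]
      omega
    · rintro s' ⟨⟨k, hk, hI⟩, hb⟩
      obtain ⟨e1, e2⟩ := hv k s' hI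
      simp only [Test.holds, eval_var, e1, e2] at hb
      obtain rfl : k = m := by omega
      exact hI
  · rw [show 5 + (T + 6) = T + 11 by omega]; omega

end RealRAM

/-! ### The greedy set cover bound -/

/-- The elements of the set `S i` that are not covered by the sets with index in `K`. -/
def uncoveredIn {X : Type*} [DecidableEq X] (S : ℕ → Finset X) (K : Finset ℕ) (i : ℕ) : Finset X :=
  S i \ K.biUnion S

/-- The sets of `O` split the uncovered points into `O.card` parts, none larger than the gain of
`b`. Hence at most the fraction `1 - 1 / O.card` survives, and `1 + x ≤ exp x`. -/
theorem greedy_step {X : Type*} [DecidableEq X] (S : ℕ → Finset X) (n : ℕ) (O K : Finset ℕ)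
    (hO : ∀ i ∈ O, i < n) (hcov : ∀ i < n, S i ⊆ O.biUnion S) (b : ℕ) (hb : b < n)
    (hbest : ∀ i < n, (uncoveredIn S K i).card ≤ (uncoveredIn S K b).card)
    (hpos : 0 < O.card) :
    (((Finset.range n).biUnion S \ (insert b K).biUnion S).card : ℝ) ≤
      (((Finset.range n).biUnion S \ K.biUnion S).card : ℝ) * Real.exp (-(1 / O.card)) := by
  set U := (Finset.range n).biUnion S \ K.biUnion S with hU
  have h1 : (Finset.range n).biUnion S \ (insert b K).biUnion S = U \ uncoveredIn S K b := by
    ext x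
    simp only [hU, uncoveredIn, Finset.biUnion_insert, Finset.mem_sdiff, Finset.mem_union]
    tauto
  have h2 : uncoveredIn S K b ⊆ U := by
    intro x hx
    simp only [uncoveredIn, hU, Finset.mem_sdiff, Finset.mem_biUnion, Finset.mem_range] at hx ⊢
    exact ⟨⟨b, hb, hx.1⟩, hx.2⟩
  have h3 : U ⊆ O.biUnion (uncoveredIn S K) := by
    intro x hx
    simp only [uncoveredIn, hU, Finset.mem_sdiff, Finset.mem_biUnion, Finset.mem_range] at hx ⊢
    obtain ⟨⟨i, hi, hxi⟩, hx⟩ := hx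
    obtain ⟨o, ho, hxo⟩ := Finset.mem_biUnion.1 (hcov i hi hxi)
    exact ⟨o, ho, hxo, hx⟩
  have h4 : U.card ≤ O.card * (uncoveredIn S K b).card :=
    (Finset.card_le_card h3).trans (Finset.card_biUnion_le_card_mul _ _ _
      fun i hi => hbest i (hO i hi))
  have hp : (0 : ℝ) < O.card := by exact_mod_cast hpos
  have h4' : (U.card : ℝ) ≤ O.card * (uncoveredIn S K b).card := by exact_mod_cast h4
  have h5 := Real.add_one_le_exp (-(1 / (O.card : ℝ)))
  rw [h1, Finset.card_sdiff_of_subset h2, Nat.cast_sub (Finset.card_le_card h2)]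
  have h6 : (U.card : ℝ) / O.card ≤ (uncoveredIn S K b).card := by
    rw [div_le_iff₀ hp]; linarith
  have h7 : (U.card : ℝ) * (-(1 / (O.card : ℝ)) + 1) ≤ U.card * Real.exp (-(1 / O.card)) :=
    mul_le_mul_of_nonneg_left h5 (Nat.cast_nonneg _)
  have h8 : (U.card : ℝ) * (-(1 / (O.card : ℝ)) + 1) = U.card - U.card / O.card := by ring
  linarith

/-! ### Counting uncovered grid points in cells -/

namespace RealRAM

/-- The tables that one round of the greedy algorithm works on. -/
structure Tables where
  n : ℕ
  N : ℕ
  step : ℕ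
  sel : ℕ → ℕ
  l : ℕ → ℕ → ℕ
  h : ℕ → ℕ → ℕ
  op : ℕ → ℕ → ℕ
  wt : ℕ → ℕ → ℕ

/-- The geometric part of the tables is consistent in dimension `d`. -/
structure Tables.Valid (D : Tables) (d : ℕ) : Prop where
  l_lt : ∀ j < d, ∀ i < D.n, D.l j i < D.N
  h_lt : ∀ j < d, ∀ i < D.n, D.h j i < D.N
  l_inj : ∀ j < d, ∀ i < D.n, ∀ k < D.n, D.l j i = D.l j k → i = k
  h_inj : ∀ j < d, ∀ i < D.n, ∀ k < D.n, D.h j i = D.h j k → i = k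
  -- The shift by one reserves the value 0 for ranks at which no box opens.
  op_eq : ∀ j < d, ∀ x < D.N, ∀ i, D.op j x = i + 1 ↔ i < D.n ∧ D.l j i = x
  step_pos : 0 < D.step

/-- The grid points of positive weight in box `i`. -/
def Tables.pts (D : Tables) (d i : ℕ) : Finset (Fin d → ℕ) :=
  Fintype.piFinset fun j : Fin d => {x ∈ Finset.Ico (D.l j i) (D.h j i) | D.wt j x = 1}

/-- The grid points of positive weight in box `i` which are in no selected box. -/
def Tables.free (D : Tables) (d i : ℕ) : Finset (Fin d → ℕ) :=
  {x ∈ D.pts d i | ∀ k < D.n, D.sel k = 1 → ¬ ∀ j : Fin d, D.l j k ≤ x j ∧ x j < D.h j k}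

/-- Box `i` has an end strictly inside the `j`-th side of the cell `[a, b)`. -/
def Tables.Cuts (D : Tables) (a b : ℕ → ℕ) (j i : ℕ) : Prop :=
  (a j < D.l j i ∧ D.l j i < b j) ∨ (a j < D.h j i ∧ D.h j i < b j)

/-- Box `i` spans the cell `[a, b)` in all dimensions other than `j`. -/
def Tables.Spans (D : Tables) (d : ℕ) (a b : ℕ → ℕ) (j i : ℕ) : Prop :=
  ∀ j' < d, j' ≠ j → D.l j' i ≤ a j' ∧ b j' ≤ D.h j' i

open Classical in
/-- The coordinates below `y` of positive weight which are in no selected slab. -/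
noncomputable def Tables.gap (D : Tables) (d : ℕ) (a b : ℕ → ℕ) (j y : ℕ) : Finset ℕ :=
  {x ∈ Finset.range y | D.wt j x = 1 ∧
    ¬ ∃ k < D.n, (D.sel k = 1 ∧ D.Spans d a b j k) ∧ D.l j k ≤ x ∧ x < D.h j k}

theorem Tables.gap_mono (D : Tables) (d : ℕ) (a b : ℕ → ℕ) (j : ℕ) {y z : ℕ} (h : y ≤ z) :
    D.gap d a b j y ⊆ D.gap d a b j z := by
  classical
  exact Finset.filter_subset_filter _ (Finset.range_mono h)

theorem Tables.gap_card_le (D : Tables) (d : ℕ) (a b : ℕ → ℕ) (j y : ℕ) :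
    (D.gap d a b j y).card ≤ y := by
  classical
  exact (Finset.card_filter_le _ _).trans (Finset.card_range y).le

/-- Cells meeting the interior of at most one pair of opposite facets of each box. -/
def Tables.Separated (D : Tables) (a b : ℕ → ℕ) (j : ℕ) : Prop :=
  ∀ i < D.n, ∀ p < j, ∀ q < j, D.Cuts a b p i → D.Cuts a b q i → p = q

/-- A selected box that contains a point of the cell, but fails to span some side, has an end
strictly inside that side. Separation allows this in one dimension only, so the box is a slab, and
avoiding all slabs is a condition on each coordinate separately. The prefixes start at 0 rather than
at the cell, which cancels in the differences. -/
theorem Tables.card_free_cell (D : Tables) (d : ℕ) (hd : 1 ≤ d) (a b : ℕ → ℕ) (i : ℕ)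
    (hsep : D.Separated a b d) :
    ({x ∈ D.free d i | ∀ j : Fin d, a j ≤ x j ∧ x j < b j}).card =
      ∏ j ∈ Finset.range d, ((D.gap d a b j (min (D.h j i) (b j))).card -
        (D.gap d a b j (max (D.l j i) (a j))).card) := by
  classical
  rw [Finset.prod_range fun j => ((D.gap d a b j (min (D.h j i) (b j))).card -
        (D.gap d a b j (max (D.l j i) (a j))).card)]
  -- Prefix sets are nested, so truncated subtraction gives the size of the set difference even if
  -- the two bounds are in the wrong order.
  have key : ∀ j : Fin d, (D.gap d a b j (min (D.h j i) (b j))).card -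
      (D.gap d a b j (max (D.l j i) (a j))).card =
      (D.gap d a b j (min (D.h j i) (b j)) \ D.gap d a b j (max (D.l j i) (a j))).card := by
    intro j
    rcases le_total (max (D.l j i) (a j)) (min (D.h j i) (b j)) with h | h
    · rw [Finset.card_sdiff_of_subset (D.gap_mono d a b j h)]
    · have := D.gap_mono d a b j h
      rw [Finset.sdiff_eq_empty_iff_subset.2 this, Finset.card_empty]
      have := Finset.card_le_card this
      omega
  rw [Finset.prod_congr rfl fun j _ => key j, ← Fintype.card_piFinset]
  congr 1
  ext x
  simp only [Tables.free, Tables.pts, Tables.gap, Finset.mem_filter, Fintype.mem_piFinset,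
    Finset.mem_sdiff, Finset.mem_range, Finset.mem_Ico]
  constructor
  · rintro ⟨⟨hx, hfree⟩, hc⟩ j
    have h1 := hx j
    have h2 := hc j
    refine ⟨⟨by omega, h1.2, ?_⟩, fun h => by omega⟩
    rintro ⟨k, hk, ⟨hs, hspan⟩, hl⟩
    refine hfree k hk hs fun j' => ?_
    by_cases hj : j' = j
    · subst hj; exact hl
    · have h3 := hspan j' j'.2 (fun h => hj (Fin.ext h))
      have h4 := hc j'
      omega
  · intro hx
    have hc : ∀ j : Fin d, D.l j i ≤ x j ∧ x j < D.h j i ∧ a j ≤ x j ∧ x j < b j := by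
      intro j
      obtain ⟨⟨h1, h2, h3⟩, h4⟩ := hx j
      have h5 : ¬ x j < max (D.l j i) (a j) := fun h => h4 ⟨h, h2, h3⟩
      omega
    refine ⟨⟨fun j => ⟨⟨(hc j).1, (hc j).2.1⟩, (hx j).1.2.1⟩, ?_⟩, fun j => (hc j).2.2⟩
    intro k hk hs hin
    have hcut : ∀ j : Fin d, ¬ (D.l j k ≤ a j ∧ b j ≤ D.h j k) → D.Cuts a b j k := by
      intro j hj
      have h1 := hin j
      have h2 := hc j
      unfold Tables.Cuts
      omega
    obtain ⟨j, hj⟩ : ∃ j : Fin d, D.Spans d a b j k := by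
      by_cases h : ∃ j : Fin d, ¬ (D.l j k ≤ a j ∧ b j ≤ D.h j k)
      · obtain ⟨j, hj⟩ := h
        refine ⟨j, fun j' hj' hne => ?_⟩
        by_contra hcon
        exact hne (hsep k hk j' hj' j j.2 (hcut ⟨j', hj'⟩ hcon) (hcut j hj))
      -- A box spanning the whole cell is a slab for any dimension; dimension 0 is available.
      · push Not at h
        exact ⟨⟨0, hd⟩, fun j' hj' _ => h ⟨j', hj'⟩⟩
    exact (hx j).1.2.2 ⟨k, hk, ⟨hs, hj⟩, hin j⟩

/-- The positions at which a side of a cell may be cut in dimension `j`. -/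
noncomputable def Tables.cutSet (D : Tables) (a b : ℕ → ℕ) (j : ℕ) : Finset ℕ := by
  classical exact
    (insert D.N ((Finset.range (D.N / D.step + 1)).image (· * D.step))) ∪
      (({i ∈ Finset.range D.n | ∃ p < j, D.Cuts a b p i}).image (D.l j) ∪
        ({i ∈ Finset.range D.n | ∃ p < j, D.Cuts a b p i}).image (D.h j))

/-- An earlier side has length at most `step`, and ends of the same kind have distinct ranks. So at
most `2 * step` boxes cut that side, and each contributes its two ends in dimension `j`. -/
theorem Tables.card_cutSet_le {D : Tables} {d : ℕ} (hD : D.Valid d) (a b : ℕ → ℕ) (j : ℕ)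
    (hj : j ≤ d) (hab : ∀ p < j, b p ≤ a p + D.step) :
    (D.cutSet a b j).card ≤ D.N / D.step + 2 + 4 * j * D.step := by
  classical
  have h1 : ({i ∈ Finset.range D.n | ∃ p < j, D.Cuts a b p i} : Finset ℕ) ⊆
      (Finset.range j).biUnion fun p =>
        {i ∈ Finset.range D.n | a p < D.l p i ∧ D.l p i < b p} ∪
        {i ∈ Finset.range D.n | a p < D.h p i ∧ D.h p i < b p} := by
    intro i hi
    obtain ⟨hi, p, hp, h⟩ := Finset.mem_filter.1 hi
    simp only [Finset.mem_filter, Finset.mem_biUnion, Finset.mem_union]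
    exact ⟨p, Finset.mem_range.2 hp, h.imp (⟨hi, ·⟩) (⟨hi, ·⟩)⟩
  have h2 : ∀ p < j, ∀ f : ℕ → ℕ, (∀ i < D.n, ∀ k < D.n, f i = f k → i = k) →
      ({i ∈ Finset.range D.n | a p < f i ∧ f i < b p} : Finset ℕ).card ≤ D.step := by
    intro p hp f hf
    have h3 : ({i ∈ Finset.range D.n | a p < f i ∧ f i < b p} : Finset ℕ).card ≤
        (Finset.Ioo (a p) (b p)).card := by
      refine Finset.card_le_card_of_injOn f ?_ ?_
      · intro i hi
        simp only [Finset.coe_filter, Set.mem_ofPred_eq] at hi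
        simpa using hi.2
      · intro i hi k hk h
        simp only [Finset.coe_filter, Set.mem_ofPred_eq, Finset.mem_range] at hi hk
        exact hf i hi.1 k hk.1 h
    have h4 := hab p hp
    rw [Nat.card_Ioo] at h3
    omega
  have h3 : ({i ∈ Finset.range D.n | ∃ p < j, D.Cuts a b p i} : Finset ℕ).card ≤
      j * (2 * D.step) := by
    refine (Finset.card_le_card h1).trans ?_
    refine (Finset.card_biUnion_le_card_mul _ _ (2 * D.step) ?_).trans (by simp)
    intro p hp
    rw [Finset.mem_range] at hp
    refine (Finset.card_union_le _ _).trans ?_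
    have := h2 p hp _ (hD.l_inj p (hp.trans_le hj))
    have := h2 p hp _ (hD.h_inj p (hp.trans_le hj))
    omega
  have h4 : (insert D.N ((Finset.range (D.N / D.step + 1)).image (· * D.step))).card ≤
      D.N / D.step + 2 :=
    (Finset.card_insert_le _ _).trans (Nat.add_le_add_right
      (Finset.card_image_le.trans (Finset.card_range _).le) 1)
  unfold Tables.cutSet
  refine (Finset.card_union_le _ _).trans (Nat.add_le_add h4 ((Finset.card_union_le _ _).trans ?_))
  refine (Nat.add_le_add (Finset.card_image_le.trans h3) (Finset.card_image_le.trans h3)).trans ?_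
  exact le_of_eq (by ring)

end RealRAM

/-! ### Ranks of interval ends -/

namespace IntervalRank

/-- The position of an interval end in the order by value, then lower before upper ends, then
index. -/
noncomputable def key (lo hi : ℕ → ℝ) (e : ℕ × Bool) : ℝ ×ₗ Bool ×ₗ ℕ :=
  toLex (if e.2 then hi e.1 else lo e.1, toLex (e.2, e.1))

theorem key_injective (lo hi : ℕ → ℝ) : Function.Injective (key lo hi) := by
  rintro ⟨i, t⟩ ⟨k, u⟩ h
  have h := congrArg ofLex h
  simp only [key, ofLex_toLex, Prod.mk.injEq] at h
  have h' := congrArg ofLex h.2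
  simp only [ofLex_toLex, Prod.mk.injEq] at h'
  rw [h'.1, h'.2]

/-- The number of interval ends before `e`. -/
noncomputable def rank (lo hi : ℕ → ℝ) (n : ℕ) (e : ℕ × Bool) : ℕ :=
  ((Finset.range n ×ˢ Finset.univ).filter fun e' => key lo hi e' < key lo hi e).card

/-- Strictness comes from `e` itself, which precedes `e'` but not itself; this is why only `e` must
belong to an interval in range. -/
theorem rank_lt_iff (lo hi : ℕ → ℝ) (n : ℕ) {e : ℕ × Bool} (he : e.1 < n) (e' : ℕ × Bool) :
    rank lo hi n e < rank lo hi n e' ↔ key lo hi e < key lo hi e' := by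
  constructor
  · intro h
    by_contra hle
    refine absurd (Finset.card_le_card ?_) (not_le.2 h)
    intro f hf
    rw [Finset.mem_filter] at hf ⊢
    exact ⟨hf.1, hf.2.trans_le (not_lt.1 hle)⟩
  · intro h
    refine Finset.card_lt_card ?_
    rw [Finset.ssubset_iff_of_subset]
    · exact ⟨e, Finset.mem_filter.2 ⟨by simp [he], h⟩, by simp⟩
    · intro f hf
      rw [Finset.mem_filter] at hf ⊢
      exact ⟨hf.1, hf.2.trans h⟩

theorem rank_lt (lo hi : ℕ → ℝ) (n : ℕ) {e : ℕ × Bool} (he : e.1 < n) :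
    rank lo hi n e < 2 * n := by
  have h : (Finset.range n ×ˢ (Finset.univ : Finset Bool)).card = 2 * n := by
    simp [mul_comm]
  rw [← h]
  refine Finset.card_lt_card ?_
  rw [Finset.ssubset_iff_of_subset (Finset.filter_subset _ _)]
  exact ⟨e, by simp [he], by simp⟩

theorem rank_inj (lo hi : ℕ → ℝ) (n : ℕ) {e e' : ℕ × Bool} (he : e.1 < n) (he' : e'.1 < n)
    (h : rank lo hi n e = rank lo hi n e') : e = e' := by
  refine key_injective lo hi (le_antisymm ?_ ?_)
  · exact not_lt.1 fun hlt => h.not_gt ((rank_lt_iff lo hi n he' e).2 hlt)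
  · exact not_lt.1 fun hlt => h.not_lt ((rank_lt_iff lo hi n he e').2 hlt)

/-- This formula and the next are what the program evaluates. As lower ends precede upper ends of
equal value, the comparison between ends of different kinds is strict here and weak there. -/
theorem rank_false_eq (lo hi : ℕ → ℝ) (n i : ℕ) :
    rank lo hi n (i, false) = ∑ k ∈ Finset.range n,
      ((if lo k < lo i ∨ (lo k = lo i ∧ k < i) then 1 else 0) + if hi k < lo i then 1 else 0) := by
  rw [rank, Finset.card_filter, Finset.sum_product]
  refine Finset.sum_congr rfl fun k _ => ?_
  have hb : ¬ (true < false) := by decide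
  rw [Fintype.sum_bool, add_comm]
  simp [key, Prod.Lex.lt_iff, hb]

theorem rank_true_eq (lo hi : ℕ → ℝ) (n i : ℕ) :
    rank lo hi n (i, true) = ∑ k ∈ Finset.range n,
      ((if lo k ≤ hi i then 1 else 0) + if hi k < hi i ∨ (hi k = hi i ∧ k < i) then 1 else 0) := by
  rw [rank, Finset.card_filter, Finset.sum_product]
  refine Finset.sum_congr rfl fun k _ => ?_
  rw [Fintype.sum_bool, add_comm]
  simp [key, Prod.Lex.lt_iff, le_iff_lt_or_eq]

/-- The last interval end among those of the same kind and value. -/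
def Last (lo hi : ℕ → ℝ) (n : ℕ) (e : ℕ × Bool) : Prop :=
  e.1 < n ∧ ∀ k < n, (if e.2 then hi k = hi e.1 else lo k = lo e.1) → k ≤ e.1

/-- The ranks of last interval ends. -/
def LastRank (lo hi : ℕ → ℝ) (n x : ℕ) : Prop :=
  ∃ e, Last lo hi n e ∧ rank lo hi n e = x

/-- The intervals whose ends enclose the rank `x` are those that contain the point `p`. -/
def Stabs (lo hi : ℕ → ℝ) (n x : ℕ) (p : ℝ) : Prop :=
  ∀ k < n, (rank lo hi n (k, false) ≤ x ∧ x < rank lo hi n (k, true)) ↔ (lo k ≤ p ∧ p ≤ hi k)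

/-- A lower end is represented by its own value, an upper end by a point slightly to the right of
it. Being last ensures that all equal lower ends have been opened, respectively that all equal upper
ends have been closed, at rank `x`; other ranks may correspond to no real point. -/
theorem LastRank.exists_stabs {lo hi : ℕ → ℝ} {n x : ℕ} (h : LastRank lo hi n x) :
    ∃ p, Stabs lo hi n x p := by
  obtain ⟨⟨i, t⟩, ⟨hi', hlast⟩, rfl⟩ := h
  dsimp only at hi' hlast
  cases t with
  | false =>
    refine ⟨lo i, fun k hk => ?_⟩
    rw [← not_lt, rank_lt_iff lo hi n hi', rank_lt_iff lo hi n hi']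
    have := hlast k hk
    simp only [Bool.false_eq_true, if_false] at this
    simp only [key, Prod.Lex.lt_iff, ofLex_toLex, Bool.false_eq_true, if_false, if_true,
      lt_irrefl, false_or, true_and, Bool.false_lt_true, true_or, and_true]
    refine and_congr ⟨fun h => not_lt.1 fun h' => h (Or.inl h'), ?_⟩ le_iff_lt_or_eq.symm
    rintro h (h' | ⟨h', h''⟩)
    · exact h.not_gt h'
    · exact absurd h'' (not_lt.2 (this h'.symm))
  | true =>
    -- Points close enough to `hi i` on the right lie before all of the finitely many greater ends.
    have hev : ∀ᶠ p in nhdsWithin (hi i) (Set.Ioi (hi i)), hi i < p ∧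
        ∀ k ∈ Finset.range n, (hi i < lo k → p < lo k) ∧ (hi i < hi k → p < hi k) := by
      refine Filter.Eventually.and self_mem_nhdsWithin ?_
      rw [Filter.eventually_all_finset]
      intro k _
      have haux : ∀ v, ∀ᶠ p in nhdsWithin (hi i) (Set.Ioi (hi i)), hi i < v → p < v := by
        intro v
        by_cases hv : hi i < v
        · filter_upwards [Ioo_mem_nhdsGT hv] with p hp _ using hp.2
        · exact Filter.Eventually.of_forall fun p h => absurd h hv
      exact (haux _).and (haux _)
    obtain ⟨p, hp, hpk⟩ := hev.exists
    refine ⟨p, fun k hk => ?_⟩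
    obtain ⟨hp1, hp2⟩ := hpk k (Finset.mem_range.2 hk)
    rw [← not_lt, rank_lt_iff lo hi n hi', rank_lt_iff lo hi n hi']
    have := hlast k hk
    simp only [if_true] at this
    simp only [key, Prod.Lex.lt_iff, ofLex_toLex, Bool.false_eq_true, if_false, if_true,
      lt_irrefl, false_or, true_and]
    refine and_congr ⟨fun h => ?_, fun h => ?_⟩ ⟨?_, fun h => ?_⟩
    · exact (not_lt.1 fun h' => h (Or.inl h')).trans hp.le
    · rintro (h' | ⟨h', h'' | h''⟩)
      · exact h.not_gt (hp1 h')
      · exact absurd h'' (by decide)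
      · exact absurd h''.1 (by decide)
    · rintro (h | ⟨h, h'⟩)
      · exact (hp2 h).le
      · exact absurd h' (not_lt.2 (this h.symm))
    · exact Or.inl (hp.trans_le h)

/-- The rank wanted is that of the last end passed on the way to `p`: a lower end is passed when it
is at most `p`, an upper end only when it is below `p`. Maximality makes this end the last of its
equals and separates passed from unpassed ends. -/
theorem exists_lastRank {lo hi : ℕ → ℝ} {n b : ℕ} {p : ℝ} (hb : b < n) (hlo : lo b ≤ p) :
    ∃ x, LastRank lo hi n x ∧ Stabs lo hi n x p := by
  classical
  set E : Finset (ℕ × Bool) := (Finset.range n ×ˢ Finset.univ).filter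
    fun e => if e.2 then hi e.1 < p else lo e.1 ≤ p with hE
  have hmem : ∀ e : ℕ × Bool, e ∈ E ↔ e.1 < n ∧ if e.2 then hi e.1 < p else lo e.1 ≤ p := by
    intro e
    simp [hE]
  obtain ⟨⟨i, t⟩, he, hmax⟩ := E.exists_max_image (rank lo hi n) ⟨(b, false), by simp [hmem, hb, hlo]⟩
  obtain ⟨hin, het⟩ := (hmem _).1 he
  dsimp only at hin het
  refine ⟨_, ⟨(i, t), ⟨hin, fun k hk hkt => ?_⟩, rfl⟩, fun k hk => and_congr ⟨fun h => ?_, fun h => ?_⟩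
    ⟨fun h => ?_, fun h => ?_⟩⟩
  · have hkE : (k, t) ∈ E := by
      rw [hmem]
      refine ⟨hk, ?_⟩
      cases t <;> simp_all
    have h1 := hmax _ hkE
    by_contra hlt
    refine absurd h1 (not_le.2 ((rank_lt_iff lo hi n hin _).2 ?_))
    cases t <;> simp_all [key, Prod.Lex.lt_iff]
  · have h1 := mt (rank_lt_iff lo hi n hin _).2 (not_lt.2 h)
    by_contra hlt
    rw [not_le] at hlt
    refine h1 ?_
    cases t
    · simpa [key, Prod.Lex.lt_iff] using Or.inl (lt_of_le_of_lt (by simpa using het) hlt)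
    · simpa [key, Prod.Lex.lt_iff] using Or.inl (lt_trans (by simpa using het) hlt)
  · exact hmax _ ((hmem _).2 ⟨hk, by simpa using h⟩)
  · by_contra hlt
    rw [not_le] at hlt
    exact absurd (hmax _ ((hmem (k, true)).2 ⟨hk, by simpa using hlt⟩)) (not_le.2 h)
  · refine (rank_lt_iff lo hi n hin _).2 ?_
    cases t
    · simpa [key, Prod.Lex.lt_iff] using le_iff_lt_or_eq.1 (le_trans (by simpa using het) h)
    · simpa [key, Prod.Lex.lt_iff] using Or.inl (lt_of_lt_of_le (by simpa using het) h)

end IntervalRank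

/-! ### Coverage kernels as covers of the weighted rank grid -/

namespace RealRAM

/-- Lower end of box `i` in dimension `j`. -/
noncomputable def lower {d n : ℕ} (B : Fin n → Box d) (j i : ℕ) : ℝ :=
  (inputState B).real 0 (i * d + j)

/-- Upper end of box `i` in dimension `j`. -/
noncomputable def upper {d n : ℕ} (B : Fin n → Box d) (j i : ℕ) : ℝ :=
  (inputState B).real 1 (i * d + j)

theorem lower_eq {d n : ℕ} (B : Fin n → Box d) (j : Fin d) (i : Fin n) :
    lower B j i = (B i).fst j := by
  have h : (i : ℕ) * d + j < n * d := by
    have h1 := j.2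
    have h2 : ((i : ℕ) + 1) * d ≤ n * d := Nat.mul_le_mul_right d i.2
    rw [Nat.add_mul] at h2
    omega
  have h1 : Fin.divNat ⟨i * d + j, h⟩ = i := by
    ext
    simp only [Fin.divNat]
    rw [Nat.mul_comm, Nat.mul_add_div (by have := j.2; omega), Nat.div_eq_of_lt j.2, add_zero]
  have h2 : Fin.modNat ⟨i * d + j, h⟩ = j := by
    ext
    simp only [Fin.modNat]
    rw [Nat.mul_comm, Nat.mul_add_mod, Nat.mod_eq_of_lt j.2]
  simp [lower, inputState, h, h1, h2]

theorem upper_eq {d n : ℕ} (B : Fin n → Box d) (j : Fin d) (i : Fin n) :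
    upper B j i = (B i).snd j := by
  have h : (i : ℕ) * d + j < n * d := by
    have h1 := j.2
    have h2 : ((i : ℕ) + 1) * d ≤ n * d := Nat.mul_le_mul_right d i.2
    rw [Nat.add_mul] at h2
    omega
  have h1 : Fin.divNat ⟨i * d + j, h⟩ = i := by
    ext
    simp only [Fin.divNat]
    rw [Nat.mul_comm, Nat.mul_add_div (by have := j.2; omega), Nat.div_eq_of_lt j.2, add_zero]
  have h2 : Fin.modNat ⟨i * d + j, h⟩ = j := by
    ext
    simp only [Fin.modNat]
    rw [Nat.mul_comm, Nat.mul_add_mod, Nat.mod_eq_of_lt j.2]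
  simp [upper, inputState, h, h1, h2]

theorem mem_box_iff {d n : ℕ} (B : Fin n → Box d) (i : Fin n) (p : Fin d → ℝ) :
    p ∈ (B i : Set (Fin d → ℝ)) ↔ ∀ j : Fin d, lower B j i ≤ p j ∧ p j ≤ upper B j i := by
  simp only [lower_eq, upper_eq]
  rw [SetLike.mem_coe, NonemptyInterval.mem_def, Pi.le_def, Pi.le_def, forall_and]

/-- The tables describe the rank space of the boxes `B`. -/
structure Tables.Describes (D : Tables) {d n : ℕ} (B : Fin n → Box d) : Prop where
  n_eq : D.n = n
  l_eq : ∀ j < d, ∀ i < n, D.l j i = IntervalRank.rank (lower B j) (upper B j) n (i, false)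
  h_eq : ∀ j < d, ∀ i < n, D.h j i = IntervalRank.rank (lower B j) (upper B j) n (i, true)
  wt_eq : ∀ j < d, ∀ x, D.wt j x = 1 ↔ IntervalRank.LastRank (lower B j) (upper B j) n x

theorem Tables.Describes.mem_pts {D : Tables} {d n : ℕ} {B : Fin n → Box d} (hD : D.Describes B)
    (i : Fin n) (x : Fin d → ℕ) (p : Fin d → ℝ)
    (hx : ∀ j : Fin d, IntervalRank.LastRank (lower B j) (upper B j) n (x j))
    (hp : ∀ j : Fin d, IntervalRank.Stabs (lower B j) (upper B j) n (x j) (p j)) :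
    x ∈ D.pts d i ↔ p ∈ (B i : Set (Fin d → ℝ)) := by
  rw [mem_box_iff]
  simp only [Tables.pts, Fintype.mem_piFinset, Finset.mem_filter, Finset.mem_Ico]
  refine forall_congr' fun j => ?_
  rw [hD.wt_eq j j.2, and_iff_left (hx j), hD.l_eq j j.2 i i.2, hD.h_eq j j.2 i i.2]
  exact hp j i i.2

theorem isCoverageKernel_iff_forall {d n : ℕ} (B : Fin n → Box d) (K : Finset (Fin n)) :
    IsCoverageKernel B K ↔
      ∀ b p, p ∈ (B b : Set (Fin d → ℝ)) → ∃ k ∈ K, p ∈ (B k : Set (Fin d → ℝ)) := by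
  unfold IsCoverageKernel coveredRegion
  constructor
  · intro h b p hp
    have : p ∈ ⋃ i ∈ Finset.univ, (B i : Set (Fin d → ℝ)) :=
      Set.mem_iUnion₂.2 ⟨b, Finset.mem_univ b, hp⟩
    rw [← h] at this
    simpa using Set.mem_iUnion₂.1 this
  · intro h
    refine Set.Subset.antisymm ?_ ?_
    · exact Set.biUnion_subset_biUnion_left fun _ _ => Finset.mem_univ _
    · intro p hp
      obtain ⟨b, -, hb⟩ := Set.mem_iUnion₂.1 hp
      obtain ⟨k, hk, hpk⟩ := h b p hb
      exact Set.mem_iUnion₂.2 ⟨k, hk, hpk⟩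

/-- Every weighted grid point has a real point in exactly the same boxes, and every real point in
some box has such a grid point. Both are chosen coordinate by coordinate, since boxes are products.
-/
theorem Tables.Describes.isCoverageKernel_iff {D : Tables} {d n : ℕ} {B : Fin n → Box d}
    (hD : D.Describes B) (K : Finset (Fin n)) :
    IsCoverageKernel B K ↔ ∀ i < n, D.pts d i ⊆ (K.map Fin.valEmbedding).biUnion (D.pts d) := by
  rw [isCoverageKernel_iff_forall]
  constructor
  · intro h i hi x hx
    have hl : ∀ j : Fin d, IntervalRank.LastRank (lower B j) (upper B j) n (x j) := by
      intro j
      rw [← hD.wt_eq j j.2]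
      exact (Finset.mem_filter.1 (Fintype.mem_piFinset.1 hx j)).2
    choose p hp using fun j => (hl j).exists_stabs
    obtain ⟨k, hk, hpk⟩ := h ⟨i, hi⟩ p ((hD.mem_pts ⟨i, hi⟩ x p hl hp).1 hx)
    rw [Finset.mem_biUnion]
    exact ⟨k, Finset.mem_map_of_mem _ hk, (hD.mem_pts k x p hl hp).2 hpk⟩
  · intro h b p hpb
    choose x hl hs using fun j : Fin d => IntervalRank.exists_lastRank (lo := lower B j)
      (hi := upper B j) (p := p j) b.2 ((mem_box_iff B b p).1 hpb j).1
    have := h b b.2 ((hD.mem_pts b x p hl hs).2 hpb)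
    rw [Finset.mem_biUnion] at this
    obtain ⟨k, hk, hxk⟩ := this
    obtain ⟨k', hk', rfl⟩ := Finset.mem_map.1 hk
    exact ⟨k', hk', (hD.mem_pts k' x p hl hs).1 hxk⟩


/-! ### Frames -/

/-- The states differ at most in the word arrays `reg k j` with `M k j`. -/
def Agree (M : ℕ → ℕ → Prop) (s s' : State) : Prop :=
  (∀ k j, ¬ M k j → s'.word (reg k j) = s.word (reg k j)) ∧ s'.real = s.real

theorem Agree.refl (M : ℕ → ℕ → Prop) (s : State) : Agree M s s := ⟨fun _ _ _ => rfl, rfl⟩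

theorem Agree.trans {M M' M'' : ℕ → ℕ → Prop} {s s' s'' : State} (h : Agree M s s')
    (h' : Agree M' s' s'') (hM : ∀ k j, M k j → M'' k j) (hM' : ∀ k j, M' k j → M'' k j) :
    Agree M'' s s'' :=
  ⟨fun k j hk => (h'.1 k j (mt (hM' k j) hk)).trans (h.1 k j (mt (hM k j) hk)), h'.2.trans h.2⟩

theorem Agree.setWord {M : ℕ → ℕ → Prop} {s s' : State} (h : Agree M s s') {k j : ℕ} (i v : ℕ)
    (hM : M k j) : Agree M s (s'.setWord (reg k j) i v) := by
  refine ⟨fun k' j' hk => ?_, h.2⟩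
  rw [setWord_word_ne, h.1 k' j' hk]
  rw [Ne, reg_inj]
  rintro ⟨rfl, rfl⟩
  exact hk hM

theorem Agree.mono {M M' : ℕ → ℕ → Prop} {s s' : State} (h : Agree M s s')
    (hM : ∀ k j, M k j → M' k j) : Agree M' s s' :=
  h.trans (Agree.refl M' s') hM fun _ _ h => h

/-- The memory holds the tables `D`. -/
structure Tables.Holds (D : Tables) (s : State) : Prop where
  n_eq : s.word (reg 1 0) 0 = D.n
  N_eq : s.word (reg 2 0) 0 = D.N
  step_eq : s.word (reg 3 0) 0 = D.step
  sel_eq : s.word (reg 4 0) = D.sel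
  l_eq : ∀ j, s.word (reg 5 j) = D.l j
  h_eq : ∀ j, s.word (reg 6 j) = D.h j
  op_eq : ∀ j, s.word (reg 7 j) = D.op j
  wt_eq : ∀ j, s.word (reg 8 j) = D.wt j

/-- The tables live in the families 1 to 8; code that writes only to higher families preserves them.
-/
theorem Tables.Holds.agree {D : Tables} {M : ℕ → ℕ → Prop} {s s' : State} (hD : D.Holds s)
    (h : Agree M s s') (hM : ∀ k j, M k j → 8 < k) : D.Holds s' := by
  have h' : ∀ k j, k ≤ 8 → s'.word (reg k j) = s.word (reg k j) := fun k j hk =>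
    h.1 k j fun hk' => absurd (hM k j hk') (not_lt.2 hk)
  constructor
  · rw [h' _ _ (by norm_num), hD.n_eq]
  · rw [h' _ _ (by norm_num), hD.N_eq]
  · rw [h' _ _ (by norm_num), hD.step_eq]
  · rw [h' _ _ (by norm_num), hD.sel_eq]
  · intro j; rw [h' _ _ (by norm_num), hD.l_eq]
  · intro j; rw [h' _ _ (by norm_num), hD.h_eq]
  · intro j; rw [h' _ _ (by norm_num), hD.op_eq]
  · intro j; rw [h' _ _ (by norm_num), hD.wt_eq]

/-- The lower ends of the current cell. -/
def State.cellLo (s : State) (j : ℕ) : ℕ := s.word (reg 9 j) 0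

/-- The upper ends of the current cell. -/
def State.cellHi (s : State) (j : ℕ) : ℕ := s.word (reg 10 j) 0

/-! ### Expressions -/

/-- The cell of `reg k j` with address `e`. -/
def WordExpr.at (k j : ℕ) (e : WordExpr) : WordExpr := .read (reg k j) e

@[simp] theorem eval_at (w : ℕ) (s : State) (k j : ℕ) (e : WordExpr) :
    (WordExpr.at k j e).eval w s = s.word (reg k j) (e.eval w s) := rfl

/-- The maximum of two words. -/
def WordExpr.max (x y : WordExpr) : WordExpr := .add x (.sub y x)

/-- The minimum of two words. -/
def WordExpr.min (x y : WordExpr) : WordExpr := .sub x (.sub x y)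

/-- With truncated subtraction `x + (y - x)` is the maximum, and it is a word again, so the addition
does not wrap. -/
theorem eval_max {w : ℕ} {s : State} {x y : WordExpr} (hx : x.eval w s < 2 ^ w)
    (hy : y.eval w s < 2 ^ w) :
    (WordExpr.max x y).eval w s = Max.max (x.eval w s) (y.eval w s) := by
  simp only [WordExpr.max, WordExpr.eval]
  rw [Nat.mod_eq_of_lt] <;> omega

@[simp] theorem eval_min (w : ℕ) (s : State) (x y : WordExpr) :
    (WordExpr.min x y).eval w s = Min.min (x.eval w s) (y.eval w s) := by
  simp only [WordExpr.min, WordExpr.eval]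
  omega

theorem eval_lit {w k : ℕ} (h : k < 2 ^ w) (s : State) : (WordExpr.lit k).eval w s = k :=
  Nat.mod_eq_of_lt h

theorem eval_add {w : ℕ} {s : State} {x y : WordExpr} (h : x.eval w s + y.eval w s < 2 ^ w) :
    (WordExpr.add x y).eval w s = x.eval w s + y.eval w s :=
  Nat.mod_eq_of_lt h

theorem eval_mul {w : ℕ} {s : State} {x y : WordExpr} (h : x.eval w s * y.eval w s < 2 ^ w) :
    (WordExpr.mul x y).eval w s = x.eval w s * y.eval w s :=
  Nat.mod_eq_of_lt h

@[simp] theorem eval_sub (w : ℕ) (s : State) (x y : WordExpr) :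
    (WordExpr.sub x y).eval w s = x.eval w s - y.eval w s := rfl

/-- Does box `e` span the current cell in all dimensions below `m` other than `j`? -/
def spanTest (j : ℕ) (e : WordExpr) : ℕ → Test
  | 0 => .wordEq (.lit 0) (.lit 0)
  | m + 1 => if m = j then spanTest j e m else
      .and (spanTest j e m) (.and (.not (.wordLt (.var 9 m) (.at 5 m e)))
        (.not (.wordLt (.at 6 m e) (.var 10 m))))

theorem holds_spanTest {D : Tables} {w : ℕ} {s : State} (hD : D.Holds s) (j : ℕ) (e : WordExpr)
    (m : ℕ) : (spanTest j e m).holds w s ↔ D.Spans m s.cellLo s.cellHi j (e.eval w s) := by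
  induction m with
  | zero => simp [spanTest, Test.holds, Tables.Spans]
  | succ m ih =>
    by_cases hm : m = j
    · rw [spanTest, if_pos hm, ih]
      subst hm
      refine ⟨fun h p hp hpj => h p (by omega) hpj, fun h p hp hpj => h p (by omega) hpj⟩
    · rw [spanTest, if_neg hm]
      simp only [Test.holds, ih, eval_var, eval_at, hD.l_eq, hD.h_eq, not_lt]
      constructor
      · rintro ⟨h, h'⟩ p hp hpj
        rcases Nat.lt_succ_iff_lt_or_eq.1 hp with h'' | rfl
        · exact h p h'' hpj
        · exact h'
      · exact fun h => ⟨fun p hp => h p (by omega), h m (by omega) hm⟩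

/-! ### Processing a cell -/

/-- One step of the scan of dimension `j`. -/
def scanBody (d j : ℕ) : Program :=
  -- Family 12 holds the reach: the greatest upper end of a selected slab opened so far. If no box
  -- opens here, the index computed below truncates to 0, which is harmless because the first test
  -- fails.
  .seq (.ite (.and (.not (.wordEq (.at 7 j (.var 13 0)) (.lit 0)))
      (.and (.wordEq (.at 4 0 (.sub (.at 7 j (.var 13 0)) (.lit 1))) (.lit 1))
        (spanTest j (.sub (.at 7 j (.var 13 0)) (.lit 1)) d)))
    (.setWord (reg 12 0) (.lit 0)
      (.max (.var 12 0) (.at 6 j (.sub (.at 7 j (.var 13 0)) (.lit 1))))) .skip)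
    (.ite (.and (.wordEq (.at 8 j (.var 13 0)) (.lit 1)) (.not (.wordLt (.var 13 0) (.var 12 0))))
      (.setWord (reg 11 j) (.add (.var 13 0) (.lit 1)) (.add (.at 11 j (.var 13 0)) (.lit 1)))
      (.setWord (reg 11 j) (.add (.var 13 0) (.lit 1)) (.at 11 j (.var 13 0))))

/-- Compute the prefix counts of uncovered coordinates of dimension `j`. -/
def scan (d j : ℕ) : Program :=
  .seq (.setWord (reg 11 j) (.lit 0) (.lit 0))
    (.seq (.setWord (reg 12 0) (.lit 0) (.lit 0)) (forLoop 13 2 (scanBody d j)))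

/-- The time taken by `scan`. -/
def scanTime (N d j : ℕ) : ℕ := 3 + (3 + (((scanBody d j).bound + 11) * N + 8))

theorem scanBody_loopFree (d j : ℕ) : (scanBody d j).LoopFree := by
  simp [scanBody, Program.LoopFree]

theorem card_gap_succ (D : Tables) (d : ℕ) (a b : ℕ → ℕ) (j x : ℕ) :
    (D.wt j x = 1 ∧ (¬ ∃ k < D.n, (D.sel k = 1 ∧ D.Spans d a b j k) ∧ D.l j k ≤ x ∧ x < D.h j k) →
      (D.gap d a b j (x + 1)).card = (D.gap d a b j x).card + 1) ∧
    (¬ (D.wt j x = 1 ∧ ¬ ∃ k < D.n, (D.sel k = 1 ∧ D.Spans d a b j k) ∧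
      D.l j k ≤ x ∧ x < D.h j k) →
      (D.gap d a b j (x + 1)).card = (D.gap d a b j x).card) := by
  classical
  unfold Tables.gap
  rw [Finset.range_add_one, Finset.filter_insert]
  constructor
  · intro h
    rw [if_pos h, Finset.card_insert_of_notMem (by simp)]
  · intro h
    rw [if_neg h]

/-- Slabs are opened in the order of their lower ends. So a coordinate `x` lies in some slab exactly
if it is below the greatest upper end among the slabs opened at or before `x`. -/
theorem runs_scan {D : Tables} {d w : ℕ} (hD : D.Valid d) (hN : D.N + 2 < 2 ^ w) {j : ℕ}
    (hj : j < d) {s : State} (hs : D.Holds s) :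
    Runs w (scan d j) s (scanTime D.N d j) (fun s' =>
      Agree (fun k j' => (k = 11 ∧ j' = j) ∨ k = 12 ∨ k = 13) s s' ∧
      ∀ y ≤ D.N, s'.word (reg 11 j) y = (D.gap d s.cellLo s.cellHi j y).card) := by
  classical
  set F : ℕ → Prop := fun k => D.sel k = 1 ∧ D.Spans d s.cellLo s.cellHi j k with hF
  refine Runs.seq (Q₁ := fun s₁ => s₁ = s.setWord (reg 11 j) 0 0)
    ⟨3, _, .setWord _ _ _ _, le_rfl, by simp [WordExpr.eval]⟩ ?_
  rintro s₁ rfl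
  refine Runs.seq (Q₁ := fun s₁ => s₁ = (s.setWord (reg 11 j) 0 0).setWord (reg 12 0) 0 0)
    ⟨3, _, .setWord _ _ _ _, le_rfl, by simp [WordExpr.eval]⟩ ?_
  rintro s₁ rfl
  refine Runs.mono (Runs.forLoop (m := D.N) (T := (scanBody d j).bound) (by omega) (fun x s' =>
      Agree (fun k j' => (k = 11 ∧ j' = j) ∨ k = 12 ∨ k = 13) s s' ∧
      s'.word (reg 13 0) 0 = x ∧
      (∀ y ≤ x, s'.word (reg 11 j) y = (D.gap d s.cellLo s.cellHi j y).card) ∧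
      s'.word (reg 12 0) 0 < 2 ^ w ∧
      -- Required for all `y`, this says that the reach is the maximum of the upper ends, or 0 if
      -- there are none.
      ∀ y, y < s'.word (reg 12 0) 0 ↔ ∃ k < D.n, F k ∧ D.l j k < x ∧ y < D.h j k)
    ?_ ?_ ?_) le_rfl ?_
  · rintro x s' ⟨h1, h2, -⟩
    exact ⟨h2, (hs.agree h1 (by omega)).N_eq⟩
  · rintro x s' hx ⟨hA, hv, hG, hr, hR⟩
    refine runs_of_loopFree (scanBody_loopFree d j) ?_
    have hs' : D.Holds s' := hs.agree hA (by omega)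
    have hlo : s'.cellLo = s.cellLo := funext fun p => by
      unfold State.cellLo; rw [hA.1 9 p (by omega)]
    have hhi : s'.cellHi = s.cellHi := funext fun p => by
      unfold State.cellHi; rw [hA.1 10 p (by omega)]
    have hl1 : ∀ s'' : State, (WordExpr.lit 1).eval w s'' = 1 := eval_lit (by omega)
    have hl0 : ∀ s'' : State, (WordExpr.lit 0).eval w s'' = 0 := eval_lit (by omega)
    set c := D.op j x with hc
    -- the state after the update of the reach
    obtain ⟨s₂, hrun, hA₂, hv₂, hG₂, hr₂, hR₂⟩ : ∃ s₂, (Program.ite (.and (.not (.wordEq (.at 7 j (.var 13 0)) (.lit 0)))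
      (.and (.wordEq (.at 4 0 (.sub (.at 7 j (.var 13 0)) (.lit 1))) (.lit 1))
        (spanTest j (.sub (.at 7 j (.var 13 0)) (.lit 1)) d)))
        (.setWord (reg 12 0) (.lit 0)
          (.max (.var 12 0) (.at 6 j (.sub (.at 7 j (.var 13 0)) (.lit 1))))) .skip).run w s' = s₂ ∧
        Agree (fun k j' => (k = 11 ∧ j' = j) ∨ k = 12 ∨ k = 13) s s₂ ∧
        s₂.word (reg 13 0) 0 = x ∧ s₂.word (reg 11 j) = s'.word (reg 11 j) ∧
        s₂.word (reg 12 0) 0 < 2 ^ w ∧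
        ∀ y, y < s₂.word (reg 12 0) 0 ↔ ∃ k < D.n, F k ∧ D.l j k < x + 1 ∧ y < D.h j k := by
      refine ⟨_, rfl, ?_⟩
      simp only [Program.run, Test.holds, eval_at, eval_var, eval_sub, hl1, hl0, hv,
        holds_spanTest hs', hlo, hhi, hs'.op_eq, hs'.sel_eq, ← hc]
      split_ifs with hcond
      · obtain ⟨h0, hFk⟩ := hcond
        obtain ⟨k, hk⟩ : ∃ k, c = k + 1 := ⟨c - 1, by omega⟩
        obtain ⟨hkn, hkl⟩ := (hD.op_eq j hj x hx k).1 (hc ▸ hk)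
        have hck : c - 1 = k := by omega
        have hhk := hD.h_lt j hj k hkn
        have hmax : (WordExpr.max (.var 12 0) (.at 6 j (.sub (.at 7 j (.var 13 0)) (.lit 1)))).eval
            w s' = Max.max (s'.word (reg 12 0) 0) (D.h j k) := by
          rw [eval_max (by simpa using hr)] <;>
            simp only [eval_at, eval_var, eval_sub, hl1, hv, hs'.op_eq, ← hc, hck, hs'.h_eq]
          omega
        rw [hck] at hFk
        refine ⟨hA.setWord _ _ (by omega), ?_, ?_, ?_, ?_⟩
        · simp [setWord_word, hv]
        · rw [setWord_word_ne]; simp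
        · simp only [setWord_word, and_self, if_true, hmax]; omega
        · intro y
          simp only [setWord_word, and_self, if_true, hmax, lt_max_iff, hR]
          constructor
          · rintro (⟨i, hi, hFi, hil, hih⟩ | h)
            · exact ⟨i, hi, hFi, by omega, hih⟩
            · exact ⟨k, hkn, hFk, by omega, h⟩
          · rintro ⟨i, hi, hFi, hil, hih⟩
            rcases Nat.lt_succ_iff_lt_or_eq.1 hil with h | h
            · exact Or.inl ⟨i, hi, hFi, h, hih⟩
            -- At most one box opens at each rank, so the single lookup misses nothing.
            · obtain rfl := hD.l_inj j hj i hi k hkn (h.trans hkl.symm)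
              exact Or.inr hih
      · refine ⟨hA, hv, rfl, hr, fun y => ?_⟩
        rw [hR]
        constructor
        · rintro ⟨i, hi, hFi, hil, hih⟩
          exact ⟨i, hi, hFi, by omega, hih⟩
        · rintro ⟨i, hi, hFi, hil, hih⟩
          refine ⟨i, hi, hFi, ?_, hih⟩
          rcases Nat.lt_succ_iff_lt_or_eq.1 hil with h | h
          · exact h
          · have := (hD.op_eq j hj x hx i).2 ⟨hi, h⟩
            refine absurd ⟨?_, ?_⟩ hcond
            · omega
            · rw [show c - 1 = i by omega]; exact hFi
    have hrun' : (scanBody d j).run w s' = (Program.ite (.and (.wordEq (.at 8 j (.var 13 0)) (.lit 1))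
        (.not (.wordLt (.var 13 0) (.var 12 0))))
      (.setWord (reg 11 j) (.add (.var 13 0) (.lit 1)) (.add (.at 11 j (.var 13 0)) (.lit 1)))
      (.setWord (reg 11 j) (.add (.var 13 0) (.lit 1)) (.at 11 j (.var 13 0)))).run w s₂ := by
      rw [← hrun]; rfl
    rw [hrun']
    have hs₂ : D.Holds s₂ := hs.agree hA₂ (by omega)
    have hx1 : (WordExpr.add (.var 13 0) (.lit 1)).eval w s₂ = x + 1 := by
      rw [eval_add] <;> simp only [eval_var, hv₂, hl1]
      omega
    have hgx := hG x le_rfl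
    have hcard := D.gap_card_le d s.cellLo s.cellHi j x
    have hg1 : (WordExpr.add (.at 11 j (.var 13 0)) (.lit 1)).eval w s₂ =
        (D.gap d s.cellLo s.cellHi j x).card + 1 := by
      rw [eval_add] <;> simp only [eval_at, eval_var, hv₂, hl1, hG₂, hgx]
      omega
    obtain ⟨hc1, hc2⟩ := card_gap_succ D d s.cellLo s.cellHi j x
    have hRx : x < s₂.word (reg 12 0) 0 ↔ ∃ k < D.n, F k ∧ D.l j k ≤ x ∧ x < D.h j k := by
      rw [hR₂]; simp only [Nat.lt_succ_iff]
    have hfin : ∀ v, v = (D.gap d s.cellLo s.cellHi j (x + 1)).card →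
        (s₂.setWord (reg 11 j) (x + 1) v).word (reg 13 0) 0 = x ∧
        Agree (fun k j' => (k = 11 ∧ j' = j) ∨ k = 12 ∨ k = 13) s
          ((s₂.setWord (reg 11 j) (x + 1) v).setWord (reg 13 0) 0 (x + 1)) ∧
        ((s₂.setWord (reg 11 j) (x + 1) v).setWord (reg 13 0) 0 (x + 1)).word (reg 13 0) 0 = x + 1 ∧
        (∀ y ≤ x + 1, ((s₂.setWord (reg 11 j) (x + 1) v).setWord (reg 13 0) 0 (x + 1)).word
          (reg 11 j) y = (D.gap d s.cellLo s.cellHi j y).card) ∧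
        ((s₂.setWord (reg 11 j) (x + 1) v).setWord (reg 13 0) 0 (x + 1)).word (reg 12 0) 0 < 2 ^ w ∧
        ∀ y, y < ((s₂.setWord (reg 11 j) (x + 1) v).setWord (reg 13 0) 0 (x + 1)).word (reg 12 0) 0 ↔
          ∃ k < D.n, F k ∧ D.l j k < x + 1 ∧ y < D.h j k := by
      rintro v rfl
      refine ⟨by simp [setWord_word, hv₂], (hA₂.setWord _ _ (by simp)).setWord _ _ (by simp),
        by simp [setWord_word], ?_, by simpa [setWord_word] using hr₂,
        by simpa [setWord_word] using hR₂⟩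
      intro y hy
      by_cases hyx : y = x + 1
      · subst hyx; simp [setWord_word]
      · simp [setWord_word, hyx, hG₂, hG y (by omega)]
    simp only [Program.run, Test.holds, eval_at, eval_var, hl1, hv₂, hs₂.wt_eq, hx1, hg1, hRx, hG₂,
      hgx]
    split_ifs with hcond
    · exact hfin _ (hc1 hcond).symm
    · exact hfin _ (hc2 hcond).symm
  · refine ⟨(((Agree.refl _ s).setWord _ _ ?_).setWord _ _ ?_).setWord _ _ ?_, ?_, ?_, ?_, ?_⟩
    · simp
    · simp
    · simp
    · simp [setWord_word]
    · intro y hy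
      obtain rfl : y = 0 := by omega
      simp [setWord_word, Tables.gap]
    · simp [setWord_word]
    · simp [setWord_word]
  · rintro s' ⟨h1, h2, h3, -⟩
    exact ⟨h1, h3⟩


/-- Scan all dimensions below `m`. -/
def scanAll (d : ℕ) : ℕ → Program
  | 0 => .skip
  | m + 1 => .seq (scanAll d m) (scan d m)

/-- The time taken by `scanAll`. -/
def scanAllTime (N d : ℕ) : ℕ → ℕ
  | 0 => 1
  | m + 1 => scanAllTime N d m + scanTime N d m

theorem runs_scanAll {D : Tables} {d w : ℕ} (hD : D.Valid d) (hN : D.N + 2 < 2 ^ w) {s : State}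
    (hs : D.Holds s) (m : ℕ) (hm : m ≤ d) :
    Runs w (scanAll d m) s (scanAllTime D.N d m) (fun s' =>
      Agree (fun k _ => k = 11 ∨ k = 12 ∨ k = 13) s s' ∧
      ∀ j < m, ∀ y ≤ D.N, s'.word (reg 11 j) y = (D.gap d s.cellLo s.cellHi j y).card) := by
  induction m with
  | zero => exact ⟨1, s, .skip s, le_rfl, Agree.refl _ _, by omega⟩
  | succ m ih =>
    refine Runs.seq (ih (by omega)) ?_
    rintro s₁ ⟨hA, hG⟩
    have hlo : s₁.cellLo = s.cellLo := funext fun p => by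
      unfold State.cellLo; rw [hA.1 9 p (by omega)]
    have hhi : s₁.cellHi = s.cellHi := funext fun p => by
      unfold State.cellHi; rw [hA.1 10 p (by omega)]
    refine Runs.mono (runs_scan hD hN (j := m) (by omega) (hs.agree hA (by omega))) le_rfl ?_
    rintro s₂ ⟨hA₂, hG₂⟩
    rw [hlo, hhi] at hG₂
    refine ⟨hA.trans hA₂ (by omega) (by omega), fun j hj y hy => ?_⟩
    rcases Nat.lt_succ_iff_lt_or_eq.1 hj with h | rfl
    · rw [hA₂.1 11 j (by omega), hG j h y hy]
    · exact hG₂ y hy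

/-- The number of uncovered coordinates of box `i` in the `j`-th side of the cell. -/
def sideExpr (j : ℕ) : WordExpr :=
  .sub (.at 11 j (.min (.at 6 j (.var 14 0)) (.var 10 j)))
    (.at 11 j (.max (.at 5 j (.var 14 0)) (.var 9 j)))

/-- The product of the first `m` side counts. -/
def prodExpr : ℕ → WordExpr
  | 0 => .lit 1
  | m + 1 => .mul (prodExpr m) (sideExpr m)

/-- Partial products are bounded by powers of `W`, so no multiplication wraps. -/
theorem eval_prodExpr {w W : ℕ} {s : State} (f : ℕ → ℕ) (m : ℕ) (hW : 0 < W)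
    (hf : ∀ j < m, (sideExpr j).eval w s = f j ∧ f j ≤ W) (h : W ^ m < 2 ^ w) :
    (prodExpr m).eval w s = ∏ j ∈ Finset.range m, f j ∧ ∏ j ∈ Finset.range m, f j ≤ W ^ m := by
  induction m with
  | zero => simpa [prodExpr] using eval_lit (by simpa using h) s
  | succ m ih =>
    obtain ⟨h1, h2⟩ := ih (fun j hj => hf j (by omega))
      ((Nat.pow_le_pow_right hW (Nat.le_succ m)).trans_lt h)
    obtain ⟨h3, h4⟩ := hf m (by omega)
    have h5 : (∏ j ∈ Finset.range m, f j) * f m ≤ W ^ (m + 1) := by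
      rw [pow_succ]; exact Nat.mul_le_mul h2 h4
    rw [Finset.prod_range_succ]
    refine ⟨?_, h5⟩
    rw [prodExpr, eval_mul, h1, h3]
    rw [h1, h3]
    omega

/-- Add the number of uncovered grid points in the current cell to the counters of all boxes. -/
def tally (d : ℕ) : Program :=
  forLoop 14 1 (.setWord (reg 15 0) (.var 14 0) (.add (.at 15 0 (.var 14 0)) (prodExpr d)))

/-- The time taken by `tally`. -/
def tallyTime (n d : ℕ) : ℕ :=
  ((Program.setWord (reg 15 0) (.var 14 0)
    (.add (.at 15 0 (.var 14 0)) (prodExpr d))).bound + 11) * n + 8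

/-- Process the current cell. -/
def leaf (d : ℕ) : Program := .seq (scanAll d d) (tally d)

/-- The uncovered grid points of box `i` in the cell given by the first `j` sides. -/
def Tables.cell (D : Tables) (d j : ℕ) (a b : ℕ → ℕ) (i : ℕ) : Finset (Fin d → ℕ) :=
  {x ∈ D.free d i | ∀ p : Fin d, (p : ℕ) < j → a p ≤ x p ∧ x p < b p}

/-- Separation turns the product of side counts into the number of uncovered points of the box in
this cell. The assumption on the counters prevents wrapping when this number is added. -/
theorem runs_leaf {D : Tables} {d w : ℕ} (hd : 1 ≤ d) (hD : D.Valid d) (hN : D.N + 2 < 2 ^ w)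
    (hNd : D.N ^ d < 2 ^ w) (hn : D.n < 2 ^ w) {s : State} (hs : D.Holds s)
    (hsep : D.Separated s.cellLo s.cellHi d)
    (hside : ∀ j < d, s.cellLo j < s.cellHi j ∧ s.cellHi j ≤ D.N)
    (hcnt : ∀ i < D.n, s.word (reg 15 0) i + (D.cell d d s.cellLo s.cellHi i).card < 2 ^ w) :
    Runs w (leaf d) s (scanAllTime D.N d d + tallyTime D.n d) (fun s' =>
      Agree (fun k _ => 11 ≤ k ∧ k ≤ 15) s s' ∧
      ∀ i < D.n, s'.word (reg 15 0) i =
        s.word (reg 15 0) i + (D.cell d d s.cellLo s.cellHi i).card) := by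
  refine Runs.seq (runs_scanAll hD hN hs d le_rfl) ?_
  rintro s₁ ⟨hA, hG⟩
  refine Runs.mono (Runs.forLoop (m := D.n) (T := Program.bound _) hn (fun m s' =>
    Agree (fun k _ => 14 ≤ k ∧ k ≤ 15) s₁ s' ∧ s'.word (reg 14 0) 0 = m ∧
    ∀ i < D.n, s'.word (reg 15 0) i = s.word (reg 15 0) i +
      if i < m then (D.cell d d s.cellLo s.cellHi i).card else 0) ?_ ?_ ?_) le_rfl ?_
  · rintro m s' ⟨h1, h2, -⟩
    exact ⟨h2, ((hs.agree hA (by omega)).agree h1 (by omega)).n_eq⟩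
  · rintro m s' hm ⟨hA', hv, hc⟩
    refine runs_of_loopFree (by exact trivial) ?_
    have hs' : D.Holds s' := (hs.agree hA (by omega)).agree hA' (by omega)
    have hAA : Agree (fun k _ => 11 ≤ k ∧ k ≤ 15) s s' := hA.trans hA' (by omega) (by omega)
    have hNpos : 0 < D.N := by
      have := hside 0 hd
      omega
    have hprod := eval_prodExpr (w := w) (W := D.N) (s := s')
      (fun j => (D.gap d s.cellLo s.cellHi j (min (D.h j m) (s.cellHi j))).card -
        (D.gap d s.cellLo s.cellHi j (max (D.l j m) (s.cellLo j))).card) d hNpos (by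
        intro j hj
        have hl := hD.l_lt j hj m hm
        have hh := hD.h_lt j hj m hm
        have hsj := hside j hj
        have e9 : s'.word (reg 9 j) 0 = s.cellLo j := by rw [hAA.1 9 j (by omega)]; rfl
        have e10 : s'.word (reg 10 j) 0 = s.cellHi j := by rw [hAA.1 10 j (by omega)]; rfl
        have e11 : ∀ y ≤ D.N, s'.word (reg 11 j) y = (D.gap d s.cellLo s.cellHi j y).card :=
          fun y hy => by rw [hA'.1 11 j (by omega), hG j hj y hy]
        have emax : (WordExpr.max (.at 5 j (.var 14 0)) (.var 9 j)).eval w s' =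
            max (D.l j m) (s.cellLo j) := by
          rw [eval_max] <;> simp only [eval_at, eval_var, hv, hs'.l_eq, e9] <;> omega
        constructor
        · simp only [sideExpr, eval_sub, eval_at, eval_min, eval_var, emax, hv, hs'.h_eq, e10]
          rw [e11, e11] <;> omega
        · have := D.gap_card_le d s.cellLo s.cellHi j (min (D.h j m) (s.cellHi j))
          omega) hNd
    have hcell : (D.cell d d s.cellLo s.cellHi m).card = ∏ j ∈ Finset.range d,
        ((D.gap d s.cellLo s.cellHi j (min (D.h j m) (s.cellHi j))).card -
        (D.gap d s.cellLo s.cellHi j (max (D.l j m) (s.cellLo j))).card) := by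
      rw [← D.card_free_cell d hd _ _ m hsep]
      unfold Tables.cell
      congr 1
      ext x
      simp only [Finset.mem_filter, Fin.is_lt, forall_true_left]
    have hcm := hc m hm
    rw [if_neg (lt_irrefl m), add_zero] at hcm
    have hval : (WordExpr.add (.at 15 0 (.var 14 0)) (prodExpr d)).eval w s' =
        s.word (reg 15 0) m + (D.cell d d s.cellLo s.cellHi m).card := by
      rw [eval_add] <;> simp only [eval_at, eval_var, hv, hprod.1, hcm, ← hcell]
      exact hcnt m hm
    simp only [Program.run, hval, eval_var, hv]
    refine ⟨by simp [setWord_word, hv], (hA'.setWord _ _ (by omega)).setWord _ _ (by omega),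
      by simp [setWord_word], fun i hi => ?_⟩
    by_cases him : i = m
    · subst him
      simp [setWord_word]
    · have h3 : i < m + 1 ↔ i < m := by omega
      simp only [setWord_word, reg_inj, him, h3, and_false, if_false]
      simpa using hc i hi
  · refine ⟨(Agree.refl _ _).setWord _ _ (by omega), by simp [setWord_word], fun i hi => ?_⟩
    simp [setWord_word, hA.1 15 0]
  · rintro s' ⟨h1, -, h3⟩
    refine ⟨hA.trans h1 (by omega) (by omega), fun i hi => ?_⟩
    rw [h3 i hi, if_pos hi]

/-! ### Enumerating the cells -/

/-- Does box `i` (the loop variable) have an end strictly inside one of the first `m` sides? -/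
def cutTest : ℕ → Test
  | 0 => .wordLt (.lit 0) (.lit 0)
  | m + 1 => .not (.and (.not (cutTest m)) (.and
      (.not (.and (.wordLt (.var 9 m) (.at 5 m (.var 14 0)))
        (.wordLt (.at 5 m (.var 14 0)) (.var 10 m))))
      (.not (.and (.wordLt (.var 9 m) (.at 6 m (.var 14 0)))
        (.wordLt (.at 6 m (.var 14 0)) (.var 10 m))))))

theorem holds_cutTest {D : Tables} {w : ℕ} {s : State} (hD : D.Holds s) (m : ℕ) :
    (cutTest m).holds w s ↔
      ∃ p < m, D.Cuts s.cellLo s.cellHi p (s.word (reg 14 0) 0) := by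
  induction m with
  | zero => simp [cutTest, Test.holds]
  | succ m ih =>
    simp only [cutTest, Test.holds, ih, eval_var, eval_at, hD.l_eq, hD.h_eq]
    have h : (∃ p < m + 1, D.Cuts s.cellLo s.cellHi p (s.word (reg 14 0) 0)) ↔
        (∃ p < m, D.Cuts s.cellLo s.cellHi p (s.word (reg 14 0) 0)) ∨
          D.Cuts s.cellLo s.cellHi m (s.word (reg 14 0) 0) := by
      constructor
      · rintro ⟨p, hp, h⟩
        rcases Nat.lt_succ_iff_lt_or_eq.1 hp with h' | rfl
        · exact Or.inl ⟨p, h', h⟩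
        · exact Or.inr h
      · rintro (⟨p, hp, h⟩ | h)
        · exact ⟨p, by omega, h⟩
        · exact ⟨m, by omega, h⟩
    rw [h]
    generalize (∃ p < m, D.Cuts s.cellLo s.cellHi p (s.word (reg 14 0) 0)) = X
    unfold Tables.Cuts State.cellLo State.cellHi
    tauto

/-- Shorten the `j`-th side of the cell to end at `e`, if `e` is strictly inside. -/
def shorten (j : ℕ) (e : WordExpr) : Program :=
  .ite (.and (.wordLt (.var 9 j) e) (.wordLt e (.var 10 j))) (.setWord (reg 10 j) (.lit 0) e) .skip

/-- Shorten the `j`-th side at the ends of box `i` (the loop variable), if that box has an end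
strictly inside an earlier side. -/
def cutBody (j : ℕ) : Program :=
  .ite (cutTest j) (.seq (shorten j (.at 5 j (.var 14 0))) (shorten j (.at 6 j (.var 14 0)))) .skip

/-- Find the upper end of the `j`-th side of the next cell. -/
def chooseCut (j : ℕ) : Program :=
  .seq (.setWord (reg 10 j) (.lit 0)
    (.min (.var 2 0) (.mul (.add (.div (.var 9 j) (.var 3 0)) (.lit 1)) (.var 3 0))))
    (forLoop 14 1 (cutBody j))

/-- The time taken by `chooseCut`. -/
def cutTime (n j : ℕ) : ℕ :=
  (Program.setWord (reg 10 j) (.lit 0)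
    (.min (.var 2 0) (.mul (.add (.div (.var 9 j) (.var 3 0)) (.lit 1)) (.var 3 0)))).bound +
  (((cutBody j).bound + 11) * n + 8)

theorem run_shorten {w : ℕ} {s : State} (j : ℕ) (e : WordExpr) (v : ℕ) (hv : e.eval w s = v) :
    ((shorten j e).run w s).cellHi j =
        (if s.cellLo j < v ∧ v < s.cellHi j then v else s.cellHi j) ∧
      Agree (fun k j' => k = 10 ∧ j' = j) s ((shorten j e).run w s) := by
  classical
  simp only [shorten, Program.run, Test.holds, hv, eval_var]
  unfold State.cellHi State.cellLo
  split_ifs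
  · refine ⟨by simp [setWord_word, WordExpr.eval], (Agree.refl _ _).setWord _ _ (by simp)⟩
  · exact ⟨rfl, Agree.refl _ _⟩

theorem Tables.Cuts.congr {D : Tables} {a b a' b' : ℕ → ℕ} {j i : ℕ} (h : D.Cuts a b j i)
    (ha : a' j = a j) (hb : b' j = b j) : D.Cuts a' b' j i := by
  unfold Tables.Cuts at h ⊢
  rwa [ha, hb]

/-- Shortening a side at an inner end moves that end to the boundary of the side. After both
attempts box `i` has no end strictly inside, and the new bound is still one of the admissible cut
positions. -/
theorem Tables.Holds.run_cutBody {D : Tables} {w : ℕ} {s : State} (hs : D.Holds s) (j : ℕ)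
    (a b : ℕ → ℕ) (hab : ∀ p < j, s.cellLo p = a p ∧ s.cellHi p = b p) {i : ℕ}
    (hi : s.word (reg 14 0) 0 = i) (hin : i < D.n) (hlt : s.cellLo j < s.cellHi j)
    (hmem : s.cellHi j ∈ D.cutSet a b j) :
    Agree (fun k j' => k = 10 ∧ j' = j) s ((cutBody j).run w s) ∧
      s.cellLo j < ((cutBody j).run w s).cellHi j ∧
      ((cutBody j).run w s).cellHi j ≤ s.cellHi j ∧
      ((cutBody j).run w s).cellHi j ∈ D.cutSet a b j ∧
      ((∃ p < j, D.Cuts a b p i) →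
        ¬ D.Cuts s.cellLo ((cutBody j).run w s).cellHi j i) := by
  classical
  have hiff : (cutTest j).holds w s ↔ ∃ p < j, D.Cuts a b p i := by
    rw [holds_cutTest hs, hi]
    exact exists_congr fun p => and_congr_right fun hp =>
      ⟨fun h => h.congr (hab p hp).1.symm (hab p hp).2.symm,
        fun h => h.congr (hab p hp).1 (hab p hp).2⟩
  rw [cutBody, Program.run]
  by_cases hc : ∃ p < j, D.Cuts a b p i
  · rw [if_pos (hiff.2 hc), Program.run]
    obtain ⟨h1, hA1⟩ := run_shorten (w := w) (s := s) j (.at 5 j (.var 14 0)) (D.l j i)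
      (by rw [eval_at, eval_var, hi, hs.l_eq])
    set s₁ := (shorten j (.at 5 j (.var 14 0))).run w s
    have hs₁ : D.Holds s₁ := hs.agree hA1 (by omega)
    obtain ⟨h2, hA2⟩ := run_shorten (w := w) (s := s₁) j (.at 6 j (.var 14 0)) (D.h j i)
      (by rw [eval_at, eval_var, hA1.1 14 0 (by omega), hi, hs₁.h_eq])
    set s₂ := (shorten j (.at 6 j (.var 14 0))).run w s₁
    have hlo : s₁.cellLo j = s.cellLo j := by unfold State.cellLo; rw [hA1.1 9 j (by omega)]
    rw [hlo] at h2
    have hml : D.l j i ∈ D.cutSet a b j := by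
      unfold Tables.cutSet
      exact Finset.mem_union_right _ (Finset.mem_union_left _ (Finset.mem_image_of_mem _
        (Finset.mem_filter.2 ⟨Finset.mem_range.2 hin, hc⟩)))
    have hmh : D.h j i ∈ D.cutSet a b j := by
      unfold Tables.cutSet
      exact Finset.mem_union_right _ (Finset.mem_union_right _ (Finset.mem_image_of_mem _
        (Finset.mem_filter.2 ⟨Finset.mem_range.2 hin, hc⟩)))
    refine ⟨hA1.trans hA2 (by simp) (by simp), ?_, ?_, ?_, fun _ => ?_⟩
    · rw [h2, h1]; split_ifs <;> omega
    · rw [h2, h1]; split_ifs <;> omega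
    · rw [h2, h1]; split_ifs <;> assumption
    · unfold Tables.Cuts
      rw [h2, h1]; split_ifs <;> omega
  · rw [if_neg (mt hiff.1 hc), Program.run]
    exact ⟨Agree.refl _ _, hlt, le_rfl, hmem, fun h => absurd h hc⟩

/-- The side first extends to the next multiple of `step`, or to `N`, and is then only shortened
from above. A box that does not cut a side does not cut a shorter one either, so a single pass over
the boxes suffices. -/
theorem runs_chooseCut {D : Tables} {d w : ℕ} (hD : D.Valid d) (hN : D.N + D.step + 2 < 2 ^ w)
    (hn : D.n < 2 ^ w) {s : State} (hs : D.Holds s) (j : ℕ) (hlt : s.cellLo j < D.N) :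
    Runs w (chooseCut j) s (cutTime D.n j) (fun s' =>
      Agree (fun k j' => (k = 10 ∧ j' = j) ∨ k = 14) s s' ∧
      s.cellLo j < s'.cellHi j ∧ s'.cellHi j ≤ D.N ∧ s'.cellHi j ≤ s.cellLo j + D.step ∧
      s'.cellHi j ∈ D.cutSet s.cellLo s.cellHi j ∧
      ∀ i < D.n, (∃ p < j, D.Cuts s.cellLo s.cellHi p i) →
        ¬ D.Cuts s.cellLo s'.cellHi j i) := by
  have hstep := hD.step_pos
  set x := s.cellLo j with hx
  have hdiv : x / D.step * D.step ≤ x := Nat.div_mul_le_self _ _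
  have hdiv' : x < (x / D.step + 1) * D.step := by
    rw [Nat.add_mul, one_mul, mul_comm]; exact Nat.lt_mul_div_succ x hstep |>.trans_eq (by ring)
  have hle : (x / D.step + 1) * D.step ≤ x + D.step := by rw [Nat.add_mul, one_mul]; omega
  have hdle : x / D.step ≤ x := Nat.div_le_self _ _
  have hval : (WordExpr.min (.var 2 0) (.mul (.add (.div (.var 9 j) (.var 3 0)) (.lit 1))
      (.var 3 0))).eval w s = min D.N ((x / D.step + 1) * D.step) := by
    have h1 : (WordExpr.add (.div (.var 9 j) (.var 3 0)) (.lit 1)).eval w s = x / D.step + 1 := by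
      have h2 : (WordExpr.div (.var 9 j) (.var 3 0)).eval w s = x / D.step := by
        rw [WordExpr.eval, eval_var, eval_var, hs.step_eq]; rfl
      rw [eval_add] <;> rw [h2, eval_lit (by omega)]
      omega
    rw [eval_min, eval_var, hs.N_eq, eval_mul] <;> rw [h1, eval_var, hs.step_eq]
    omega
  refine Runs.seq (Q₁ := fun s₁ => s₁ = s.setWord (reg 10 j) 0
    (min D.N ((x / D.step + 1) * D.step))) (runs_of_loopFree (by exact trivial) ?_) ?_
  · simp only [Program.run, hval, WordExpr.eval, Nat.zero_mod]
  rintro s₁ rfl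
  set s₁ := s.setWord (reg 10 j) 0 (min D.N ((x / D.step + 1) * D.step)) with hs₁
  have hA₁ : Agree (fun k j' => (k = 10 ∧ j' = j) ∨ k = 14) s s₁ :=
    (Agree.refl _ _).setWord _ _ (by simp)
  have hhi₁ : s₁.cellHi j = min D.N ((x / D.step + 1) * D.step) := by
    simp [hs₁, State.cellHi, setWord_word]
  have hmem₁ : min D.N ((x / D.step + 1) * D.step) ∈ D.cutSet s.cellLo s.cellHi j := by
    classical
    unfold Tables.cutSet
    refine Finset.mem_union_left _ ?_
    rcases min_choice D.N ((x / D.step + 1) * D.step) with h | h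
    · rw [h]; exact Finset.mem_insert_self _ _
    · rw [h]
      refine Finset.mem_insert_of_mem (Finset.mem_image.2 ⟨x / D.step + 1, ?_, rfl⟩)
      rw [Finset.mem_range, Nat.add_lt_add_iff_right]
      have h1 : (x / D.step + 1) * D.step ≤ D.N := by omega
      exact (Nat.le_div_iff_mul_le hstep).2 h1
  refine Runs.mono (Runs.forLoop (m := D.n) (T := (cutBody j).bound) hn (fun m s' =>
    Agree (fun k j' => (k = 10 ∧ j' = j) ∨ k = 14) s s' ∧ s'.word (reg 14 0) 0 = m ∧
      x < s'.cellHi j ∧ s'.cellHi j ≤ D.N ∧ s'.cellHi j ≤ x + D.step ∧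
      s'.cellHi j ∈ D.cutSet s.cellLo s.cellHi j ∧
      ∀ i < D.n, i < m → (∃ p < j, D.Cuts s.cellLo s.cellHi p i) →
        ¬ D.Cuts s.cellLo s'.cellHi j i) ?_ ?_ ?_) le_rfl ?_
  · rintro m s' ⟨h1, h2, -⟩
    exact ⟨h2, (hs.agree h1 (by omega)).n_eq⟩
  · rintro m s' hm ⟨hA, hv, hb1, hb2, hb3, hb4, hb5⟩
    have hs' : D.Holds s' := hs.agree hA (by omega)
    have hlo : s'.cellLo j = x := by unfold State.cellLo; rw [hA.1 9 j (by omega)]; rfl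
    obtain ⟨hA', g1, g2, g3, g4⟩ := hs'.run_cutBody (w := w) j s.cellLo s.cellHi (fun p hp => by
      unfold State.cellLo State.cellHi
      rw [hA.1 9 p (by omega), hA.1 10 p (by omega)]; exact ⟨rfl, rfl⟩) hv hm (by omega) hb4
    have hlf : ∀ e, (shorten j e).LoopFree := fun e => by simp [shorten, Program.LoopFree]
    refine runs_of_loopFree (by exact ⟨⟨hlf _, hlf _⟩, trivial⟩) ⟨?_, ?_⟩
    · rw [hA'.1 14 0 (by omega), hv]
    set s₂ := (cutBody j).run w s'
    have hhi : (s₂.setWord (reg 14 0) 0 (m + 1)).cellHi = s₂.cellHi := by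
      funext p; simp [State.cellHi, setWord_word]
    rw [hhi]
    rw [hlo] at g1
    refine ⟨(hA.trans hA' (by omega) (by omega)).setWord _ _ (by simp), by simp [setWord_word], g1,
      by omega, by omega, g3, fun i hi him hp => ?_⟩
    rcases Nat.lt_succ_iff_lt_or_eq.1 him with h | rfl
    · have := hb5 i hi h hp
      unfold Tables.Cuts at this ⊢
      omega
    · intro h
      exact g4 hp (h.congr (hlo.trans hx) rfl)
  · have hhi : (s₁.setWord (reg 14 0) 0 0).cellHi = s₁.cellHi := by
      funext p; simp [State.cellHi, setWord_word]
    rw [hhi, hhi₁]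
    exact ⟨hA₁.setWord _ _ (by simp), by simp [setWord_word], by omega, by omega, by omega, hmem₁,
      by omega⟩
  · rintro s' ⟨h1, -, h3, h4, h5, h6, h7⟩
    exact ⟨h1, h3, h4, h5, h6, fun i hi => h7 i hi hi⟩

/-- Enumerate the cells with the given first `j` sides, where `k = d - j`. -/
def walk (d : ℕ) : ℕ → ℕ → Program
  | 0, _ => leaf d
  | k + 1, j => .seq (.setWord (reg 9 j) (.lit 0) (.lit 0))
      (.loop (.wordLt (.var 9 j) (.var 2 0))
        (.seq (chooseCut j) (.seq (walk d k (j + 1)) (.setWord (reg 9 j) (.lit 0) (.var 10 j)))))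

/-- The time taken by `walk`, if there are at most `M` cuts in each dimension. -/
def walkTime (n N M d : ℕ) : ℕ → ℕ → ℕ
  | 0, _ => scanAllTime N d d + tallyTime n d
  | k + 1, j => 3 + ((5 + (cutTime n j + (walkTime n N M d k (j + 1) + 4))) * M + 5)

theorem Tables.cutSet_congr {D : Tables} {a b a' b' : ℕ → ℕ} {j : ℕ}
    (h : ∀ p < j, a' p = a p ∧ b' p = b p) : D.cutSet a' b' j = D.cutSet a b j := by
  classical
  have hc : ∀ i, (∃ p < j, D.Cuts a' b' p i) ↔ ∃ p < j, D.Cuts a b p i := fun i =>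
    exists_congr fun p => and_congr_right fun hp =>
      ⟨fun hh => hh.congr (h p hp).1.symm (h p hp).2.symm, fun hh => hh.congr (h p hp).1 (h p hp).2⟩
  unfold Tables.cutSet
  simp only [hc]

theorem Tables.cell_congr {D : Tables} {d j : ℕ} {a b a' b' : ℕ → ℕ}
    (h : ∀ p < j, a' p = a p ∧ b' p = b p) (i : ℕ) : D.cell d j a' b' i = D.cell d j a b i := by
  unfold Tables.cell
  refine Finset.filter_congr fun x _ => forall_congr' fun p => forall_congr' fun hp => ?_
  rw [(h p hp).1, (h p hp).2]

theorem Tables.cell_succ {D : Tables} {d j : ℕ} (hj : j < d) (a b : ℕ → ℕ) (i : ℕ) :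
    D.cell d (j + 1) a b i = {x ∈ D.cell d j a b i | a j ≤ x ⟨j, hj⟩ ∧ x ⟨j, hj⟩ < b j} := by
  ext x
  simp only [Tables.cell, Finset.mem_filter, and_assoc]
  refine and_congr_right fun _ => ⟨fun h => ⟨fun p hp => h p (by omega), h ⟨j, hj⟩ (by simp)⟩, ?_⟩
  rintro ⟨h1, h2⟩ p hp
  rcases Nat.lt_succ_iff_lt_or_eq.1 hp with h | h
  · exact h1 p h
  · obtain rfl : p = ⟨j, hj⟩ := Fin.ext h
    exact h2

/-- Loop invariant in dimension `j`: the counters have received exactly the points whose `j`-th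
coordinate is below the current lower end. The earlier sides do not change during the loop, so all
upper ends chosen belong to one set of cut positions, and the number of those still ahead decreases.
-/
theorem runs_walk {D : Tables} {d w M : ℕ} (hd : 1 ≤ d) (hD : D.Valid d)
    (hN : D.N + D.step + 2 < 2 ^ w) (hNd : D.N ^ d < 2 ^ w) (hn : D.n < 2 ^ w)
    (hM : D.N / D.step + 2 + 4 * d * D.step ≤ M) (k : ℕ) : ∀ (j : ℕ) (s : State), j + k = d →
    D.Holds s → D.Separated s.cellLo s.cellHi j →
    (∀ p < j, s.cellLo p < s.cellHi p ∧ s.cellHi p ≤ D.N ∧ s.cellHi p ≤ s.cellLo p + D.step) →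
    (∀ i < D.n, s.word (reg 15 0) i + (D.cell d j s.cellLo s.cellHi i).card < 2 ^ w) →
    Runs w (walk d k j) s (walkTime D.n D.N M d k j) (fun s' =>
      Agree (fun k j' => ((k = 9 ∨ k = 10) ∧ j ≤ j') ∨ 11 ≤ k ∧ k ≤ 15) s s' ∧
      ∀ i < D.n, s'.word (reg 15 0) i =
        s.word (reg 15 0) i + (D.cell d j s.cellLo s.cellHi i).card) := by
  induction k with
  | zero =>
    rintro j s hjd hs hsep hside hcnt
    obtain rfl : j = d := by omega
    refine Runs.mono (runs_leaf hd hD (by omega) hNd hn hs hsep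
      (fun p hp => ⟨(hside p hp).1, (hside p hp).2.1⟩) hcnt) le_rfl ?_
    rintro s' ⟨h1, h2⟩
    exact ⟨h1.mono (by omega), h2⟩
  | succ k ih =>
    rintro j s hjk hs hsep hside hcnt
    have hj : j < d := by omega
    refine Runs.seq (Q₁ := fun s₁ => s₁ = s.setWord (reg 9 j) 0 0) (T₁ := 3)
      (runs_of_loopFree (by exact trivial) ?_) ?_
    · simp [Program.run, WordExpr.eval]
    rintro s₁ rfl
    set C := D.cutSet s.cellLo s.cellHi j with hC
    have hCM : C.card ≤ M := by
      refine (Tables.card_cutSet_le hD _ _ j hj.le fun p hp => (hside p hp).2.2).trans ?_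
      have : 4 * j * D.step ≤ 4 * d * D.step := Nat.mul_le_mul_right _ (by omega)
      omega
    refine Runs.mono (Runs.loop (b := .wordLt (.var 9 j) (.var 2 0))
      (T := cutTime D.n j + (walkTime D.n D.N M d k (j + 1) + 4)) (fun s' =>
        Agree (fun k j' => ((k = 9 ∨ k = 10) ∧ j ≤ j') ∨ 11 ≤ k ∧ k ≤ 15) s s' ∧
        s'.cellLo j ≤ D.N ∧
        ∀ i < D.n, s'.word (reg 15 0) i = s.word (reg 15 0) i +
          ({x ∈ D.cell d j s.cellLo s.cellHi i | x ⟨j, hj⟩ < s'.cellLo j}).card)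
      (fun s' => ({c ∈ C | s'.cellLo j < c}).card) ?_ M _ ⟨?_, ?_, ?_⟩ ?_) le_rfl ?_
    · rintro s' ⟨hA, hle, hc⟩ hb
      have hs' : D.Holds s' := hs.agree hA (by omega)
      have hb' : s'.cellLo j < D.N := by
        simp only [Test.holds, eval_var, hs'.N_eq] at hb
        exact hb
      have hlohi : ∀ p < j, s'.cellLo p = s.cellLo p ∧ s'.cellHi p = s.cellHi p := by
        intro p hp
        unfold State.cellLo State.cellHi
        rw [hA.1 9 p (by omega), hA.1 10 p (by omega)]
        exact ⟨rfl, rfl⟩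
      refine Runs.seq (runs_chooseCut hD hN hn hs' j hb') ?_
      rintro s₂ ⟨hA₂, hb1, hb2, hb3, hb4, hb5⟩
      have hs₂ : D.Holds s₂ := hs'.agree hA₂ (by omega)
      have hlo₂ : s₂.cellLo = s'.cellLo := by
        funext p; unfold State.cellLo; rw [hA₂.1 9 p (by omega)]
      have hhi₂ : ∀ p < j, s₂.cellHi p = s'.cellHi p := by
        intro p hp; unfold State.cellHi; rw [hA₂.1 10 p (by omega)]
      have hlohi₂ : ∀ p < j, s₂.cellLo p = s.cellLo p ∧ s₂.cellHi p = s.cellHi p := by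
        intro p hp
        rw [hlo₂, hhi₂ p hp]; exact hlohi p hp
      have hcell₂ : ∀ i, D.cell d (j + 1) s₂.cellLo s₂.cellHi i =
          {x ∈ D.cell d j s.cellLo s.cellHi i | s'.cellLo j ≤ x ⟨j, hj⟩ ∧
            x ⟨j, hj⟩ < s₂.cellHi j} := by
        intro i
        rw [Tables.cell_succ hj, Tables.cell_congr hlohi₂, hlo₂]
      have hadd : ∀ i, ({x ∈ D.cell d j s.cellLo s.cellHi i | x ⟨j, hj⟩ < s'.cellLo j}).card +
          (D.cell d (j + 1) s₂.cellLo s₂.cellHi i).card =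
          ({x ∈ D.cell d j s.cellLo s.cellHi i | x ⟨j, hj⟩ < s₂.cellHi j}).card := by
        intro i
        rw [hcell₂, ← Finset.card_union_of_disjoint]
        · congr 1
          ext x
          simp only [Finset.mem_union, Finset.mem_filter]
          constructor
          · rintro (⟨h, h'⟩ | ⟨h, h'⟩)
            · exact ⟨h, by omega⟩
            · exact ⟨h, h'.2⟩
          · rintro ⟨h, h'⟩
            rcases lt_or_ge (x ⟨j, hj⟩) (s'.cellLo j) with h'' | h''
            · exact Or.inl ⟨h, h''⟩
            · exact Or.inr ⟨h, h'', h'⟩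
        · rw [Finset.disjoint_filter]
          intro x _ h h'
          omega
      -- Only pairs involving the new dimension are at issue: the cut was chosen so that boxes
      -- cutting an earlier side do not cut the new one.
      have hsep₂ : D.Separated s₂.cellLo s₂.cellHi (j + 1) := by
        have hnew : ∀ i < D.n, ∀ p < j, D.Cuts s₂.cellLo s₂.cellHi p i →
            ¬ D.Cuts s₂.cellLo s₂.cellHi j i := by
          intro i hi p hp h h'
          refine hb5 i hi ⟨p, hp, h.congr (by rw [hlo₂]) (hhi₂ p hp).symm⟩ ?_
          exact h'.congr (by rw [hlo₂]) rfl
        intro i hi p hp q hq hcp hcq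
        rcases Nat.lt_succ_iff_lt_or_eq.1 hp with h | rfl
        · rcases Nat.lt_succ_iff_lt_or_eq.1 hq with h' | rfl
          · exact hsep i hi p h q h' (hcp.congr (hlohi₂ p h).1.symm (hlohi₂ p h).2.symm)
              (hcq.congr (hlohi₂ q h').1.symm (hlohi₂ q h').2.symm)
          · exact absurd hcq (hnew i hi p h hcp)
        · rcases Nat.lt_succ_iff_lt_or_eq.1 hq with h' | rfl
          · exact absurd hcp (hnew i hi q h' hcq)
          · rfl
      have h15 : s₂.word (reg 15 0) = s'.word (reg 15 0) := hA₂.1 15 0 (by omega)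
      refine Runs.seq (ih (j + 1) s₂ (by omega) hs₂ hsep₂ ?_ ?_) ?_
      · intro p hp
        rcases Nat.lt_succ_iff_lt_or_eq.1 hp with h | rfl
        · rw [(hlohi₂ p h).1, (hlohi₂ p h).2]; exact hside p h
        · rw [hlo₂]; exact ⟨hb1, hb2, hb3⟩
      · intro i hi
        have h1 := hcnt i hi
        have h2 : ({x ∈ D.cell d j s.cellLo s.cellHi i | x ⟨j, hj⟩ < s₂.cellHi j}).card ≤
          (D.cell d j s.cellLo s.cellHi i).card := Finset.card_filter_le _ _
        rw [h15, hc i hi, add_assoc, hadd]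
        omega
      · rintro s₃ ⟨hA₃, hc₃⟩
        refine Runs.mono (T := 4) (runs_of_loopFree (by exact trivial) ?_) le_rfl (fun _ h => h)
        have hhi₃ : s₃.word (reg 10 j) 0 = s₂.cellHi j := by
          rw [hA₃.1 10 j (by omega)]; rfl
        have hrun : (Program.setWord (reg 9 j) (.lit 0) (.var 10 j)).run w s₃ =
            s₃.setWord (reg 9 j) 0 (s₂.cellHi j) := by
          simp [Program.run, WordExpr.eval, hhi₃]
        have hloj : (s₃.setWord (reg 9 j) 0 (s₂.cellHi j)).cellLo j = s₂.cellHi j := by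
          simp [State.cellLo, setWord_word]
        rw [hrun, hloj]
        refine ⟨⟨((hA.trans hA₂ (M'' := fun k j' => ((k = 9 ∨ k = 10) ∧ j ≤ j') ∨ 11 ≤ k ∧ k ≤ 15)
          (by omega) (by omega)).trans hA₃ (by omega) (by omega)).setWord _ _ (by simp), hb2,
          fun i hi => ?_⟩, ?_⟩
        · rw [setWord_word_ne _ _ _ (by simp), hc₃ i hi, h15, hc i hi, add_assoc, hadd]
        · refine Finset.card_lt_card ?_
          rw [Finset.ssubset_iff_of_subset]
          · refine ⟨s₂.cellHi j, Finset.mem_filter.2 ⟨?_, hb1⟩, by simp⟩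
            rw [hC, ← Tables.cutSet_congr hlohi]
            exact hb4
          · intro c hc
            rw [Finset.mem_filter] at hc ⊢
            exact ⟨hc.1, hb1.trans hc.2⟩
    · exact (Agree.refl _ _).setWord _ _ (by simp)
    · simp [State.cellLo, setWord_word]
    · intro i hi
      simp [State.cellLo, setWord_word]
    · exact (Finset.card_filter_le _ _).trans hCM
    · rintro s' ⟨⟨hA, hle, hc⟩, hb⟩
      have hs' : D.Holds s' := hs.agree hA (by omega)
      have hb' : s'.cellLo j = D.N := by
        simp only [Test.holds, eval_var, hs'.N_eq] at hb
        have : s'.cellLo j = s'.word (reg 9 j) 0 := rfl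
        omega
      refine ⟨hA, fun i hi => ?_⟩
      -- All coordinates in a box are below `N`, so no points remain beyond the last slice.
      rw [hc i hi, hb', Finset.filter_true_of_mem]
      intro x hx
      have hx1 := (Finset.mem_filter.1 (Finset.mem_filter.1 hx).1).1
      have hx2 := (Finset.mem_filter.1 (Fintype.mem_piFinset.1 hx1 ⟨j, hj⟩)).1
      rw [Finset.mem_Ico] at hx2
      exact hx2.2.trans (hD.h_lt j hj i hi)


/-! ### The greedy loop -/

/-- The tables with another selection. -/
def Tables.withSel (D : Tables) (f : ℕ → ℕ) : Tables := { D with sel := f }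

theorem Tables.Valid.withSel {D : Tables} {d : ℕ} (h : D.Valid d) (f : ℕ → ℕ) :
    (D.withSel f).Valid d :=
  ⟨h.l_lt, h.h_lt, h.l_inj, h.h_inj, h.op_eq, h.step_pos⟩

/-- Links the machine, which keeps selection bits, with the greedy analysis, which speaks of a
finite set of indices. -/
theorem Tables.free_withSel (D : Tables) (d : ℕ) (f : ℕ → ℕ) (K : Finset ℕ)
    (hK : K ⊆ Finset.range D.n) (hf : ∀ i < D.n, f i = 1 ↔ i ∈ K) (i : ℕ) :
    (D.withSel f).free d i = uncoveredIn (D.pts d) K i := by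
  ext x
  simp only [Tables.free, uncoveredIn, Finset.mem_filter, Finset.mem_sdiff, Finset.mem_biUnion,
    not_exists, not_and]
  refine and_congr_right fun hx => ?_
  have hw : ∀ j : Fin d, D.wt j (x j) = 1 := fun j =>
    (Finset.mem_filter.1 (Fintype.mem_piFinset.1 hx j)).2
  have hmem : ∀ k, x ∈ D.pts d k ↔ ∀ j : Fin d, D.l j k ≤ x j ∧ x j < D.h j k := by
    intro k
    simp only [Tables.pts, Fintype.mem_piFinset, Finset.mem_filter, Finset.mem_Ico, hw, and_true]
  simp only [hmem]
  constructor
  · intro h k hk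
    have hkn := Finset.mem_range.1 (hK hk)
    exact h k hkn ((hf k hkn).2 hk)
  · intro h k hkn hk
    exact h k ((hf k hkn).1 hk)

theorem Tables.card_pts_le {D : Tables} {d : ℕ} (hD : D.Valid d) {s : Finset ℕ}
    (hs : ∀ i ∈ s, i < D.n) : (s.biUnion (D.pts d)).card ≤ D.N ^ d := by
  have h : s.biUnion (D.pts d) ⊆ Fintype.piFinset fun _ : Fin d => Finset.range D.N := by
    intro x hx
    obtain ⟨i, hi, hx⟩ := Finset.mem_biUnion.1 hx
    refine Fintype.mem_piFinset.2 fun j => ?_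
    have := (Finset.mem_filter.1 (Fintype.mem_piFinset.1 hx j)).1
    rw [Finset.mem_Ico] at this
    exact Finset.mem_range.2 (this.2.trans (hD.h_lt j j.2 i (hs i hi)))
  refine (Finset.card_le_card h).trans ?_
  simp

/-- Set all counters to zero. -/
def clear : Program := forLoop 14 1 (.setWord (reg 15 0) (.var 14 0) (.lit 0))

theorem runs_clear {D : Tables} {w : ℕ} (hn : D.n < 2 ^ w) {s : State} (hs : D.Holds s) :
    Runs w clear s ((4 + 11) * D.n + 8) (fun s' =>
      Agree (fun k _ => k = 14 ∨ k = 15) s s' ∧ ∀ i < D.n, s'.word (reg 15 0) i = 0) := by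
  refine Runs.mono (Runs.forLoop (m := D.n) (T := 4) hn (fun m s' =>
    Agree (fun k _ => k = 14 ∨ k = 15) s s' ∧ s'.word (reg 14 0) 0 = m ∧
    ∀ i < m, s'.word (reg 15 0) i = 0) ?_ ?_ ?_) le_rfl ?_
  · rintro m s' ⟨h1, h2, -⟩
    exact ⟨h2, (hs.agree h1 (by omega)).n_eq⟩
  · rintro m s' hm ⟨hA, hv, hc⟩
    refine runs_of_loopFree (by exact trivial) ?_
    simp only [Program.run, eval_var, hv, WordExpr.eval, Nat.zero_mod]
    refine ⟨by simp [setWord_word, hv], (hA.setWord _ _ (by omega)).setWord _ _ (by omega),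
      by simp [setWord_word], fun i hi => ?_⟩
    simp only [setWord_word, reg_inj]
    by_cases him : i = m
    · simp [him]
    · simp [him, hc i (by omega)]
  · exact ⟨(Agree.refl _ _).setWord _ _ (by omega), by simp [setWord_word], by omega⟩
  · rintro s' ⟨h1, -, h3⟩
    exact ⟨h1, h3⟩

/-- Find a box with the largest counter. -/
def argmax : Program :=
  .seq (.setWord (reg 16 0) (.lit 0) (.lit 0))
    (forLoop 14 1 (.ite (.wordLt (.at 15 0 (.var 16 0)) (.at 15 0 (.var 14 0)))
      (.setWord (reg 16 0) (.lit 0) (.var 14 0)) .skip))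

theorem runs_argmax {D : Tables} {w : ℕ} (hn : D.n < 2 ^ w) (hpos : 0 < D.n) {s : State}
    (hs : D.Holds s) :
    Runs w argmax s (3 + ((12 + 11) * D.n + 8)) (fun s' =>
      Agree (fun k _ => k = 14 ∨ k = 16) s s' ∧ s'.word (reg 16 0) 0 < D.n ∧
      ∀ i < D.n, s.word (reg 15 0) i ≤ s.word (reg 15 0) (s'.word (reg 16 0) 0)) := by
  classical
  refine Runs.seq (Q₁ := fun s₁ => s₁ = s.setWord (reg 16 0) 0 0) (T₁ := 3)
    (runs_of_loopFree (by exact trivial) (by simp [Program.run, WordExpr.eval])) ?_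
  rintro s₁ rfl
  refine Runs.mono (Runs.forLoop (m := D.n) (T := 12) hn (fun m s' =>
    Agree (fun k _ => k = 14 ∨ k = 16) s s' ∧ s'.word (reg 14 0) 0 = m ∧
    s'.word (reg 16 0) 0 < D.n ∧
    ∀ i < m, s.word (reg 15 0) i ≤ s.word (reg 15 0) (s'.word (reg 16 0) 0)) ?_ ?_ ?_) le_rfl ?_
  · rintro m s' ⟨h1, h2, -⟩
    exact ⟨h2, (hs.agree h1 (by omega)).n_eq⟩
  · rintro m s' hm ⟨hA, hv, hlt, hc⟩
    refine Runs.mono (runs_of_loopFree (by simp [Program.LoopFree])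
      (Q := fun s' => s'.word (reg 14 0) 0 = m ∧
        Agree (fun k _ => k = 14 ∨ k = 16) s (s'.setWord (reg 14 0) 0 (m + 1)) ∧
        (s'.setWord (reg 14 0) 0 (m + 1)).word (reg 14 0) 0 = m + 1 ∧
        (s'.setWord (reg 14 0) 0 (m + 1)).word (reg 16 0) 0 < D.n ∧
        ∀ i < m + 1, s.word (reg 15 0) i ≤
          s.word (reg 15 0) ((s'.setWord (reg 14 0) 0 (m + 1)).word (reg 16 0) 0)) ?_) le_rfl
        fun _ h => h
    simp only [Program.run, Test.holds, eval_at, eval_var, hv, hA.1 15 0 (by omega),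
      WordExpr.eval, Nat.zero_mod]
    split_ifs with hcond
    · refine ⟨by simp [setWord_word, hv], (hA.setWord _ _ (by omega)).setWord _ _ (by omega),
        by simp [setWord_word], by simpa [setWord_word] using hm, fun i hi => ?_⟩
      simp only [setWord_word, reg_inj, and_self, and_true, if_true]
      rcases Nat.lt_succ_iff_lt_or_eq.1 hi with h | rfl
      · simpa using (hc i h).trans hcond.le
      · simp
    · refine ⟨hv, hA.setWord _ _ (by omega),
        by simp [setWord_word], by simpa [setWord_word] using hlt, fun i hi => ?_⟩
      rw [setWord_word_ne _ _ _ (by simp)]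
      rcases Nat.lt_succ_iff_lt_or_eq.1 hi with h | rfl
      · exact hc i h
      · exact not_lt.1 hcond
  · exact ⟨((Agree.refl _ _).setWord _ _ (by omega)).setWord _ _ (by omega),
      by simp [setWord_word], by simpa [setWord_word] using hpos, by omega⟩
  · rintro s' ⟨h1, -, h3, h4⟩
    exact ⟨h1, h3, h4⟩

/-- Select the box found by `argmax` if its counter is positive, and stop otherwise. -/
def commit : Program :=
  .ite (.wordLt (.lit 0) (.at 15 0 (.var 16 0)))
    (.seq (.setWord (reg 4 0) (.var 16 0) (.lit 1))
      (.seq (.setWord (reg 0 1) (.var 17 0) (.var 16 0))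
        (.setWord (reg 17 0) (.lit 0) (.add (.var 17 0) (.lit 1)))))
    (.setWord (reg 18 0) (.lit 0) (.lit 0))

/-- One round of the greedy algorithm. -/
def round (d : ℕ) : Program := .seq clear (.seq (walk d d 0) (.seq argmax commit))

/-- The time taken by `round`. -/
def roundTime (n N M d : ℕ) : ℕ :=
  ((4 + 11) * n + 8) + (walkTime n N M d d 0 + ((3 + ((12 + 11) * n + 8)) + commit.bound))

/-- If the largest counter is zero, nothing is uncovered and the flag in family 18 is cleared.
Otherwise the box of largest gain is selected; its gain is positive, so it is new, and it is
appended to the output list. -/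
theorem runs_round {D : Tables} {d w M : ℕ} (hd : 1 ≤ d) (hD : D.Valid d)
    (hN : D.N + D.step + 2 < 2 ^ w) (hNd : D.N ^ d < 2 ^ w) (hn : D.n < 2 ^ w) (hpos : 0 < D.n)
    (hM : D.N / D.step + 2 + 4 * d * D.step ≤ M) {f : ℕ → ℕ} {K : Finset ℕ}
    (hK : K ⊆ Finset.range D.n) (hf : ∀ i < D.n, f i = 1 ↔ i ∈ K) {s : State}
    (hs : (D.withSel f).Holds s) (hm : s.word (reg 17 0) 0 = K.card) :
    Runs w (round d) s (roundTime D.n D.N M d) (fun s' =>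
      ((∀ i < D.n, uncoveredIn (D.pts d) K i = ∅) ∧ (D.withSel f).Holds s' ∧
        s'.word (reg 17 0) 0 = K.card ∧ s'.word (reg 18 0) 0 = 0 ∧
        s'.word (reg 0 1) = s.word (reg 0 1)) ∨
      ∃ b < D.n, (uncoveredIn (D.pts d) K b).Nonempty ∧
        (∀ i < D.n, (uncoveredIn (D.pts d) K i).card ≤ (uncoveredIn (D.pts d) K b).card) ∧
        (D.withSel (Function.update f b 1)).Holds s' ∧
        s'.word (reg 17 0) 0 = K.card + 1 ∧ s'.word (reg 18 0) 0 = s.word (reg 18 0) 0 ∧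
        s'.word (reg 0 1) = Function.update (s.word (reg 0 1)) K.card b) := by
  classical
  refine Runs.seq (runs_clear (D := D.withSel f) hn hs) ?_
  rintro s₁ ⟨hA₁, hc₁⟩
  have hs₁ := hs.agree hA₁ (by omega)
  -- With no side fixed the cell is unrestricted.
  have hcell : ∀ i, (D.withSel f).cell d 0 s₁.cellLo s₁.cellHi i = uncoveredIn (D.pts d) K i := by
    intro i
    rw [← D.free_withSel d f K hK hf]
    unfold Tables.cell
    exact Finset.filter_true_of_mem (by intro x _ p hp; omega)
  refine Runs.seq (runs_walk hd (hD.withSel f) hN hNd hn hM d 0 s₁ (by omega) hs₁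
    (by intro i _ p hp; omega) (by omega) ?_) ?_
  · intro i hi
    rw [hc₁ i hi, hcell, zero_add]
    refine lt_of_le_of_lt ?_ hNd
    refine (Finset.card_le_card (Finset.sdiff_subset)).trans ?_
    have := Tables.card_pts_le hD (s := {i}) (fun k hk => by
      rw [Finset.mem_singleton] at hk
      exact hk ▸ hi)
    simpa using this
  rintro s₂ ⟨hA₂, hc₂⟩
  have hs₂ := hs₁.agree hA₂ (by omega)
  have hcnt : ∀ i < D.n, s₂.word (reg 15 0) i = (uncoveredIn (D.pts d) K i).card := by
    intro i hi
    rw [hc₂ i hi, hc₁ i hi, hcell, zero_add]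
  refine Runs.seq (runs_argmax (D := D.withSel f) hn hpos hs₂) ?_
  rintro s₃ ⟨hA₃, hb, hbest⟩
  have hs₃ := hs₂.agree hA₃ (by omega)
  have hA : Agree (fun k _ => 9 ≤ k ∧ k ≤ 16) s s₃ :=
    (hA₁.trans hA₂ (M'' := fun k _ => 9 ≤ k ∧ k ≤ 16) (by omega) (by omega)).trans hA₃
      (by omega) (by omega)
  set b := s₃.word (reg 16 0) 0 with hbdef
  replace hb : b < D.n := hb
  replace hbest : ∀ i < D.n, s₂.word (reg 15 0) i ≤ s₂.word (reg 15 0) b := hbest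
  have hN2 : 1 < 2 ^ w := by omega
  have hl1 : ∀ s : State, (WordExpr.lit 1).eval w s = 1 := eval_lit hN2
  have hl0 : ∀ s : State, (WordExpr.lit 0).eval w s = 0 := eval_lit (by omega)
  have hm₃ : s₃.word (reg 17 0) 0 = K.card := by rw [hA.1 17 0 (by omega), hm]
  have hcb : s₃.word (reg 15 0) b = (uncoveredIn (D.pts d) K b).card := by
    rw [hA₃.1 15 0 (by omega), hcnt b hb]
  refine runs_of_loopFree (by simp [commit, Program.LoopFree]) ?_
  simp only [commit, Program.run, Test.holds, eval_at, eval_var, hl0, ← hbdef, hcb]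
  split_ifs with hcond
  · right
    have hbK : b ∉ K := by
      intro hbK
      rw [Finset.card_pos] at hcond
      obtain ⟨x, hx⟩ := hcond
      rw [uncoveredIn, Finset.mem_sdiff] at hx
      exact hx.2 (Finset.mem_biUnion.2 ⟨b, hbK, hx.1⟩)
    -- Keeps the number of selected boxes from wrapping when it is increased.
    have hKc : K.card < D.n := by
      have := Finset.card_le_card (Finset.insert_subset (Finset.mem_range.2 hb) hK)
      rw [Finset.card_insert_of_notMem hbK, Finset.card_range] at this
      exact this
    refine ⟨b, hb, Finset.card_pos.1 hcond, fun i hi => ?_, ?_, ?_, ?_, ?_⟩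
    · rw [← hcnt i hi, ← hcnt b hb]; exact hbest i hi
    · have hs' : (D.withSel (Function.update f b 1)).Holds (s₃.setWord (reg 4 0) b 1) := by
        constructor
        · simpa [setWord_word, Tables.withSel] using hs₃.n_eq
        · simpa [setWord_word, Tables.withSel] using hs₃.N_eq
        · simpa [setWord_word, Tables.withSel] using hs₃.step_eq
        · simp [State.setWord, hs₃.sel_eq]; rfl
        · intro j; rw [setWord_word_ne _ _ _ (by simp)]; exact hs₃.l_eq j
        · intro j; rw [setWord_word_ne _ _ _ (by simp)]; exact hs₃.h_eq j
        · intro j; rw [setWord_word_ne _ _ _ (by simp)]; exact hs₃.op_eq j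
        · intro j; rw [setWord_word_ne _ _ _ (by simp)]; exact hs₃.wt_eq j
      rw [hl1]
      constructor
      · simpa [setWord_word] using hs'.n_eq
      · simpa [setWord_word] using hs'.N_eq
      · simpa [setWord_word] using hs'.step_eq
      · rw [setWord_word_ne _ _ _ (by simp), setWord_word_ne _ _ _ (by simp)]; exact hs'.sel_eq
      · intro j; rw [setWord_word_ne _ _ _ (by simp), setWord_word_ne _ _ _ (by simp)]; exact hs'.l_eq j
      · intro j; rw [setWord_word_ne _ _ _ (by simp), setWord_word_ne _ _ _ (by simp)]; exact hs'.h_eq j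
      · intro j; rw [setWord_word_ne _ _ _ (by simp), setWord_word_ne _ _ _ (by simp)]; exact hs'.op_eq j
      · intro j; rw [setWord_word_ne _ _ _ (by simp), setWord_word_ne _ _ _ (by simp)]; exact hs'.wt_eq j
    · rw [eval_add] <;> simp only [eval_var, hl1, setWord_word, reg_inj] <;> simp [hm₃]
      omega
    · simp only [setWord_word, reg_inj]
      simp [hA.1 18 0]
    · rw [setWord_word_ne _ _ _ (by simp)]
      simp only [State.setWord, Function.update_self]
      rw [Function.update_of_ne (by simp), hA.1 0 1 (by omega)]
      simp [hm₃]
      rfl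
  · left
    refine ⟨fun i hi => ?_, hs₃.agree ((Agree.refl (fun k _ => k = 18) _).setWord _ _ rfl)
      (by omega), ?_, ?_, ?_⟩
    · have h1 := hbest i hi
      rw [hcnt i hi, hcnt b hb] at h1
      rw [← Finset.card_eq_zero]
      omega
    · simpa [setWord_word] using hm₃
    · simp [setWord_word]
    · rw [setWord_word_ne _ _ _ (by simp), hA.1 0 1 (by omega)]

/-- The greedy algorithm on given tables. -/
def greedy (d : ℕ) : Program :=
  .seq (.setWord (reg 18 0) (.lit 0) (.lit 1))
    (.seq (.loop (.wordEq (.var 18 0) (.lit 1)) (round d))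
      (.setWord (reg 0 0) (.lit 0) (.var 17 0)))

/-- As long as a point is uncovered, the number of uncovered points is at least 1 and at most `N^d *
exp (-K.card / O.card)`. The assumption `hR` converts this into a bound on the size after the next
choice, so at most `R` boxes are ever chosen. -/
theorem runs_greedy {D : Tables} {d w M R : ℕ} (hd : 1 ≤ d) (hD : D.Valid d)
    (hN : D.N + D.step + 2 < 2 ^ w) (hNd : D.N ^ d < 2 ^ w) (hn : D.n < 2 ^ w) (hpos : 0 < D.n)
    (hM : D.N / D.step + 2 + 4 * d * D.step ≤ M) {s : State}
    (hs : D.Holds s) (hsel : ∀ i, D.sel i = 0) (hm : s.word (reg 17 0) 0 = 0)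
    (O : Finset ℕ) (hO : ∀ i ∈ O, i < D.n) (hOpos : 0 < O.card)
    (hcov : ∀ i < D.n, D.pts d i ⊆ O.biUnion (D.pts d))
    (hR : ∀ m : ℕ, 1 ≤ (D.N : ℝ) ^ d * Real.exp (-(m / O.card)) → m + 1 ≤ R) :
    Runs w (greedy d) s (3 + (((4 + roundTime D.n D.N M d) * (R + 1) + 4) + 4)) (fun s' =>
      ∃ K : Finset ℕ, K ⊆ Finset.range D.n ∧ K.card ≤ R ∧
        (∀ i < D.n, D.pts d i ⊆ K.biUnion (D.pts d)) ∧ s'.word (reg 0 0) 0 = K.card ∧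
        (Finset.range K.card).image (s'.word (reg 0 1)) = K) := by
  classical
  set U : Finset ℕ → Finset (Fin d → ℕ) := fun K =>
    (Finset.range D.n).biUnion (D.pts d) \ K.biUnion (D.pts d) with hU
  have hl1 : ∀ s : State, (WordExpr.lit 1).eval w s = 1 := eval_lit (by omega)
  refine Runs.seq (Q₁ := fun s₁ => s₁ = s.setWord (reg 18 0) 0 1) (T₁ := 3)
    (runs_of_loopFree (by exact trivial) ?_) ?_
  · simp only [Program.run, hl1]; simp [WordExpr.eval]
  rintro s₁ rfl
  refine Runs.seq (Runs.loop (b := .wordEq (.var 18 0) (.lit 1)) (T := roundTime D.n D.N M d)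
    (fun s' => ∃ f K, (D.withSel f).Holds s' ∧ K ⊆ Finset.range D.n ∧ (∀ i < D.n, f i = 1 ↔ i ∈ K) ∧
      s'.word (reg 17 0) 0 = K.card ∧ (Finset.range K.card).image (s'.word (reg 0 1)) = K ∧
      ((U K).card : ℝ) ≤ (D.N : ℝ) ^ d * Real.exp (-(K.card / O.card)) ∧ K.card ≤ R ∧
      (s'.word (reg 18 0) 0 = 1 ∨ s'.word (reg 18 0) 0 = 0 ∧
        ∀ i < D.n, uncoveredIn (D.pts d) K i = ∅))
    -- The flag is part of the measure because the last round selects nothing and only clears it.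
    (fun s' => (R - s'.word (reg 17 0) 0) + s'.word (reg 18 0) 0) ?_ (R + 1) _ ?_ ?_) ?_
  · rintro s' ⟨f, K, hH, hK, hf, hm', himg, hUK, hKR, -⟩ hb
    simp only [Test.holds, eval_var, hl1] at hb
    refine Runs.mono (runs_round hd hD hN hNd hn hpos hM hK hf hH hm') le_rfl ?_
    rintro s₂ (⟨h1, h2, h3, h4, h5⟩ | ⟨b, hbn, hne, hbest, h2, h3, h4, h5⟩)
    · exact ⟨⟨f, K, h2, hK, hf, h3, h5 ▸ himg, hUK, hKR, Or.inr ⟨h4, h1⟩⟩, by omega⟩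
    · have hbK : b ∉ K := by
        intro hbK
        obtain ⟨x, hx⟩ := hne
        rw [uncoveredIn, Finset.mem_sdiff] at hx
        exact hx.2 (Finset.mem_biUnion.2 ⟨b, hbK, hx.1⟩)
      have hcard : (insert b K).card = K.card + 1 := Finset.card_insert_of_notMem hbK
      have hR' : K.card + 1 ≤ R := by
        refine hR _ (le_trans ?_ hUK)
        have : 0 < (U K).card := by
          obtain ⟨x, hx⟩ := hne
          rw [uncoveredIn, Finset.mem_sdiff] at hx
          exact Finset.card_pos.2 ⟨x, Finset.mem_sdiff.2
            ⟨Finset.mem_biUnion.2 ⟨b, Finset.mem_range.2 hbn, hx.1⟩, hx.2⟩⟩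
        exact_mod_cast this
      refine ⟨⟨Function.update f b 1, insert b K, h2,
        Finset.insert_subset (Finset.mem_range.2 hbn) hK, fun i hi => ?_, by rw [h3, hcard], ?_, ?_,
        hcard ▸ hR', Or.inl (h4.trans hb)⟩, by omega⟩
      · by_cases hib : i = b
        · simp [hib]
        · simp [hib, hf i hi]
      · rw [hcard, Finset.range_add_one, Finset.image_insert, h5, Function.update_self]
        congr 1
        conv_rhs => rw [← himg]
        refine Finset.image_congr fun x hx => ?_
        simp only [Finset.coe_range, Set.mem_Iio] at hx
        rw [Function.update_of_ne hx.ne]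
      · have h6 := greedy_step (D.pts d) D.n O K hO hcov b hbn hbest hOpos
        refine h6.trans ((mul_le_mul_of_nonneg_right hUK (Real.exp_pos _).le).trans_eq ?_)
        rw [mul_assoc, ← Real.exp_add, hcard]
        push_cast
        ring_nf
  · refine ⟨D.sel, ∅, ?_, by simp, by simp [hsel], by simpa [setWord_word] using hm, by simp, ?_,
      by simp, Or.inl (by simp [setWord_word])⟩
    · exact hs.agree ((Agree.refl (fun k _ => k = 18) _).setWord _ _ rfl) (by omega)
    · have h1 : (U ∅).card ≤ D.N ^ d := by
        simpa [hU] using Tables.card_pts_le hD (s := Finset.range D.n) (by simp)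
      have h2 : ((U ∅).card : ℝ) ≤ (D.N : ℝ) ^ d := by exact_mod_cast h1
      simpa using h2
  · simp [setWord_word, hm]
  · rintro s₂ ⟨⟨f, K, hH, hK, hf, hm', himg, hUK, hKR, hst⟩, hb⟩
    simp only [Test.holds, eval_var, hl1] at hb
    have hemp := (hst.resolve_left hb).2
    refine Runs.mono (T := 4) (runs_of_loopFree (by exact trivial) ⟨K, hK, hKR, fun i hi => ?_, ?_, ?_⟩)
      le_rfl fun _ h => h
    · exact Finset.sdiff_eq_empty_iff_subset.1 (hemp i hi)
    · simp [Program.run, setWord_word, WordExpr.eval, hm']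
    · rw [Program.run, setWord_word_ne _ _ _ (by simp)]; exact himg


/-! ### Computing the tables -/

/-- Increment the variable `r` if the test succeeds. -/
def countIf (r : ℕ) (t : Test) : Program :=
  .ite t (.setWord (reg r 0) (.lit 0) (.add (.var r 0) (.lit 1))) .skip

theorem run_countIf {w r : ℕ} {t : Test} {s : State} (p : Prop) [Decidable p]
    (h : t.holds w s ↔ p) (hlt : s.word (reg r 0) 0 + 1 < 2 ^ w) :
    Agree (fun k _ => k = r) s ((countIf r t).run w s) ∧
      ((countIf r t).run w s).word (reg r 0) 0 = s.word (reg r 0) 0 + if p then 1 else 0 := by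
  classical
  have hv : (WordExpr.add (.var r 0) (.lit 1)).eval w s = s.word (reg r 0) 0 + 1 := by
    rw [eval_add] <;> rw [eval_lit (by omega), eval_var]
    exact hlt
  simp only [countIf, Program.run, h, hv]
  split_ifs
  · exact ⟨(Agree.refl _ _).setWord _ _ rfl, by simp [setWord_word, WordExpr.eval]⟩
  · exact ⟨Agree.refl _ _, rfl⟩

/-- Disjunction of tests. -/
def Test.or (b c : Test) : Test := .not (.and (.not b) (.not c))

theorem holds_or {w : ℕ} {s : State} {b c : Test} :
    (Test.or b c).holds w s ↔ b.holds w s ∨ c.holds w s := by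
  simp only [Test.or, Test.holds]
  tauto

/-- Coordinate `j` of box number `v` (a variable) in the real array `a`. -/
def coord (d a j v : ℕ) : RealExpr :=
  .read a (.add (.mul (.var v 0) (.lit d)) (.lit j))

theorem eval_coord {w d a j v i n : ℕ} {s : State} (hv : s.word (reg v 0) 0 = i) (hi : i < n)
    (hj : j < d) (h : n * d < 2 ^ w) : (coord d a j v).eval w s = s.real a (i * d + j) := by
  have h2 : (i + 1) * d ≤ n * d := Nat.mul_le_mul_right d hi
  rw [Nat.add_mul, one_mul] at h2
  have hd : d < 2 ^ w := by omega
  have h1 : (WordExpr.mul (.var v 0) (.lit d)).eval w s = i * d := by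
    rw [eval_mul] <;> rw [eval_var, hv, eval_lit hd]
    omega
  rw [coord, RealExpr.eval, eval_add] <;> rw [h1, eval_lit (by omega)]
  omega

/-- Compare the ends of box `i` with those of box `k` in dimension `j`. -/
def compareBody (d j : ℕ) : Program :=
  -- Families 20 and 21 accumulate the ranks of the two ends. Families 22 and 23 count later boxes
  -- with the same lower or upper end, and are zero exactly if that end is the last of its equals.
  .seq (countIf 20 (.or (.realLt (coord d 0 j 13) (coord d 0 j 14))
    (.and (.realEq (coord d 0 j 13) (coord d 0 j 14)) (.wordLt (.var 13 0) (.var 14 0)))))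
  (.seq (countIf 20 (.realLt (coord d 1 j 13) (coord d 0 j 14)))
  (.seq (countIf 21 (.not (.realLt (coord d 1 j 14) (coord d 0 j 13))))
  (.seq (countIf 21 (.or (.realLt (coord d 1 j 13) (coord d 1 j 14))
    (.and (.realEq (coord d 1 j 13) (coord d 1 j 14)) (.wordLt (.var 13 0) (.var 14 0)))))
  (.seq (countIf 22 (.and (.realEq (coord d 0 j 13) (coord d 0 j 14))
    (.wordLt (.var 14 0) (.var 13 0))))
  (countIf 23 (.and (.realEq (coord d 1 j 13) (coord d 1 j 14))
    (.wordLt (.var 14 0) (.var 13 0))))))))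

/-- Compute the ranks of the ends of box `i` in dimension `j`. -/
def rankBox (d j : ℕ) : Program :=
  .seq (.seq (.setWord (reg 20 0) (.lit 0) (.lit 0)) (.seq (.setWord (reg 21 0) (.lit 0) (.lit 0))
    (.seq (.setWord (reg 22 0) (.lit 0) (.lit 0)) (.setWord (reg 23 0) (.lit 0) (.lit 0)))))
    (forLoop 13 1 (compareBody d j))

theorem runs_rankBox {d n w : ℕ} (B : Fin n → Box d) {j : ℕ} (hj : j < d)
    (hw : 2 * n + n * d + 2 < 2 ^ w) {s : State} (hreal : s.real = (inputState B).real)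
    (hn : s.word (reg 1 0) 0 = n) {i : ℕ} (hi : i < n) (hiv : s.word (reg 14 0) 0 = i) :
    Runs w (rankBox d j) s (12 + (((compareBody d j).bound + 11) * n + 8)) (fun s' =>
      Agree (fun k _ => k = 13 ∨ 20 ≤ k ∧ k ≤ 23) s s' ∧
      s'.word (reg 20 0) 0 = IntervalRank.rank (lower B j) (upper B j) n (i, false) ∧
      s'.word (reg 21 0) 0 = IntervalRank.rank (lower B j) (upper B j) n (i, true) ∧
      s'.word (reg 22 0) 0 = (∑ k ∈ Finset.range n,
        if lower B j k = lower B j i ∧ i < k then 1 else 0) ∧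
      s'.word (reg 23 0) 0 = ∑ k ∈ Finset.range n,
        if upper B j k = upper B j i ∧ i < k then 1 else 0) := by
  refine Runs.seq (Q₁ := fun s₁ => Agree (fun k _ => k = 13 ∨ 20 ≤ k ∧ k ≤ 23) s s₁ ∧
    s₁.word (reg 20 0) 0 = 0 ∧ s₁.word (reg 21 0) 0 = 0 ∧ s₁.word (reg 22 0) 0 = 0 ∧
    s₁.word (reg 23 0) 0 = 0) (T₁ := 12) (runs_of_loopFree (by simp [Program.LoopFree]) ?_) ?_
  · refine ⟨?_, ?_⟩
    · exact ((((Agree.refl _ _).setWord _ _ (by omega)).setWord _ _ (by omega)).setWord _ _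
        (by omega)).setWord _ _ (by omega)
    · simp [Program.run, setWord_word, WordExpr.eval]
  rintro s₁ ⟨hA₁, h20, h21, h22, h23⟩
  refine Runs.mono (Runs.forLoop (m := n) (T := (compareBody d j).bound) (by omega) (fun k s' =>
    Agree (fun k _ => k = 13 ∨ 20 ≤ k ∧ k ≤ 23) s s' ∧ s'.word (reg 13 0) 0 = k ∧
    s'.word (reg 20 0) 0 = (∑ k ∈ Finset.range k,
      ((if lower B j k < lower B j i ∨ (lower B j k = lower B j i ∧ k < i) then 1 else 0) +
        if upper B j k < lower B j i then 1 else 0)) ∧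
    s'.word (reg 21 0) 0 = (∑ k ∈ Finset.range k,
      ((if lower B j k ≤ upper B j i then 1 else 0) +
        if upper B j k < upper B j i ∨ (upper B j k = upper B j i ∧ k < i) then 1 else 0)) ∧
    s'.word (reg 22 0) 0 = (∑ k ∈ Finset.range k,
      if lower B j k = lower B j i ∧ i < k then 1 else 0) ∧
    s'.word (reg 23 0) 0 = ∑ k ∈ Finset.range k,
      if upper B j k = upper B j i ∧ i < k then 1 else 0) ?_ ?_ ?_) le_rfl ?_
  · rintro k s' ⟨h1, h2, -⟩
    exact ⟨h2, by rw [h1.1 1 0 (by omega), hn]⟩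
  · rintro k s' hk ⟨hA, hv, e20, e21, e22, e23⟩
    refine runs_of_loopFree (by simp [compareBody, countIf, Program.LoopFree]) ?_
    have hco : ∀ s'' : State, Agree (fun k _ => k = 13 ∨ 20 ≤ k ∧ k ≤ 23) s s'' →
        s''.word (reg 13 0) 0 = k →
        (coord d 0 j 13).eval w s'' = lower B j k ∧ (coord d 1 j 13).eval w s'' = upper B j k ∧
        (coord d 0 j 14).eval w s'' = lower B j i ∧ (coord d 1 j 14).eval w s'' = upper B j i ∧
        s''.word (reg 14 0) 0 = i := by
      intro s'' hA'' hv''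
      have h14 : s''.word (reg 14 0) 0 = i := by rw [hA''.1 14 0 (by omega), hiv]
      have hr : s''.real = (inputState B).real := hA''.2.trans hreal
      refine ⟨?_, ?_, ?_, ?_, h14⟩
      · rw [eval_coord hv'' hk hj (by omega), hr]; rfl
      · rw [eval_coord hv'' hk hj (by omega), hr]; rfl
      · rw [eval_coord h14 hi hj (by omega), hr]; rfl
      · rw [eval_coord h14 hi hj (by omega), hr]; rfl
    have hb2 : ∀ (f g : ℕ → Prop) [DecidablePred f] [DecidablePred g], (∑ k ∈ Finset.range k, ((if f k then 1 else 0) +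
        if g k then 1 else 0)) ≤ 2 * k := by
      intro f g _ _
      refine (Finset.sum_le_card_nsmul _ _ 2 fun x _ => by split_ifs <;> omega).trans ?_
      simp [mul_comm]
    have hb1 : ∀ (f : ℕ → Prop) [DecidablePred f], (∑ k ∈ Finset.range k, (if f k then 1 else 0)) ≤ k := by
      intro f _
      refine (Finset.sum_le_card_nsmul _ _ 1 fun x _ => by split_ifs <;> omega).trans ?_
      simp
    have b20 := e20.trans_le (hb2 _ _)
    have b21 := e21.trans_le (hb2 _ _)
    have b22 := e22.trans_le (hb1 _)
    have b23 := e23.trans_le (hb1 _)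
    simp only [compareBody, Program.run]
    -- the six comparisons in turn
    obtain ⟨c1, c2, c3, c4, c5⟩ := hco s' hA hv
    obtain ⟨g1, v1⟩ := run_countIf (w := w) (r := 20) (s := s') (t := .or
      (.realLt (coord d 0 j 13) (coord d 0 j 14))
      (.and (.realEq (coord d 0 j 13) (coord d 0 j 14)) (.wordLt (.var 13 0) (.var 14 0))))
      (lower B j k < lower B j i ∨ (lower B j k = lower B j i ∧ k < i))
      (by simp only [holds_or, Test.holds, c1, c3, eval_var, hv, c5]) (by omega)
    set s1 := (countIf 20 (.or (.realLt (coord d 0 j 13) (coord d 0 j 14))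
      (.and (.realEq (coord d 0 j 13) (coord d 0 j 14)) (.wordLt (.var 13 0) (.var 14 0))))).run w s'
    have hA1 : Agree (fun k _ => k = 13 ∨ 20 ≤ k ∧ k ≤ 23) s s1 := hA.trans g1 (by omega) (by omega)
    have hv1 : s1.word (reg 13 0) 0 = k := by rw [g1.1 13 0 (by omega), hv]
    clear c1 c2 c3 c4 c5
    obtain ⟨c1, c2, c3, c4, c5⟩ := hco s1 hA1 hv1
    obtain ⟨g2, v2⟩ := run_countIf (w := w) (r := 20) (s := s1)
      (t := .realLt (coord d 1 j 13) (coord d 0 j 14)) (upper B j k < lower B j i)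
      (by simp only [Test.holds, c2, c3]) (by rw [v1]; split_ifs <;> omega)
    set s2 := (countIf 20 (.realLt (coord d 1 j 13) (coord d 0 j 14))).run w s1
    have hA2 : Agree (fun k _ => k = 13 ∨ 20 ≤ k ∧ k ≤ 23) s s2 := hA1.trans g2 (by omega) (by omega)
    have hv2 : s2.word (reg 13 0) 0 = k := by rw [g2.1 13 0 (by omega), hv1]
    clear c1 c2 c3 c4 c5
    obtain ⟨c1, c2, c3, c4, c5⟩ := hco s2 hA2 hv2
    have v21 : s2.word (reg 21 0) 0 = s'.word (reg 21 0) 0 := by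
      rw [g2.1 21 0 (by omega), g1.1 21 0 (by omega)]
    obtain ⟨g3, v3⟩ := run_countIf (w := w) (r := 21) (s := s2)
      (t := .not (.realLt (coord d 1 j 14) (coord d 0 j 13))) (lower B j k ≤ upper B j i)
      (by simp only [Test.holds, c1, c4, not_lt]) (by omega)
    set s3 := (countIf 21 (.not (.realLt (coord d 1 j 14) (coord d 0 j 13)))).run w s2
    have hA3 : Agree (fun k _ => k = 13 ∨ 20 ≤ k ∧ k ≤ 23) s s3 := hA2.trans g3 (by omega) (by omega)
    have hv3 : s3.word (reg 13 0) 0 = k := by rw [g3.1 13 0 (by omega), hv2]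
    clear c1 c2 c3 c4 c5
    obtain ⟨c1, c2, c3, c4, c5⟩ := hco s3 hA3 hv3
    obtain ⟨g4, v4⟩ := run_countIf (w := w) (r := 21) (s := s3) (t := .or
      (.realLt (coord d 1 j 13) (coord d 1 j 14))
      (.and (.realEq (coord d 1 j 13) (coord d 1 j 14)) (.wordLt (.var 13 0) (.var 14 0))))
      (upper B j k < upper B j i ∨ (upper B j k = upper B j i ∧ k < i))
      (by simp only [holds_or, Test.holds, c2, c4, eval_var, hv3, c5])
      (by rw [v3]; split_ifs <;> omega)
    set s4 := (countIf 21 (.or (.realLt (coord d 1 j 13) (coord d 1 j 14))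
      (.and (.realEq (coord d 1 j 13) (coord d 1 j 14)) (.wordLt (.var 13 0) (.var 14 0))))).run w s3
    have hA4 : Agree (fun k _ => k = 13 ∨ 20 ≤ k ∧ k ≤ 23) s s4 := hA3.trans g4 (by omega) (by omega)
    have hv4 : s4.word (reg 13 0) 0 = k := by rw [g4.1 13 0 (by omega), hv3]
    clear c1 c2 c3 c4 c5
    obtain ⟨c1, c2, c3, c4, c5⟩ := hco s4 hA4 hv4
    have v22 : s4.word (reg 22 0) 0 = s'.word (reg 22 0) 0 := by
      rw [g4.1 22 0 (by omega), g3.1 22 0 (by omega), g2.1 22 0 (by omega), g1.1 22 0 (by omega)]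
    obtain ⟨g5, v5⟩ := run_countIf (w := w) (r := 22) (s := s4)
      (t := .and (.realEq (coord d 0 j 13) (coord d 0 j 14)) (.wordLt (.var 14 0) (.var 13 0)))
      (lower B j k = lower B j i ∧ i < k)
      (by simp only [Test.holds, c1, c3, eval_var, hv4, c5]) (by omega)
    set s5 := (countIf 22 (.and (.realEq (coord d 0 j 13) (coord d 0 j 14))
      (.wordLt (.var 14 0) (.var 13 0)))).run w s4
    have hA5 : Agree (fun k _ => k = 13 ∨ 20 ≤ k ∧ k ≤ 23) s s5 := hA4.trans g5 (by omega) (by omega)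
    have hv5 : s5.word (reg 13 0) 0 = k := by rw [g5.1 13 0 (by omega), hv4]
    clear c1 c2 c3 c4 c5
    obtain ⟨c1, c2, c3, c4, c5⟩ := hco s5 hA5 hv5
    have v23 : s5.word (reg 23 0) 0 = s'.word (reg 23 0) 0 := by
      rw [g5.1 23 0 (by omega), g4.1 23 0 (by omega), g3.1 23 0 (by omega), g2.1 23 0 (by omega),
        g1.1 23 0 (by omega)]
    obtain ⟨g6, v6⟩ := run_countIf (w := w) (r := 23) (s := s5)
      (t := .and (.realEq (coord d 1 j 13) (coord d 1 j 14)) (.wordLt (.var 14 0) (.var 13 0)))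
      (upper B j k = upper B j i ∧ i < k)
      (by simp only [Test.holds, c2, c4, eval_var, hv5, c5]) (by omega)
    set s6 := (countIf 23 (.and (.realEq (coord d 1 j 13) (coord d 1 j 14))
      (.wordLt (.var 14 0) (.var 13 0)))).run w s5
    have hA6 : Agree (fun k _ => k = 13 ∨ 20 ≤ k ∧ k ≤ 23) s s6 := hA5.trans g6 (by omega) (by omega)
    refine ⟨by rw [g6.1 13 0 (by omega), hv5], hA6.setWord _ _ (by omega), by simp [setWord_word],
      ?_, ?_, ?_, ?_⟩
    · rw [setWord_word_ne _ _ _ (by simp), g6.1 20 0 (by omega), g5.1 20 0 (by omega),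
        g4.1 20 0 (by omega), g3.1 20 0 (by omega), v2, v1, e20, Finset.sum_range_succ, add_assoc]
    · rw [setWord_word_ne _ _ _ (by simp), g6.1 21 0 (by omega), g5.1 21 0 (by omega), v4, v3, v21,
        e21, Finset.sum_range_succ, add_assoc]
    · rw [setWord_word_ne _ _ _ (by simp), g6.1 22 0 (by omega), v5, v22, e22,
        Finset.sum_range_succ]
    · rw [setWord_word_ne _ _ _ (by simp), v6, v23, e23, Finset.sum_range_succ]
  · refine ⟨hA₁.setWord _ _ (by omega), by simp [setWord_word], ?_⟩
    simp [setWord_word, h20, h21, h22, h23]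
  · rintro s' ⟨h1, -, h3, h4, h5, h6⟩
    refine ⟨h1, ?_, ?_, h5, h6⟩
    · rw [h3, IntervalRank.rank_false_eq]
    · rw [h4, IntervalRank.rank_true_eq]


/-- Store the ranks of the ends of box `i` in dimension `j`. -/
def storeRanks (j : ℕ) : Program :=
  .seq (.setWord (reg 5 j) (.var 14 0) (.var 20 0))
  (.seq (.setWord (reg 6 j) (.var 14 0) (.var 21 0))
  (.seq (.setWord (reg 7 j) (.var 20 0) (.add (.var 14 0) (.lit 1)))
  (.seq (.setWord (reg 8 j) (.var 20 0) (.sub (.lit 1) (.var 22 0)))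
  (.setWord (reg 8 j) (.var 21 0) (.sub (.lit 1) (.var 23 0))))))

/-- Compute all ranks in dimension `j`. -/
def rankDim (d j : ℕ) : Program := forLoop 14 1 (.seq (rankBox d j) (storeRanks j))

/-- The time taken by `rankDim`. -/
def rankDimTime (n d j : ℕ) : ℕ :=
  (12 + (((compareBody d j).bound + 11) * n + 8) + (storeRanks j).bound + 11) * n + 8

/-- The rank tables in dimension `j` are correct for the first `m` boxes. -/
structure RanksStored {d n : ℕ} (B : Fin n → Box d) (j m : ℕ) (s : State) : Prop where
  l_eq : ∀ i < m, s.word (reg 5 j) i = IntervalRank.rank (lower B j) (upper B j) n (i, false)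
  h_eq : ∀ i < m, s.word (reg 6 j) i = IntervalRank.rank (lower B j) (upper B j) n (i, true)
  op_eq : ∀ x i, s.word (reg 7 j) x = i + 1 ↔
    i < m ∧ IntervalRank.rank (lower B j) (upper B j) n (i, false) = x
  wt_eq : ∀ x, s.word (reg 8 j) x = 1 ↔ ∃ e : ℕ × Bool, e.1 < m ∧
    IntervalRank.Last (lower B j) (upper B j) n e ∧
      IntervalRank.rank (lower B j) (upper B j) n e = x

theorem RanksStored.congr {d n : ℕ} {B : Fin n → Box d} {j m : ℕ} {s s' : State}
    (h : RanksStored B j m s) (h5 : s'.word (reg 5 j) = s.word (reg 5 j))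
    (h6 : s'.word (reg 6 j) = s.word (reg 6 j)) (h7 : s'.word (reg 7 j) = s.word (reg 7 j))
    (h8 : s'.word (reg 8 j) = s.word (reg 8 j)) : RanksStored B j m s' := by
  constructor
  · rw [h5]; exact h.l_eq
  · rw [h6]; exact h.h_eq
  · rw [h7]; exact h.op_eq
  · rw [h8]; exact h.wt_eq

/-- Truncated subtraction from 1 is the indicator that the count vanishes. -/
theorem last_iff_sum {n i : ℕ} (hi : i < n) (v : ℕ → ℝ) :
    1 - (∑ k ∈ Finset.range n, if v k = v i ∧ i < k then 1 else 0) = 1 ↔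
      i < n ∧ ∀ k < n, v k = v i → k ≤ i := by
  have h : (∑ k ∈ Finset.range n, if v k = v i ∧ i < k then 1 else 0) = 0 ↔
      ∀ k < n, v k = v i → k ≤ i := by
    rw [Finset.sum_eq_zero_iff]
    simp only [Finset.mem_range, ite_eq_right_iff, one_ne_zero, imp_false, not_and, not_lt]
  rw [← h]
  omega

/-- The opening and weight tables are indexed by rank and written only at ranks of ends. Initial
zeros supply the values elsewhere, and distinctness of ranks excludes overwriting. -/
theorem runs_rankDim {d n w : ℕ} (B : Fin n → Box d) {j : ℕ} (hj : j < d)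
    (hw : 2 * n + n * d + 2 < 2 ^ w) {s : State} (hreal : s.real = (inputState B).real)
    (hn : s.word (reg 1 0) 0 = n) (h7 : ∀ x, s.word (reg 7 j) x = 0)
    (h8 : ∀ x, s.word (reg 8 j) x = 0) :
    Runs w (rankDim d j) s (rankDimTime n d j) (fun s' =>
      Agree (fun k j' => (5 ≤ k ∧ k ≤ 8 ∧ j' = j) ∨ k = 13 ∨ k = 14 ∨ 20 ≤ k ∧ k ≤ 23) s s' ∧
      RanksStored B j n s') := by
  refine Runs.mono (Runs.forLoop (m := n)
    (T := 12 + (((compareBody d j).bound + 11) * n + 8) + (storeRanks j).bound) (by omega)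
    (fun m s' => m ≤ n ∧
      Agree (fun k j' => (5 ≤ k ∧ k ≤ 8 ∧ j' = j) ∨ k = 13 ∨ k = 14 ∨ 20 ≤ k ∧ k ≤ 23) s s' ∧
      s'.word (reg 14 0) 0 = m ∧ RanksStored B j m s') ?_ ?_ ?_) le_rfl ?_
  · rintro m s' ⟨-, h1, h2, -⟩
    exact ⟨h2, by rw [h1.1 1 0 (by omega), hn]⟩
  · rintro m s' hm ⟨-, hA, hv, hS⟩
    refine Runs.seq (runs_rankBox B hj hw (hA.2.trans hreal) (by rw [hA.1 1 0 (by omega), hn]) hm hv) ?_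
    rintro s₁ ⟨hA₁, h20, h21, h22, h23⟩
    have hv₁ : s₁.word (reg 14 0) 0 = m := by rw [hA₁.1 14 0 (by omega), hv]
    have hS₁ : RanksStored B j m s₁ := hS.congr (hA₁.1 5 j (by omega)) (hA₁.1 6 j (by omega))
      (hA₁.1 7 j (by omega)) (hA₁.1 8 j (by omega))
    refine runs_of_loopFree (by simp [storeRanks, Program.LoopFree]) ?_
    set lo := lower B j
    set hi := upper B j
    set L := IntervalRank.rank lo hi n (m, false) with hL
    set H := IntervalRank.rank lo hi n (m, true) with hH
    have hLH : L ≠ H := by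
      intro h
      have := IntervalRank.rank_inj lo hi n (e := (m, false)) (e' := (m, true)) hm hm h
      simp at this
    have hl1 : ∀ s : State, (WordExpr.lit 1).eval w s = 1 := eval_lit (by omega)
    have hadd : ∀ s : State, s.word (reg 14 0) 0 = m →
        (WordExpr.add (.var 14 0) (.lit 1)).eval w s = m + 1 := by
      intro s hs
      rw [eval_add] <;> rw [eval_var, hs, hl1]
      omega
    have hrun : (storeRanks j).run w s₁ = ((((s₁.setWord (reg 5 j) m L).setWord (reg 6 j) m
        H).setWord (reg 7 j) L (m + 1)).setWord (reg 8 j) L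
        (1 - ∑ k ∈ Finset.range n, if lo k = lo m ∧ m < k then 1 else 0)).setWord (reg 8 j) H
        (1 - ∑ k ∈ Finset.range n, if hi k = hi m ∧ m < k then 1 else 0) := by
      simp only [storeRanks, Program.run]
      rw [hadd]
      · simp [setWord_word, hv₁, h20, h21, h22, h23, hl1]
      · simp [setWord_word, hv₁]
    rw [hrun]
    have hcl := last_iff_sum hm lo
    have hch := last_iff_sum hm hi
    clear hrun h22 h23
    generalize (1 - ∑ k ∈ Finset.range n, if lo k = lo m ∧ m < k then 1 else 0) = cl at hcl ⊢
    generalize (1 - ∑ k ∈ Finset.range n, if hi k = hi m ∧ m < k then 1 else 0) = ch at hch ⊢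
    have hinj : ∀ e e' : ℕ × Bool, e.1 < n → e'.1 < n →
      IntervalRank.rank lo hi n e = IntervalRank.rank lo hi n e' → e = e' := fun e e' h h' =>
        IntervalRank.rank_inj lo hi n h h'
    refine ⟨by simp [setWord_word, hv₁], by omega, ?_, by simp [setWord_word], ?_⟩
    · exact ((((((hA.trans hA₁ (by omega) (by omega)).setWord _ _ (by omega)).setWord _ _
        (by omega)).setWord _ _ (by omega)).setWord _ _ (by omega)).setWord _ _ (by omega)).setWord _ _
        (by omega)
    · constructor
      · intro i hi'
        by_cases him : i = m
        · subst him; simp [setWord_word, L, lo, hi]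
        · simp [setWord_word, him, hS₁.l_eq i (by omega)]
      · intro i hi'
        by_cases him : i = m
        · subst him; simp [setWord_word, H, lo, hi]
        · simp [setWord_word, him, hS₁.h_eq i (by omega)]
      · intro x i
        by_cases hx : x = L
        · subst hx
          simp only [setWord_word, reg_inj]
          norm_num
          constructor
          · rintro rfl
            exact ⟨by omega, rfl⟩
          · rintro ⟨hi1, hi2⟩
            have := hinj (i, false) (m, false) (by omega) hm hi2
            simp only [Prod.mk.injEq, and_true] at this
            exact this.symm
        · have : (i < m + 1 ∧ IntervalRank.rank lo hi n (i, false) = x) ↔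
              (i < m ∧ IntervalRank.rank lo hi n (i, false) = x) := by
            constructor
            · rintro ⟨h1, h2⟩
              refine ⟨?_, h2⟩
              rcases Nat.lt_succ_iff_lt_or_eq.1 h1 with h | rfl
              · exact h
              · exact absurd h2.symm hx
            · rintro ⟨h1, h2⟩
              exact ⟨by omega, h2⟩
          rw [this, ← hS₁.op_eq x i]
          simp [setWord_word, hx]
      · intro x
        by_cases hxH : x = H
        · subst hxH
          have e : (((((((s₁.setWord (reg 5 j) m L).setWord (reg 6 j) m H).setWord (reg 7 j) L
              (m + 1)).setWord (reg 8 j) L cl).setWord (reg 8 j) H ch).setWord (reg 14 0) 0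
              (m + 1)).word (reg 8 j) H) = ch := by simp [setWord_word]
          rw [e, hch]
          constructor
          · exact fun h => ⟨(m, true), by simp, ⟨h.1, by simpa using h.2⟩, rfl⟩
          · rintro ⟨⟨i, t⟩, h1, h2, h3⟩
            have := hinj (i, t) (m, true) (by omega) hm h3
            simp only [Prod.mk.injEq] at this
            obtain ⟨rfl, rfl⟩ := this
            exact ⟨h2.1, by simpa using h2.2⟩
        by_cases hxL : x = L
        · subst hxL
          have e : (((((((s₁.setWord (reg 5 j) m L).setWord (reg 6 j) m H).setWord (reg 7 j) L
              (m + 1)).setWord (reg 8 j) L cl).setWord (reg 8 j) H ch).setWord (reg 14 0) 0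
              (m + 1)).word (reg 8 j) L) = cl := by simp [setWord_word, hLH]
          rw [e, hcl]
          constructor
          · exact fun h => ⟨(m, false), by simp, ⟨h.1, by simpa using h.2⟩, rfl⟩
          · rintro ⟨⟨i, t⟩, h1, h2, h3⟩
            have := hinj (i, t) (m, false) (by omega) hm h3
            simp only [Prod.mk.injEq] at this
            obtain ⟨rfl, rfl⟩ := this
            exact ⟨h2.1, by simpa using h2.2⟩
        · have hw8 := hS₁.wt_eq x
          have e : (((((((s₁.setWord (reg 5 j) m L).setWord (reg 6 j) m H).setWord (reg 7 j) L
              (m + 1)).setWord (reg 8 j) L cl).setWord (reg 8 j) H ch).setWord (reg 14 0) 0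
              (m + 1)).word (reg 8 j) x) = s₁.word (reg 8 j) x := by simp [setWord_word, hxH, hxL]
          rw [e, hw8]
          constructor
          · rintro ⟨⟨i, t⟩, h1, h2, h3⟩
            exact ⟨(i, t), by dsimp only at h1 ⊢; omega, h2, h3⟩
          · rintro ⟨⟨i, t⟩, h1, h2, h3⟩
            refine ⟨(i, t), ?_, h2, h3⟩
            rcases Nat.lt_succ_iff_lt_or_eq.1 h1 with h | rfl
            · exact h
            · cases t
              · exact absurd h3.symm hxL
              · exact absurd h3.symm hxH
  · refine ⟨Nat.zero_le _, (Agree.refl _ _).setWord _ _ (by omega), by simp [setWord_word], ?_⟩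
    constructor
    · omega
    · omega
    · simp [setWord_word, h7]
    · simp [setWord_word, h8]
  · rintro s' ⟨-, h1, -, h3⟩
    exact ⟨h1, h3⟩

/-- Compute all ranks in the dimensions below `m`. -/
def rankAll (d : ℕ) : ℕ → Program
  | 0 => .skip
  | m + 1 => .seq (rankAll d m) (rankDim d m)

/-- The time taken by `rankAll`. -/
def rankAllTime (n d : ℕ) : ℕ → ℕ
  | 0 => 1
  | m + 1 => rankAllTime n d m + rankDimTime n d m

theorem runs_rankAll {d n w : ℕ} (B : Fin n → Box d)
    (hw : 2 * n + n * d + 2 < 2 ^ w) {s : State} (hreal : s.real = (inputState B).real)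
    (hn : s.word (reg 1 0) 0 = n) (h7 : ∀ j x, s.word (reg 7 j) x = 0)
    (h8 : ∀ j x, s.word (reg 8 j) x = 0) (m : ℕ) (hm : m ≤ d) :
    Runs w (rankAll d m) s (rankAllTime n d m) (fun s' =>
      Agree (fun k j => (5 ≤ k ∧ k ≤ 8 ∧ j < m) ∨ k = 13 ∨ k = 14 ∨ 20 ≤ k ∧ k ≤ 23) s s' ∧
      ∀ j < m, RanksStored B j n s') := by
  induction m with
  | zero => exact ⟨1, s, .skip s, le_rfl, Agree.refl _ _, by omega⟩
  | succ m ih =>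
    refine Runs.seq (ih (by omega)) ?_
    rintro s₁ ⟨hA, hS⟩
    refine Runs.mono (runs_rankDim B (j := m) (by omega) hw (hA.2.trans hreal)
      (by rw [hA.1 1 0 (by omega), hn]) (by rw [hA.1 7 m (by omega)]; exact h7 m)
      (by rw [hA.1 8 m (by omega)]; exact h8 m)) le_rfl ?_
    rintro s₂ ⟨hA₂, hS₂⟩
    refine ⟨hA.trans hA₂ (by omega) (by omega), fun j hj => ?_⟩
    rcases Nat.lt_succ_iff_lt_or_eq.1 hj with h | rfl
    · exact (hS j h).congr (hA₂.1 5 j (by omega)) (hA₂.1 6 j (by omega)) (hA₂.1 7 j (by omega))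
        (hA₂.1 8 j (by omega))
    · exact hS₂

/-! ### Cell width and preparation of the tables -/

/-- Compute the least `step` with `n ≤ step ^ 2`. -/
def sqrtLoop : Program :=
  .loop (.wordLt (.mul (.var 3 0) (.var 3 0)) (.var 1 0))
    (.setWord (reg 3 0) (.lit 0) (.add (.var 3 0) (.lit 1)))

/-- Counting up is cheap enough. The first bound limits the number of multiples of `step` in the
grid, the second the length of a cell side; both become `O(√n)`. -/
theorem runs_sqrtLoop {n w : ℕ} (hw : n * n + n + 2 < 2 ^ w) {s : State}
    (hn : s.word (reg 1 0) 0 = n) (h3 : s.word (reg 3 0) 0 = 0) :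
    Runs w sqrtLoop s ((8 + 6) * n + 8) (fun s' => Agree (fun k _ => k = 3) s s' ∧
      n ≤ s'.word (reg 3 0) 0 * s'.word (reg 3 0) 0 ∧
      ∀ t < s'.word (reg 3 0) 0, t * t < n) := by
  have hmul : ∀ s' : State, s'.word (reg 3 0) 0 ≤ n →
      (WordExpr.mul (.var 3 0) (.var 3 0)).eval w s' =
        s'.word (reg 3 0) 0 * s'.word (reg 3 0) 0 := by
    intro s' h
    have := Nat.mul_le_mul h h
    rw [eval_mul] <;> simp only [eval_var]
    omega
  refine Runs.mono (Runs.loop (b := .wordLt (.mul (.var 3 0) (.var 3 0)) (.var 1 0)) (T := 6)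
    (fun s' => Agree (fun k _ => k = 3) s s' ∧ s'.word (reg 3 0) 0 ≤ n ∧
      ∀ t < s'.word (reg 3 0) 0, t * t < n) (fun s' => n - s'.word (reg 3 0) 0) ?_ n s ?_
      (by omega)) le_rfl ?_
  · rintro s' ⟨hA, hle, ht⟩ hb
    simp only [Test.holds, hmul s' hle, eval_var, hA.1 1 0 (by omega), hn] at hb
    have hlt : s'.word (reg 3 0) 0 < n := lt_of_le_of_lt (Nat.le_mul_self _) hb
    have hadd : (WordExpr.add (.var 3 0) (.lit 1)).eval w s' = s'.word (reg 3 0) 0 + 1 := by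
      rw [eval_add] <;> rw [eval_var, eval_lit (by omega)]
      omega
    refine runs_of_loopFree (by exact trivial) ?_
    have h0 : (WordExpr.lit 0).eval w s' = 0 := eval_lit (by omega) s'
    simp only [Program.run, hadd, h0, setWord_word, and_self, if_true]
    refine ⟨⟨hA.setWord _ _ rfl, by omega, fun t hlt' => ?_⟩, by omega⟩
    rcases Nat.lt_succ_iff_lt_or_eq.1 hlt' with h | rfl
    · exact ht t h
    · exact hb
  · exact ⟨Agree.refl _ _, by omega, by omega⟩
  · rintro s' ⟨⟨hA, hle, ht⟩, hb⟩
    simp only [Test.holds, hmul s' hle, eval_var, hA.1 1 0 (by omega), hn] at hb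
    exact ⟨hA, not_lt.1 hb, ht⟩

/-- Compute the tables from the input. -/
def setup (d : ℕ) : Program :=
  .seq (.setWord (reg 1 0) (.lit 0) (.var 0 0))
    (.seq (.setWord (reg 2 0) (.lit 0) (.add (.var 1 0) (.var 1 0)))
      (.seq sqrtLoop (rankAll d d)))

/-- The time taken by `setup`. -/
def setupTime (n d : ℕ) : ℕ := 4 + (7 + (((8 + 6) * n + 8) + rankAllTime n d d))

theorem runs_setup {d n w : ℕ} (B : Fin n → Box d) (hn0 : 0 < n)
    (hw : n * n + 2 * n + n * d + 2 < 2 ^ w) :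
    Runs w (setup d) (inputState B) (setupTime n d) (fun s => ∃ D : Tables, D.Holds s ∧
      D.Valid d ∧ D.Describes B ∧ (∀ i, D.sel i = 0) ∧ D.N = 2 * n ∧ s.word (reg 17 0) 0 = 0 ∧
      n ≤ D.step * D.step ∧ ∀ t < D.step, t * t < n) := by
  have hz : ∀ k j x, k ≠ 0 → (inputState B).word (reg k j) x = 0 := by
    intro k j x hk
    have h0 : (0 : ℕ) = reg 0 0 := rfl
    simp only [inputState]
    rw [if_neg]
    rintro ⟨h, -⟩
    rw [h0, reg_inj] at h
    exact hk h.1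
  have hin : (inputState B).word (reg 0 0) 0 = n := rfl
  have hlit : ∀ s : State, (WordExpr.lit 0).eval w s = 0 := eval_lit (by omega)
  refine Runs.seq (Q₁ := fun s₁ => s₁ = (inputState B).setWord (reg 1 0) 0 n) (T₁ := 4)
    (runs_of_loopFree (by exact trivial) ?_) ?_
  · simp only [Program.run, eval_var, hin, hlit]
  rintro s₁ rfl
  refine Runs.seq (Q₁ := fun s₂ => s₂ = ((inputState B).setWord (reg 1 0) 0 n).setWord (reg 2 0) 0
    (2 * n)) (T₁ := 7) (runs_of_loopFree (by exact trivial) ?_) ?_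
  · have : (WordExpr.add (.var 1 0) (.var 1 0)).eval w
        ((inputState B).setWord (reg 1 0) 0 n) = 2 * n := by
      rw [eval_add] <;> simp [setWord_word] <;> omega
    simp only [Program.run, this, hlit]
  rintro s₂ rfl
  set s₂ := ((inputState B).setWord (reg 1 0) 0 n).setWord (reg 2 0) 0 (2 * n)
  have hA₂ : Agree (fun k _ => k = 1 ∨ k = 2) (inputState B) s₂ :=
    ((Agree.refl _ _).setWord _ _ (by omega)).setWord _ _ (by omega)
  have hn₂ : s₂.word (reg 1 0) 0 = n := by simp [s₂, setWord_word]
  have hN₂ : s₂.word (reg 2 0) 0 = 2 * n := by simp [s₂, setWord_word]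
  refine Runs.seq (runs_sqrtLoop (by omega) hn₂
    (by rw [hA₂.1 3 0 (by omega)]; exact hz _ _ _ (by omega))) ?_
  rintro s₃ ⟨hA₃, hge, hlt⟩
  refine Runs.mono (runs_rankAll B (by omega) (hA₃.2.trans hA₂.2)
    (by rw [hA₃.1 1 0 (by omega), hn₂])
    (by intro j x; rw [hA₃.1 7 j (by omega), hA₂.1 7 j (by omega)]; exact hz _ _ _ (by omega))
    (by intro j x; rw [hA₃.1 8 j (by omega), hA₂.1 8 j (by omega)]; exact hz _ _ _ (by omega))
    d le_rfl) le_rfl ?_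
  rintro s ⟨hA, hS⟩
  have hsn : s.word (reg 1 0) 0 = n := by rw [hA.1 1 0 (by omega), hA₃.1 1 0 (by omega), hn₂]
  have hsN : s.word (reg 2 0) 0 = 2 * n := by rw [hA.1 2 0 (by omega), hA₃.1 2 0 (by omega), hN₂]
  have hstep : s.word (reg 3 0) 0 = s₃.word (reg 3 0) 0 := by rw [hA.1 3 0 (by omega)]
  refine ⟨⟨n, 2 * n, s.word (reg 3 0) 0, s.word (reg 4 0), fun j => s.word (reg 5 j),
    fun j => s.word (reg 6 j), fun j => s.word (reg 7 j), fun j => s.word (reg 8 j)⟩,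
    ⟨hsn, hsN, rfl, rfl, fun _ => rfl, fun _ => rfl, fun _ => rfl, fun _ => rfl⟩, ?_, ?_, ?_, rfl,
    ?_, ?_, ?_⟩
  · constructor
    · intro j hj i hi
      dsimp only at hi ⊢
      rw [(hS j hj).l_eq i hi]
      exact IntervalRank.rank_lt _ _ _ hi
    · intro j hj i hi
      dsimp only at hi ⊢
      rw [(hS j hj).h_eq i hi]
      exact IntervalRank.rank_lt _ _ _ hi
    · intro j hj i hi k hk h
      dsimp only at hi hk h
      rw [(hS j hj).l_eq i hi, (hS j hj).l_eq k hk] at h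
      exact congrArg Prod.fst (IntervalRank.rank_inj _ _ n (e := (i, false)) (e' := (k, false)) hi hk h)
    · intro j hj i hi k hk h
      dsimp only at hi hk h
      rw [(hS j hj).h_eq i hi, (hS j hj).h_eq k hk] at h
      exact congrArg Prod.fst (IntervalRank.rank_inj _ _ n (e := (i, true)) (e' := (k, true)) hi hk h)
    · intro j hj x _ i
      dsimp only
      rw [(hS j hj).op_eq]
      exact and_congr_right fun hi => by rw [(hS j hj).l_eq i hi]
    · dsimp only
      rw [hstep]
      rcases Nat.eq_zero_or_pos (s₃.word (reg 3 0) 0) with h | h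
      · rw [h] at hge; omega
      · exact h
  · refine ⟨rfl, fun j hj => (hS j hj).l_eq, fun j hj => (hS j hj).h_eq, fun j hj x => ?_⟩
    dsimp only
    rw [(hS j hj).wt_eq x]
    exact ⟨fun ⟨e, _, h2, h3⟩ => ⟨e, h2, h3⟩, fun ⟨e, h2, h3⟩ => ⟨e, h2.1, h2, h3⟩⟩
  · intro i
    dsimp only
    rw [hA.1 4 0 (by omega), hA₃.1 4 0 (by omega), hA₂.1 4 0 (by omega)]
    exact hz _ _ _ (by omega)
  · rw [hA.1 17 0 (by omega), hA₃.1 17 0 (by omega), hA₂.1 17 0 (by omega)]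
    exact hz _ _ _ (by omega)
  · dsimp only; rw [hstep]; exact hge
  · dsimp only; rw [hstep]; exact hlt


/-! ### Sweeping over intervals -/

theorem Runs.ite {w : ℕ} {b : Test} {p q : Program} {s : State} {T₁ T₂ : ℕ} {Q : State → Prop}
    (hp : b.holds w s → Runs w p s T₁ Q) (hq : ¬ b.holds w s → Runs w q s T₂ Q) :
    Runs w (.ite b p q) s (b.cost + (T₁ + T₂)) Q := by
  by_cases h : b.holds w s
  · obtain ⟨t, s', he, ht, hQ⟩ := hp h
    exact ⟨_, _, .iteTrue h he, by omega, hQ⟩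
  · obtain ⟨t, s', he, ht, hQ⟩ := hq h
    exact ⟨_, _, .iteFalse h he, by omega, hQ⟩

/-- The states differ at most in the word arrays `reg k j` with `M k` and in the real arrays
`reg k j` with `R k`. -/
def AgreeOff (M R : ℕ → Prop) (s s' : State) : Prop :=
  (∀ k j, ¬ M k → s'.word (reg k j) = s.word (reg k j)) ∧
    ∀ k j, ¬ R k → s'.real (reg k j) = s.real (reg k j)

theorem AgreeOff.refl (M R : ℕ → Prop) (s : State) : AgreeOff M R s s :=
  ⟨fun _ _ _ => rfl, fun _ _ _ => rfl⟩

theorem AgreeOff.trans {M M' M'' R R' R'' : ℕ → Prop} {s s' s'' : State} (h : AgreeOff M R s s')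
    (h' : AgreeOff M' R' s' s'') (hM : ∀ k, M k ∨ M' k → M'' k) (hR : ∀ k, R k ∨ R' k → R'' k) :
    AgreeOff M'' R'' s s'' :=
  ⟨fun k j hk => (h'.1 k j fun h => hk (hM k (Or.inr h))).trans
      (h.1 k j fun h => hk (hM k (Or.inl h))),
    fun k j hk => (h'.2 k j fun h => hk (hR k (Or.inr h))).trans
      (h.2 k j fun h => hk (hR k (Or.inl h)))⟩

theorem AgreeOff.setWord {M R : ℕ → Prop} {s s' : State} (h : AgreeOff M R s s') {k j : ℕ}
    (i v : ℕ) (hM : M k) : AgreeOff M R s (s'.setWord (reg k j) i v) := by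
  refine ⟨fun k' j' hk => ?_, h.2⟩
  rw [setWord_word_ne, h.1 k' j' hk]
  rw [Ne, reg_inj]
  rintro ⟨rfl, rfl⟩
  exact hk hM

theorem AgreeOff.setReal {M R : ℕ → Prop} {s s' : State} (h : AgreeOff M R s s') {k j : ℕ}
    (i : ℕ) (v : ℝ) (hR : R k) : AgreeOff M R s (s'.setReal (reg k j) i v) := by
  refine ⟨h.1, fun k' j' hk => ?_⟩
  rw [← h.2 k' j' hk]
  funext x
  rw [setReal_real, if_neg]
  rw [reg_inj]
  rintro ⟨⟨rfl, rfl⟩, -⟩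
  exact hk hR

/-- The real in the cell of `reg k j` with address `e`. -/
def RealExpr.at (k j : ℕ) (e : WordExpr) : RealExpr := .read (reg k j) e

@[simp] theorem evalReal_at (w : ℕ) (s : State) (k j : ℕ) (e : WordExpr) :
    (RealExpr.at k j e).eval w s = s.real (reg k j) (e.eval w s) := rfl

/-- The memory holds `n` intervals with ends `lo` and `hi`. -/
structure HoldsIntervals (n : ℕ) (lo hi : ℕ → ℝ) (s : State) : Prop where
  n_eq : s.word (reg 1 0) 0 = n
  lo_eq : s.real (reg 0 0) = lo
  hi_eq : s.real (reg 0 1) = hi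

theorem HoldsIntervals.agreeOff {n : ℕ} {lo hi : ℕ → ℝ} {M R : ℕ → Prop} {s s' : State}
    (hs : HoldsIntervals n lo hi s) (h : AgreeOff M R s s') (hM : ¬ M 1) (hR : ¬ R 0) :
    HoldsIntervals n lo hi s' :=
  ⟨by rw [h.1 1 0 hM, hs.n_eq], by rw [h.2 0 0 hR, hs.lo_eq], by rw [h.2 0 1 hR, hs.hi_eq]⟩

/-- Update of the least lower end seen so far. -/
def lowestBody : Program :=
  .ite (.or (.wordEq (.var 17 0) (.lit 0)) (.realLt (.at 30 0 (.lit 0)) (.at 0 1 (.var 14 0))))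
    (.ite (.or (.wordEq (.var 24 0) (.lit 0)) (.realLt (.at 0 0 (.var 14 0)) (.at 31 0 (.lit 0))))
      (.seq (.setReal (reg 31 0) (.lit 0) (.at 0 0 (.var 14 0))) (.setWord (reg 24 0) (.lit 0) (.lit 1)))
      .skip) .skip

/-- Find the least lower end of the intervals that reach beyond the frontier. -/
def lowest : Program := .seq (.setWord (reg 24 0) (.lit 0) (.lit 0)) (forLoop 14 1 lowestBody)

/-- Before the first choice there is no frontier, so then every interval is a candidate. Family 24
tells whether a candidate has been seen, so the initial content of the minimum is irrelevant. -/
theorem runs_lowest {n w : ℕ} {lo hi : ℕ → ℝ} (hn : n + 1 < 2 ^ w) {s : State}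
    (hs : HoldsIntervals n lo hi s) (cand : ℕ → Prop)
    (hcand : ∀ i, cand i ↔ s.word (reg 17 0) 0 = 0 ∨ s.real (reg 30 0) 0 < hi i) :
    Runs w lowest s (3 + ((lowestBody.bound + 11) * n + 8)) (fun s' =>
      AgreeOff (fun k => k = 14 ∨ k = 24) (fun k => k = 31) s s' ∧
      ((s'.word (reg 24 0) 0 = 0 ∧ ∀ i < n, ¬ cand i) ∨
        (s'.word (reg 24 0) 0 = 1 ∧ (∃ i < n, cand i ∧ lo i = s'.real (reg 31 0) 0) ∧
          ∀ i < n, cand i → s'.real (reg 31 0) 0 ≤ lo i))) := by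
  classical
  have h0 : ∀ s : State, (WordExpr.lit 0).eval w s = 0 := eval_lit (by omega)
  have h1 : ∀ s : State, (WordExpr.lit 1).eval w s = 1 := eval_lit (by omega)
  refine Runs.seq (Q₁ := fun s₁ => s₁ = s.setWord (reg 24 0) 0 0) (T₁ := 3)
    (runs_of_loopFree (by exact trivial) (by simp only [Program.run, h0])) ?_
  rintro s₁ rfl
  refine Runs.mono (Runs.forLoop (m := n) (T := lowestBody.bound) (by omega) (fun k s' =>
    AgreeOff (fun k => k = 14 ∨ k = 24) (fun k => k = 31) s s' ∧ s'.word (reg 14 0) 0 = k ∧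
      ((s'.word (reg 24 0) 0 = 0 ∧ ∀ i < k, ¬ cand i) ∨
        (s'.word (reg 24 0) 0 = 1 ∧ (∃ i < k, cand i ∧ lo i = s'.real (reg 31 0) 0) ∧
          ∀ i < k, cand i → s'.real (reg 31 0) 0 ≤ lo i))) ?_ ?_ ?_) le_rfl ?_
  · rintro k s' ⟨hA, hv, -⟩
    exact ⟨hv, (hs.agreeOff hA (by omega) (by omega)).n_eq⟩
  · rintro k s' hk ⟨hA, hv, hI⟩
    have hs' := hs.agreeOff hA (by omega) (by omega)
    have h17 : s'.word (reg 17 0) = s.word (reg 17 0) := hA.1 17 0 (by omega)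
    have h30 : s'.real (reg 30 0) = s.real (reg 30 0) := hA.2 30 0 (by omega)
    refine runs_of_loopFree (by simp [lowestBody, Program.LoopFree]) ?_
    simp only [lowestBody, Program.run, holds_or, Test.holds, eval_var, evalReal_at, h0, h1, hv,
      hs'.lo_eq, hs'.hi_eq, h17, h30, ← hcand]
    split_ifs with hc hc'
    · refine ⟨by simp [setWord_word, hv], ((hA.setReal _ _ rfl).setWord _ _ (by omega)).setWord _ _
        (by omega), by simp [setWord_word], Or.inr ⟨by simp [setWord_word],
        ⟨k, by omega, hc, by simp [setReal_real]⟩, fun i hi hci => ?_⟩⟩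
      simp only [setWord_real, setReal_real, and_self, if_true]
      rcases Nat.lt_succ_iff_lt_or_eq.1 hi with h | rfl
      · rcases hI with ⟨-, hI⟩ | ⟨hI1, hI2, hI3⟩
        · exact absurd hci (hI i h)
        · rcases hc' with hc' | hc'
          · omega
          · exact hc'.le.trans (hI3 i h hci)
      · exact le_rfl
    · push Not at hc'
      refine ⟨hv, hA.setWord _ _ (by omega), by simp [setWord_word], Or.inr ?_⟩
      rcases hI with ⟨hI, -⟩ | ⟨hI1, ⟨i, hi, hI2⟩, hI3⟩
      · exact absurd hI hc'.1
      · refine ⟨by simpa [setWord_word] using hI1, ⟨i, by omega, hI2⟩, fun i hi hci => ?_⟩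
        rcases Nat.lt_succ_iff_lt_or_eq.1 hi with h | rfl
        · exact hI3 i h hci
        · exact hc'.2
    · refine ⟨hv, hA.setWord _ _ (by omega), by simp [setWord_word], ?_⟩
      rcases hI with ⟨hI, hI'⟩ | ⟨hI1, ⟨i, hi, hI2⟩, hI3⟩
      · refine Or.inl ⟨by simpa [setWord_word] using hI, fun i hi => ?_⟩
        rcases Nat.lt_succ_iff_lt_or_eq.1 hi with h | rfl
        · exact hI' i h
        · exact hc
      · refine Or.inr ⟨by simpa [setWord_word] using hI1, ⟨i, by omega, hI2⟩, fun i hi hci => ?_⟩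
        rcases Nat.lt_succ_iff_lt_or_eq.1 hi with h | rfl
        · exact hI3 i h hci
        · exact absurd hci hc
  · exact ⟨((AgreeOff.refl _ _ _).setWord _ _ (by omega)).setWord _ _ (by omega),
      by simp [setWord_word], Or.inl ⟨by simp [setWord_word], by omega⟩⟩
  · rintro s' ⟨hA, -, h⟩
    exact ⟨hA, h⟩

/-- Update of the farthest reaching interval seen so far. -/
def farthestBody : Program :=
  .ite (.not (.realLt (.at 31 0 (.lit 0)) (.at 0 0 (.var 14 0))))
    (.ite (.or (.wordEq (.var 24 0) (.lit 0))
        (.realLt (.at 0 1 (.var 25 0)) (.at 0 1 (.var 14 0))))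
      (.seq (.setWord (reg 25 0) (.lit 0) (.var 14 0)) (.setWord (reg 24 0) (.lit 0) (.lit 1)))
      .skip) .skip

/-- Find the interval of largest upper end among those that start at or before a bound. -/
def farthest : Program := .seq (.setWord (reg 24 0) (.lit 0) (.lit 0)) (forLoop 14 1 farthestBody)

theorem runs_farthest {n w : ℕ} {lo hi : ℕ → ℝ} (hn : n + 1 < 2 ^ w) {s : State}
    (hs : HoldsIntervals n lo hi s) (q : ℝ) (hq : s.real (reg 31 0) 0 = q)
    (hex : ∃ i < n, lo i ≤ q) :
    Runs w farthest s (3 + ((farthestBody.bound + 11) * n + 8)) (fun s' =>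
      AgreeOff (fun k => k = 14 ∨ k = 24 ∨ k = 25) (fun k => k < 0) s s' ∧
      s'.word (reg 25 0) 0 < n ∧ lo (s'.word (reg 25 0) 0) ≤ q ∧
      ∀ i < n, lo i ≤ q → hi i ≤ hi (s'.word (reg 25 0) 0)) := by
  classical
  have h0 : ∀ s : State, (WordExpr.lit 0).eval w s = 0 := eval_lit (by omega)
  have h1 : ∀ s : State, (WordExpr.lit 1).eval w s = 1 := eval_lit (by omega)
  refine Runs.seq (Q₁ := fun s₁ => s₁ = s.setWord (reg 24 0) 0 0) (T₁ := 3)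
    (runs_of_loopFree (by exact trivial) (by simp only [Program.run, h0])) ?_
  rintro s₁ rfl
  refine Runs.mono (Runs.forLoop (m := n) (T := farthestBody.bound) (by omega) (fun k s' =>
    AgreeOff (fun k => k = 14 ∨ k = 24 ∨ k = 25) (fun k => k < 0) s s' ∧
      s'.word (reg 14 0) 0 = k ∧
      ((s'.word (reg 24 0) 0 = 0 ∧ ∀ i < k, ¬ lo i ≤ q) ∨
        (s'.word (reg 24 0) 0 = 1 ∧ s'.word (reg 25 0) 0 < n ∧ lo (s'.word (reg 25 0) 0) ≤ q ∧
          ∀ i < k, lo i ≤ q → hi i ≤ hi (s'.word (reg 25 0) 0)))) ?_ ?_ ?_) le_rfl ?_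
  · rintro k s' ⟨hA, hv, -⟩
    exact ⟨hv, (hs.agreeOff hA (by omega) (by omega)).n_eq⟩
  · rintro k s' hk ⟨hA, hv, hI⟩
    have hs' := hs.agreeOff hA (by omega) (by omega)
    have h31 : s'.real (reg 31 0) 0 = q := by rw [hA.2 31 0 (by omega), hq]
    refine runs_of_loopFree (by simp [farthestBody, Program.LoopFree]) ?_
    simp only [farthestBody, Program.run, holds_or, Test.holds, eval_var, evalReal_at, h0, h1, hv,
      hs'.lo_eq, hs'.hi_eq, h31, not_lt]
    split_ifs with hc hc'
    · refine ⟨by simp [setWord_word, hv], ((hA.setWord _ _ (by omega)).setWord _ _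
        (by omega)).setWord _ _ (by omega), by simp [setWord_word],
        Or.inr ⟨by simp [setWord_word], by simpa [setWord_word] using hk,
          by simpa [setWord_word] using hc, fun i hi' hci => ?_⟩⟩
      have : (((s'.setWord (reg 25 0) 0 k).setWord (reg 24 0) 0 1).setWord (reg 14 0) 0
        (k + 1)).word (reg 25 0) 0 = k := by simp [setWord_word]
      rw [this]
      rcases Nat.lt_succ_iff_lt_or_eq.1 hi' with h | rfl
      · rcases hI with ⟨-, hI⟩ | ⟨hI1, hI2, hI3, hI4⟩
        · exact absurd hci (hI i h)
        · rcases hc' with hc' | hc'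
          · omega
          · exact (hI4 i h hci).trans hc'.le
      · exact le_rfl
    · push Not at hc'
      refine ⟨hv, hA.setWord _ _ (by omega), by simp [setWord_word], Or.inr ?_⟩
      rcases hI with ⟨hI, -⟩ | ⟨hI1, hI2, hI3, hI4⟩
      · exact absurd hI hc'.1
      · have : (s'.setWord (reg 14 0) 0 (k + 1)).word (reg 25 0) 0 = s'.word (reg 25 0) 0 := by
          simp [setWord_word]
        rw [this]
        refine ⟨by simpa [setWord_word] using hI1, hI2, hI3, fun i hi' hci => ?_⟩
        rcases Nat.lt_succ_iff_lt_or_eq.1 hi' with h | rfl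
        · exact hI4 i h hci
        · exact hc'.2
    · refine ⟨hv, hA.setWord _ _ (by omega), by simp [setWord_word], ?_⟩
      have : (s'.setWord (reg 14 0) 0 (k + 1)).word (reg 25 0) 0 = s'.word (reg 25 0) 0 := by
        simp [setWord_word]
      rw [this]
      rcases hI with ⟨hI, hI'⟩ | ⟨hI1, hI2, hI3, hI4⟩
      · refine Or.inl ⟨by simpa [setWord_word] using hI, fun i hi' => ?_⟩
        rcases Nat.lt_succ_iff_lt_or_eq.1 hi' with h | rfl
        · exact hI' i h
        · exact hc
      · refine Or.inr ⟨by simpa [setWord_word] using hI1, hI2, hI3, fun i hi' hci => ?_⟩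
        rcases Nat.lt_succ_iff_lt_or_eq.1 hi' with h | rfl
        · exact hI4 i h hci
        · exact absurd hci hc
  · exact ⟨((AgreeOff.refl _ _ _).setWord _ _ (by omega)).setWord _ _ (by omega),
      by simp [setWord_word], Or.inl ⟨by simp [setWord_word], by omega⟩⟩
  · rintro s' ⟨hA, -, h⟩
    refine ⟨hA, ?_⟩
    rcases h with ⟨-, h⟩ | ⟨-, h⟩
    · obtain ⟨i, hi', hiq⟩ := hex
      exact absurd hiq (h i hi')
    · exact h

/-- Raise the bound to the frontier. -/
def raiseBound : Program :=
  .ite (.and (.not (.wordEq (.var 17 0) (.lit 0)))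
      (.realLt (.at 31 0 (.lit 0)) (.at 30 0 (.lit 0))))
    (.setReal (reg 31 0) (.lit 0) (.at 30 0 (.lit 0))) .skip

/-- Output the interval found and move the frontier to its upper end. -/
def advance : Program :=
  .seq (.setWord (reg 0 1) (.var 17 0) (.var 25 0))
    (.seq (.setWord (reg 17 0) (.lit 0) (.add (.var 17 0) (.lit 1)))
      (.setReal (reg 30 0) (.lit 0) (.at 0 1 (.var 25 0))))

/-- One round of the sweep. -/
def sweepRound : Program :=
  .seq lowest (.ite (.wordEq (.var 24 0) (.lit 0)) (.setWord (reg 18 0) (.lit 0) (.lit 0))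
    (.seq raiseBound (.seq farthest advance)))

/-- The time taken by `sweepRound`. -/
def sweepRoundTime (n : ℕ) : ℕ :=
  (3 + ((lowestBody.bound + 11) * n + 8)) + (4 + (3 +
    (raiseBound.bound + ((3 + ((farthestBody.bound + 11) * n + 8)) + advance.bound))))

/-! ### Optimality of the interval sweep -/

/-- The intervals chosen so far cover everything up to the frontier `p`, and there are equally many
points no two of which lie in a common interval. -/
structure SweepState (n : ℕ) (lo hi : ℕ → ℝ) (p : ℝ) (K : Finset ℕ) (W : Finset ℝ) : Prop where
  subset : K ⊆ Finset.range n
  hi_le : ∀ k ∈ K, hi k ≤ p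
  -- The frontier is meaningless until an interval has been chosen.
  covers : K.Nonempty → ∀ i < n, ∀ x, lo i ≤ x → x ≤ hi i → x ≤ p → ∃ k ∈ K, lo k ≤ x ∧ x ≤ hi k
  card_eq : W.card = K.card
  mem : ∀ x ∈ W, ∃ i < n, lo i ≤ x ∧ x ≤ hi i
  -- This is what separates later points, taken beyond the frontier, from the earlier ones.
  reach : ∀ x ∈ W, ∀ i < n, lo i ≤ x → x ≤ hi i → hi i ≤ p
  separate : ∀ x ∈ W, ∀ y ∈ W, ∀ i < n, lo i ≤ x → x ≤ hi i → lo i ≤ y → y ≤ hi i → x = y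

/-- A cover needs a different interval for each point of `W`. -/
theorem SweepState.card_le {n : ℕ} {lo hi : ℕ → ℝ} {p : ℝ} {K : Finset ℕ} {W : Finset ℝ}
    (h : SweepState n lo hi p K W) (O : Finset ℕ) (hO : ∀ i ∈ O, i < n)
    (hcov : ∀ i < n, ∀ x, lo i ≤ x → x ≤ hi i → ∃ k ∈ O, lo k ≤ x ∧ x ≤ hi k) :
    K.card ≤ O.card := by
  rw [← h.card_eq]
  have : ∀ x : W, ∃ k ∈ O, lo k ≤ x ∧ (x : ℝ) ≤ hi k := by
    rintro ⟨x, hx⟩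
    obtain ⟨i, hi', h1, h2⟩ := h.mem x hx
    exact hcov i hi' x h1 h2
  choose f hf hf1 hf2 using this
  rw [← Finset.card_attach]
  refine Finset.card_le_card_of_injOn f (fun x _ => hf x) ?_
  intro x _ y _ hxy
  refine Subtype.ext (h.separate x x.2 y y.2 (f x) (hO _ (hf x)) (hf1 x) (hf2 x) ?_ ?_)
  · rw [hxy]; exact hf1 y
  · rw [hxy]; exact hf2 y

/-- The new point `x` lies beyond the frontier and in some interval, and every interval through it
starts by `q`, hence ends by `hi b`. Intervals through old points end by the old frontier, so `x`
shares none with them. -/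
theorem SweepState.step {n : ℕ} {lo hi : ℕ → ℝ} (hlohi : ∀ i < n, lo i ≤ hi i) {p : ℝ}
    {K : Finset ℕ} {W : Finset ℝ} (h : SweepState n lo hi p K W) (q : ℝ) (b : ℕ) (hb : b < n)
    (hqK : K.Nonempty → p ≤ q) (c : ℕ) (hc : c < n) (hcq : lo c ≤ q)
    (hcand : K.Nonempty → p < hi c) (hqc : q = lo c ∨ (K.Nonempty ∧ q = p))
    (hlow : ∀ i < n, (K.Nonempty → p < hi i) → (K.Nonempty ∧ q = p) ∨ q ≤ lo i)
    (hbq : lo b ≤ q) (hbest : ∀ i < n, lo i ≤ q → hi i ≤ hi b) :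
    b ∉ K ∧ ∃ W', SweepState n lo hi (hi b) (insert b K) W' := by
  classical
  -- a point just after the frontier
  obtain ⟨x, hxp, hqx, ⟨i, hin, hix, hxi⟩, hx⟩ : ∃ x, (K.Nonempty → p < x) ∧ q ≤ x ∧
      (∃ i < n, lo i ≤ x ∧ x ≤ hi i) ∧ ∀ i < n, lo i ≤ x → x ≤ hi i → lo i ≤ q := by
    -- If the bound equals the frontier, the point must lie strictly beyond it and before every
    -- greater end. Otherwise the bound is the lower end of `c` and itself serves as the point.
    by_cases hcase : K.Nonempty ∧ q = p
    · obtain ⟨hK, rfl⟩ := hcase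
      have hev : ∀ᶠ x in nhdsWithin q (Set.Ioi q), q < x ∧
          ∀ k ∈ Finset.range n, (q < lo k → x < lo k) ∧ (q < hi k → x < hi k) := by
        refine Filter.Eventually.and self_mem_nhdsWithin ?_
        rw [Filter.eventually_all_finset]
        intro k _
        have haux : ∀ v, ∀ᶠ x in nhdsWithin q (Set.Ioi q), q < v → x < v := by
          intro v
          by_cases hv : q < v
          · filter_upwards [Ioo_mem_nhdsGT hv] with x hx _ using hx.2
          · exact Filter.Eventually.of_forall fun x h => absurd h hv
        exact (haux _).and (haux _)
      obtain ⟨x, hx1, hx2⟩ := hev.exists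
      refine ⟨x, fun _ => hx1, hx1.le, ⟨c, hc, hcq.trans hx1.le,
        ((hx2 c (Finset.mem_range.2 hc)).2 (hcand hK)).le⟩, fun i hi' h1 _ => ?_⟩
      by_contra hlt
      exact absurd ((hx2 i (Finset.mem_range.2 hi')).1 (not_le.1 hlt)) (not_lt.2 h1)
    · have hqc' : q = lo c := hqc.resolve_right hcase
      refine ⟨q, fun hK => lt_of_le_of_ne (hqK hK) fun h => hcase ⟨hK, h.symm⟩, le_rfl,
        ⟨c, hc, hcq, ?_⟩, fun i _ h1 _ => h1⟩
      rw [hqc']; exact hlohi c hc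
  have hpb : K.Nonempty → p < hi b := fun hK =>
    (hxp hK).trans_le (hxi.trans (hbest i hin (hx i hin hix hxi)))
  have hbK : b ∉ K := fun hbK => absurd (h.hi_le b hbK) (not_le.2 (hpb ⟨b, hbK⟩))
  have hWK : W.Nonempty → K.Nonempty := by
    rw [← Finset.card_pos, ← Finset.card_pos, h.card_eq]; exact id
  have hWp : ∀ y ∈ W, ∀ i < n, lo i ≤ y → y ≤ hi i → ¬ x ≤ hi i := fun y hy i hi' h1 h2 h3 =>
    absurd (h3.trans (h.reach y hy i hi' h1 h2)) (not_le.2 (hxp (hWK ⟨y, hy⟩)))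
  have hxW : x ∉ W := fun hxW => hWp x hxW i hin hix hxi hxi
  refine ⟨hbK, insert x W, ?_, ?_, ?_, ?_, ?_, ?_, ?_⟩
  · exact Finset.insert_subset (Finset.mem_range.2 hb) h.subset
  · intro k hk
    rcases Finset.mem_insert.1 hk with rfl | hk
    · exact le_rfl
    · exact (h.hi_le k hk).trans (hpb ⟨k, hk⟩).le
  · intro _ i hi' y h1 h2 h3
    by_cases hy : K.Nonempty ∧ y ≤ p
    · obtain ⟨k, hk, hk'⟩ := h.covers hy.1 i hi' y h1 h2 hy.2
      exact ⟨k, Finset.mem_insert_of_mem hk, hk'⟩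
    -- A point beyond the frontier lies in a candidate, which starts at or after `q` unless `q` is
    -- the frontier; in both cases `lo b ≤ q ≤ y`.
    · refine ⟨b, Finset.mem_insert_self _ _, hbq.trans ?_, h3⟩
      have hy' : K.Nonempty → p < y := fun hK => not_le.1 fun h => hy ⟨hK, h⟩
      rcases hlow i hi' (fun hK => (hy' hK).trans_le h2) with ⟨hK, rfl⟩ | h
      · exact (hy' hK).le
      · exact h.trans h1
  · rw [Finset.card_insert_of_notMem hxW, Finset.card_insert_of_notMem hbK, h.card_eq]
  · intro y hy
    rcases Finset.mem_insert.1 hy with rfl | hy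
    · exact ⟨i, hin, hix, hxi⟩
    · exact h.mem y hy
  · intro y hy k hk h1 h2
    rcases Finset.mem_insert.1 hy with rfl | hy
    · exact hbest k hk (hx k hk h1 h2)
    · exact (h.reach y hy k hk h1 h2).trans (hpb (hWK ⟨y, hy⟩)).le
  · intro y hy z hz k hk h1 h2 h3 h4
    rcases Finset.mem_insert.1 hy with rfl | hyW
    · rcases Finset.mem_insert.1 hz with rfl | hzW
      · rfl
      · exact absurd h2 (hWp z hzW k hk h3 h4)
    · rcases Finset.mem_insert.1 hz with rfl | hzW
      · exact absurd h4 (hWp y hyW k hk h1 h2)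
      · exact h.separate y hyW z hzW k hk h1 h2 h3 h4

theorem runs_sweepRound {n w : ℕ} {lo hi : ℕ → ℝ} (hlohi : ∀ i < n, lo i ≤ hi i)
    (hn : n + 1 < 2 ^ w) {s : State} (hs : HoldsIntervals n lo hi s) {K : Finset ℕ} {W : Finset ℝ}
    (hm : s.word (reg 17 0) 0 = K.card) (hK : SweepState n lo hi (s.real (reg 30 0) 0) K W) :
    Runs w sweepRound s (sweepRoundTime n) (fun s' => HoldsIntervals n lo hi s' ∧
      ((s'.word (reg 18 0) 0 = 0 ∧ s'.word (reg 17 0) 0 = K.card ∧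
          s'.word (reg 0 1) = s.word (reg 0 1) ∧ s'.real (reg 30 0) 0 = s.real (reg 30 0) 0 ∧
          ∀ i < n, K.Nonempty ∧ hi i ≤ s.real (reg 30 0) 0) ∨
        ∃ b W', b ∉ K ∧ s'.word (reg 17 0) 0 = K.card + 1 ∧
          s'.word (reg 18 0) 0 = s.word (reg 18 0) 0 ∧
          s'.word (reg 0 1) = Function.update (s.word (reg 0 1)) K.card b ∧
          SweepState n lo hi (s'.real (reg 30 0) 0) (insert b K) W')) := by
  classical
  have h0 : ∀ s : State, (WordExpr.lit 0).eval w s = 0 := eval_lit (by omega)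
  have h1 : ∀ s : State, (WordExpr.lit 1).eval w s = 1 := eval_lit (by omega)
  have hKm : s.word (reg 17 0) 0 = 0 ↔ ¬ K.Nonempty := by
    rw [hm, Finset.card_eq_zero, Finset.not_nonempty_iff_eq_empty]
  set p := s.real (reg 30 0) 0 with hp
  refine Runs.seq (runs_lowest hn hs (fun i => s.word (reg 17 0) 0 = 0 ∨ p < hi i)
    (fun i => Iff.rfl)) ?_
  rintro s₁ ⟨hA₁, hf⟩
  have hs₁ := hs.agreeOff hA₁ (by omega) (by omega)
  refine Runs.ite (T₁ := 3) ?_ ?_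
  · intro hb
    simp only [Test.holds, eval_var, h0] at hb
    have hnc := (hf.resolve_right (by omega)).2
    refine runs_of_loopFree (by exact trivial) ?_
    simp only [Program.run, h0]
    have hA : AgreeOff (fun k => k = 14 ∨ k = 24 ∨ k = 18) (fun k => k = 31) s
        (s₁.setWord (reg 18 0) 0 0) :=
      (hA₁.trans (AgreeOff.refl (fun k => k = 24) (fun k => k = 31) _) (by omega)
        (by omega)).setWord _ _ (by omega)
    refine ⟨hs.agreeOff hA (by omega) (by omega), Or.inl ⟨by simp [setWord_word], ?_, ?_, ?_, ?_⟩⟩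
    · rw [hA.1 17 0 (by omega), hm]
    · rw [hA.1 0 1 (by omega)]
    · rw [hA.2 30 0 (by omega)]
    · intro i hi'
      have := hnc i hi'
      rw [hKm] at this
      push Not at this
      exact this
  intro hb
  simp only [Test.holds, eval_var, h0] at hb
  obtain ⟨-, ⟨c, hcn, hcc, hcq⟩, hmin⟩ := hf.resolve_left (by tauto)
  set q₀ := s₁.real (reg 31 0) 0 with hq₀
  have h17 : s₁.word (reg 17 0) 0 = K.card := by rw [hA₁.1 17 0 (by omega), hm]
  have h30 : s₁.real (reg 30 0) 0 = p := by rw [hA₁.2 30 0 (by omega)]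
  -- The least lower end of a candidate, raised to the frontier if there is one: the place from
  -- which coverage has to continue.
  set q : ℝ := if K.Nonempty ∧ q₀ < p then p else q₀ with hqdef
  refine Runs.seq (Q₁ := fun s₂ => AgreeOff (fun k => k = 24) (fun k => k = 31) s₁ s₂ ∧
    s₂.real (reg 31 0) 0 = q) (runs_of_loopFree (by simp [raiseBound, Program.LoopFree]) ?_) ?_
  · simp only [raiseBound, Program.run, Test.holds, eval_var, evalReal_at, h0, h17, h30, ← hq₀,
      Finset.card_eq_zero, ← Finset.nonempty_iff_ne_empty, ← ne_eq]
    rw [hqdef]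
    split_ifs
    · exact ⟨(AgreeOff.refl _ _ _).setReal _ _ rfl, by simp [setReal_real]⟩
    · exact ⟨AgreeOff.refl _ _ _, rfl⟩
  rintro s₂ ⟨hA₂, hq⟩
  have hs₂ := hs₁.agreeOff hA₂ (by omega) (by omega)
  have hqq₀ : q₀ ≤ q := by rw [hqdef]; split_ifs with h; exacts [h.2.le, le_rfl]
  refine Runs.seq (runs_farthest hn hs₂ q hq ⟨c, hcn, hcq.trans_le hqq₀⟩) ?_
  rintro s₃ ⟨hA₃, hbn, hbq, hbest⟩
  have hA : AgreeOff (fun k => k = 14 ∨ k = 24 ∨ k = 25) (fun k => k = 31) s s₃ :=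
    (hA₁.trans hA₂ (M'' := fun k => k = 14 ∨ k = 24) (R'' := fun k => k = 31) (by omega)
      (by omega)).trans hA₃ (by omega) (by omega)
  have hs₃ := hs.agreeOff hA (by omega) (by omega)
  set b := s₃.word (reg 25 0) 0 with hbdef
  have hcand : ∀ i, (s.word (reg 17 0) 0 = 0 ∨ p < hi i) ↔ (K.Nonempty → p < hi i) := by
    intro i; rw [hKm]; tauto
  obtain ⟨hbK, W', hW'⟩ := hK.step hlohi q b hbn (fun hKn => by
      rw [hqdef]; split_ifs with h
      · exact le_rfl
      · exact not_lt.1 fun h' => h ⟨hKn, h'⟩) c hcn (hcq.trans_le hqq₀) ((hcand c).1 hcc)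
    (by
      rw [hqdef]; split_ifs with h
      · exact Or.inr ⟨h.1, rfl⟩
      · exact Or.inl hcq.symm)
    (fun i hi' hci => by
      rw [hqdef]; split_ifs with h
      · exact Or.inl ⟨h.1, rfl⟩
      · exact Or.inr (hmin i hi' ((hcand i).2 hci))) hbq hbest
  have hKc : K.card < n := by
    have := Finset.card_le_card hW'.subset
    rw [Finset.card_insert_of_notMem hbK, Finset.card_range] at this
    exact this
  refine runs_of_loopFree (by simp [advance, Program.LoopFree]) ?_
  have h17' : s₃.word (reg 17 0) 0 = K.card := by rw [hA.1 17 0 (by omega), hm]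
  have hrun : advance.run w s₃ = ((s₃.setWord (reg 0 1) K.card b).setWord (reg 17 0) 0
      (K.card + 1)).setReal (reg 30 0) 0 (hi b) := by
    have hadd : (WordExpr.add (.var 17 0) (.lit 1)).eval w (s₃.setWord (reg 0 1) K.card b) =
        K.card + 1 := by
      rw [eval_add] <;> rw [h1, eval_var, setWord_word_ne _ _ _ (by simp), h17']
      omega
    simp only [advance, Program.run, eval_var, h17', h0, evalReal_at, ← hbdef, hadd,
      setWord_real, hs₃.hi_eq]
    congr 2
  have hA' : AgreeOff (fun k => k = 14 ∨ k = 24 ∨ k = 25 ∨ k = 17 ∨ k = 0)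
      (fun k => k = 31 ∨ k = 30) s (advance.run w s₃) := by
    rw [hrun]
    exact (((hA.trans (AgreeOff.refl (fun k => k = 24) (fun k => k = 31) _) (by omega)
      (by omega)).setWord _ _ (by omega)).setWord _ _ (by omega)).setReal _ _ (by omega)
  refine ⟨hs.agreeOff hA' (by omega) (by omega), Or.inr ⟨b, W', hbK, ?_, ?_, ?_, ?_⟩⟩
  · rw [hrun]; simp [setWord_word]
  · rw [hA'.1 18 0 (by omega)]
  · rw [hrun, setReal_word, setWord_word_ne _ _ _ (by simp)]
    simp only [State.setWord, Function.update_self]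
    rw [hA.1 0 1 (by omega)]
  · rw [hrun, setReal_real, if_pos ⟨rfl, rfl⟩]
    exact hW'

/-- The sweep algorithm for intervals. -/
def sweep : Program :=
  .seq (.seq (.setWord (reg 1 0) (.lit 0) (.var 0 0)) (.setWord (reg 18 0) (.lit 0) (.lit 1)))
    (.seq (.loop (.wordEq (.var 18 0) (.lit 1)) sweepRound)
      (.setWord (reg 0 0) (.lit 0) (.var 17 0)))

/-- Every round except the last chooses an interval, and no more are chosen than any cover `O` has;
so there are at most `O.card + 1` rounds. -/
theorem runs_sweep {n w : ℕ} {lo hi : ℕ → ℝ} (hlohi : ∀ i < n, lo i ≤ hi i)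
    (hn : n + 1 < 2 ^ w) (hpos : 0 < n) {s : State} (hs0 : s.word (reg 0 0) 0 = n)
    (hlo : s.real (reg 0 0) = lo) (hhi : s.real (reg 0 1) = hi) (hm : s.word (reg 17 0) 0 = 0)
    (O : Finset ℕ) (hO : ∀ i ∈ O, i < n)
    (hcov : ∀ i < n, ∀ x, lo i ≤ x → x ≤ hi i → ∃ k ∈ O, lo k ≤ x ∧ x ≤ hi k) :
    Runs w sweep s (7 + (((4 + sweepRoundTime n) * (O.card + 1) + 4) + 4)) (fun s' =>
      ∃ K : Finset ℕ, K ⊆ Finset.range n ∧ K.card ≤ O.card ∧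
        (∀ i < n, ∀ x, lo i ≤ x → x ≤ hi i → ∃ k ∈ K, lo k ≤ x ∧ x ≤ hi k) ∧
        s'.word (reg 0 0) 0 = K.card ∧ (Finset.range K.card).image (s'.word (reg 0 1)) = K) := by
  classical
  have h0 : ∀ s : State, (WordExpr.lit 0).eval w s = 0 := eval_lit (by omega)
  have h1 : ∀ s : State, (WordExpr.lit 1).eval w s = 1 := eval_lit (by omega)
  refine Runs.seq (Q₁ := fun s₁ => s₁ = (s.setWord (reg 1 0) 0 n).setWord (reg 18 0) 0 1) (T₁ := 7)
    (runs_of_loopFree (by exact ⟨trivial, trivial⟩) ?_) ?_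
  · simp only [Program.run, h0, h1, eval_var, hs0]
  rintro s₁ rfl
  set s₁ := (s.setWord (reg 1 0) 0 n).setWord (reg 18 0) 0 1
  refine Runs.seq (Runs.loop (b := .wordEq (.var 18 0) (.lit 1)) (T := sweepRoundTime n)
    (fun s' => HoldsIntervals n lo hi s' ∧ ∃ K W, s'.word (reg 17 0) 0 = K.card ∧
      SweepState n lo hi (s'.real (reg 30 0) 0) K W ∧
      (Finset.range K.card).image (s'.word (reg 0 1)) = K ∧
      (s'.word (reg 18 0) 0 = 1 ∨ s'.word (reg 18 0) 0 = 0 ∧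
        ∀ i < n, K.Nonempty ∧ hi i ≤ s'.real (reg 30 0) 0))
    (fun s' => (O.card - s'.word (reg 17 0) 0) + s'.word (reg 18 0) 0) ?_ (O.card + 1) _ ?_ ?_) ?_
  · rintro s' ⟨hs, K, W, hm', hK, himg, -⟩ hb
    simp only [Test.holds, eval_var, h1] at hb
    refine Runs.mono (runs_sweepRound hlohi hn hs hm' hK) le_rfl ?_
    rintro s₂ ⟨hs₂, ⟨e1, e2, e3, e4, e5⟩ | ⟨b, W', hbK, e1, e2, e3, hK'⟩⟩
    · exact ⟨⟨hs₂, K, W, e2, e4 ▸ hK, e3 ▸ himg, Or.inr ⟨e1, e4.symm ▸ e5⟩⟩, by omega⟩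
    · have hcard : (insert b K).card = K.card + 1 := Finset.card_insert_of_notMem hbK
      have hle := hK'.card_le O hO hcov
      refine ⟨⟨hs₂, insert b K, W', by rw [e1, hcard], hK', ?_, Or.inl (e2.trans hb)⟩, by omega⟩
      rw [hcard, Finset.range_add_one, Finset.image_insert, e3, Function.update_self]
      congr 1
      conv_rhs => rw [← himg]
      refine Finset.image_congr fun x hx => ?_
      simp only [Finset.coe_range, Set.mem_Iio] at hx
      rw [Function.update_of_ne hx.ne]
  · refine ⟨⟨by simp [s₁, setWord_word], hlo, hhi⟩, ∅, ∅, by simpa [s₁, setWord_word] using hm, ?_,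
      by simp, Or.inl (by simp [s₁, setWord_word])⟩
    constructor <;> simp
  · simp [s₁, setWord_word, hm]
  · rintro s₂ ⟨⟨hs₂, K, W, hm', hK, himg, hst⟩, hb⟩
    simp only [Test.holds, eval_var, h1] at hb
    have hend := (hst.resolve_left hb).2
    refine Runs.mono (T := 4) (runs_of_loopFree (by exact trivial)
      ⟨K, hK.subset, hK.card_le O hO hcov, fun i hi' x hx1 hx2 => ?_, ?_, ?_⟩) le_rfl fun _ h => h
    · exact hK.covers (hend i hi').1 i hi' x hx1 hx2 (hx2.trans (hend i hi').2)
    · simp [Program.run, setWord_word, WordExpr.eval, hm']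
    · rw [Program.run, setWord_word_ne _ _ _ (by simp)]; exact himg


/-! ### Time bounds -/

theorem scanAllTime_le (d m : ℕ) : ∃ C, ∀ n N : ℕ, 1 ≤ n → N ≤ 2 * n →
    scanAllTime N d m ≤ C * n := by
  induction m with
  | zero => exact ⟨1, fun n N h _ => by simp only [scanAllTime]; omega⟩
  | succ m ih =>
    obtain ⟨C, hC⟩ := ih
    refine ⟨C + (14 + ((scanBody d m).bound + 11) * 2), fun n N hn hN => ?_⟩
    have h1 := hC n N hn hN
    have h2 := Nat.mul_le_mul_left ((scanBody d m).bound + 11) hN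
    simp only [scanAllTime, scanTime]
    nlinarith

/-- Each of the `k` nested loops has `O(s)` iterations around linear work. The linear cost of
choosing a cut is absorbed by the inner walk, because `s ^ k` is at least 1. -/
theorem walkTime_le (d κ k : ℕ) : ∀ j : ℕ, ∃ C, ∀ n N M s : ℕ, 1 ≤ n → N ≤ 2 * n → 1 ≤ s →
    M ≤ κ * s → walkTime n N M d k j ≤ C * (s ^ k * n) := by
  induction k with
  | zero =>
    intro j
    obtain ⟨C, hC⟩ := scanAllTime_le d d
    refine ⟨C + ((Program.setWord (reg 15 0) (.var 14 0)
      (.add (.at 15 0 (.var 14 0)) (prodExpr d))).bound + 11 + 8), fun n N M s hn hN _ _ => ?_⟩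
    have h1 := hC n N hn hN
    simp only [walkTime, tallyTime, pow_zero, one_mul]
    nlinarith
  | succ k ih =>
    intro j
    obtain ⟨C, hC⟩ := ih (j + 1)
    obtain ⟨A, hA⟩ : ∃ A, ∀ n : ℕ, 1 ≤ n → 5 + (cutTime n j + 4) ≤ A * n :=
      ⟨9 + ((Program.setWord (reg 10 j) (.lit 0)
        (.min (.var 2 0) (.mul (.add (.div (.var 9 j) (.var 3 0)) (.lit 1)) (.var 3 0)))).bound +
        ((cutBody j).bound + 11 + 8)), fun n hn => by simp only [cutTime]; nlinarith⟩
    refine ⟨(A + C) * κ + 8, fun n N M s hn hN hs hM => ?_⟩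
    have h1 := hC n N M s hn hN hs hM
    have h2 := hA n hn
    have hsk : 1 ≤ s ^ k := Nat.one_le_pow _ _ hs
    have h3 : 5 + (cutTime n j + (walkTime n N M d k (j + 1) + 4)) ≤ (A + C) * (s ^ k * n) := by
      have : A * n ≤ A * (s ^ k * n) := Nat.mul_le_mul_left _ (Nat.le_mul_of_pos_left _ hsk)
      rw [add_mul]
      omega
    have h4 := Nat.mul_le_mul h3 hM
    have h5 : 1 ≤ s ^ (k + 1) * n := Nat.mul_pos (Nat.one_le_pow _ _ hs) hn
    have h6 : (A + C) * (s ^ k * n) * (κ * s) = (A + C) * κ * (s ^ (k + 1) * n) := by ring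
    rw [h6] at h4
    simp only [walkTime]
    rw [add_mul ((A + C) * κ) 8]
    omega

theorem roundTime_le (d κ : ℕ) : ∃ C, ∀ n N M s : ℕ, 1 ≤ n → N ≤ 2 * n → 1 ≤ s →
    M ≤ κ * s → roundTime n N M d ≤ C * (s ^ d * n) := by
  obtain ⟨C, hC⟩ := walkTime_le d κ d 0
  refine ⟨C + (15 + 8 + 3 + 23 + 8 + commit.bound), fun n N M s hn hN hs hM => ?_⟩
  have h1 := hC n N M s hn hN hs hM
  have hsk : 1 ≤ s ^ d := Nat.one_le_pow _ _ hs
  have h2 : n ≤ s ^ d * n := Nat.le_mul_of_pos_left _ hsk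
  have h3 : commit.bound ≤ commit.bound * (s ^ d * n) :=
    Nat.le_mul_of_pos_right _ (by omega)
  simp only [roundTime]
  rw [add_mul C, add_mul _ commit.bound]
  omega

theorem setupTime_le (d : ℕ) : ∃ C, ∀ n : ℕ, 1 ≤ n → setupTime n d ≤ C * (n * n) := by
  have h : ∀ m, ∃ C, ∀ n : ℕ, 1 ≤ n → rankAllTime n d m ≤ C * (n * n) := by
    intro m
    induction m with
    | zero => exact ⟨1, fun n hn => by simp only [rankAllTime]; nlinarith⟩
    | succ m ih =>
      obtain ⟨C, hC⟩ := ih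
      refine ⟨C + (12 + ((compareBody d m).bound + 11) + 8 + (storeRanks m).bound + 11 + 8),
        fun n hn => ?_⟩
      have h1 := hC n hn
      have h2 : n ≤ n * n := Nat.le_mul_self n
      have h3 : (12 + 8 + (storeRanks m).bound + 11) * n ≤
        (12 + 8 + (storeRanks m).bound + 11) * (n * n) := Nat.mul_le_mul_left _ h2
      simp only [rankAllTime, rankDimTime]
      nlinarith
  obtain ⟨C, hC⟩ := h d
  refine ⟨C + 33, fun n hn => ?_⟩
  have h1 := hC n hn
  have h2 : n ≤ n * n := Nat.le_mul_self n
  simp only [setupTime]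
  rw [add_mul C 33]
  omega

theorem sweepRoundTime_le : ∃ C, ∀ n : ℕ, 1 ≤ n → sweepRoundTime n ≤ C * n :=
  ⟨3 + (lowestBody.bound + 11 + 8) + 7 + raiseBound.bound + (3 + (farthestBody.bound + 11) + 8) +
    advance.bound, fun n hn => by simp only [sweepRoundTime]; nlinarith⟩

/-- With `P = 2 ^ (Nat.log 2 n + 1)` one has `n < P` and `4 ≤ P`, so `2 * n ≤ P ^ 2`; together with
`d < P ^ d` every quantity stays below `P ^ (2 * d + 5)`. -/
theorem word_length (d n : ℕ) (hn : 2 ≤ n) :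
    (2 * n) ^ d < 2 ^ ((2 * d + 5) * (Nat.log 2 n + 1)) ∧
      n * n + 5 * n + n * d + 5 < 2 ^ ((2 * d + 5) * (Nat.log 2 n + 1)) := by
  set P := 2 ^ (Nat.log 2 n + 1) with hP
  have hlt : n < P := Nat.lt_pow_succ_log_self (by norm_num) n
  have hlog : 1 ≤ Nat.log 2 n := Nat.log_pos (by norm_num) hn
  have h4 : 4 ≤ P := by
    calc 4 = 2 ^ 2 := by norm_num
      _ ≤ P := Nat.pow_le_pow_right (by norm_num) (by omega)
  have hW : 2 ^ ((2 * d + 5) * (Nat.log 2 n + 1)) = P ^ (2 * d + 5) := by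
    rw [hP, ← pow_mul, mul_comm]
  rw [hW]
  constructor
  · calc (2 * n) ^ d ≤ (P ^ 2) ^ d := Nat.pow_le_pow_left (by nlinarith) d
      _ = P ^ (2 * d) := by rw [← pow_mul]
      _ < P ^ (2 * d + 5) := Nat.pow_lt_pow_right (by omega) (by omega)
  · have hd : d < P ^ d := Nat.lt_pow_self (by omega)
    have hPd : 1 ≤ P ^ d := Nat.one_le_pow _ _ (by omega)
    have h1 : n * n ≤ P * P := Nat.mul_le_mul hlt.le hlt.le
    have h2 : n * d ≤ P * P ^ d := Nat.mul_le_mul hlt.le hd.le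
    calc n * n + 5 * n + n * d + 5 ≤ P * P + 5 * P + P * P ^ d + 5 := by omega
      _ ≤ P ^ d * (P * P + 8 * P) := by
        have a1 : P * P ≤ P ^ d * (P * P) := Nat.le_mul_of_pos_left _ hPd
        have a2 : P ≤ P ^ d * P := Nat.le_mul_of_pos_left _ hPd
        rw [mul_add, mul_left_comm _ 8, mul_comm P (P ^ d)]
        omega
      _ < P ^ d * P ^ 5 := by
        refine Nat.mul_lt_mul_of_pos_left ?_ (by omega)
        have : P ^ 5 = P * P * (P * P * P) := by ring
        rw [this]
        have a1 : 4 * P ≤ P * P := Nat.mul_le_mul_right P h4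
        have a2 : 4 * 4 * 4 ≤ P * P * P := Nat.mul_le_mul (Nat.mul_le_mul h4 h4) h4
        have a3 := Nat.mul_le_mul_left (P * P) a2
        omega
      _ ≤ P ^ (2 * d + 5) := by
        rw [← pow_add]; exact Nat.pow_le_pow_right (by omega) (by omega)

/-! ### Kernels -/

theorem exists_minKernel {d n : ℕ} (B : Fin n → Box d) :
    ∃ K : Finset (Fin n), IsCoverageKernel B K ∧ K.card = minKernelSize B :=
  Nat.sInf_mem (s := {k | ∃ K : Finset (Fin n), IsCoverageKernel B K ∧ K.card = k})
    ⟨_, Finset.univ, rfl, rfl⟩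

/-- Boxes are nonempty, so the empty family is no kernel. -/
theorem minKernelSize_pos {d n : ℕ} (hn : 0 < n) (B : Fin n → Box d) : 0 < minKernelSize B := by
  obtain ⟨K, hK, hc⟩ := exists_minKernel B
  rw [← hc, Finset.card_pos]
  obtain ⟨k, hk, -⟩ := (isCoverageKernel_iff_forall B K).1 hK ⟨0, hn⟩ (B ⟨0, hn⟩).fst
    ((mem_box_iff B _ _).2 fun j => by
      rw [lower_eq, upper_eq]; exact ⟨le_rfl, (B ⟨0, hn⟩).fst_le_snd j⟩)
  exact ⟨k, hk⟩

theorem exists_outputs {n : ℕ} {s : State} {K : Finset ℕ} (hK : K ⊆ Finset.range n)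
    (h0 : s.word (reg 0 0) 0 = K.card) (h1 : (Finset.range K.card).image (s.word (reg 0 1)) = K) :
    ∃ K' : Finset (Fin n), K'.map Fin.valEmbedding = K ∧ K'.card = K.card ∧ s.Outputs K' := by
  have hlt : ∀ i ∈ K, i < n := fun i hi => Finset.mem_range.1 (hK hi)
  have hmap : (K.attachFin hlt).map Fin.valEmbedding = K := by
    ext i
    simp only [Finset.mem_map, Finset.mem_attachFin, Fin.valEmbedding_apply]
    exact ⟨fun ⟨a, ha, h⟩ => h ▸ ha, fun h => ⟨⟨i, hlt i h⟩, h, rfl⟩⟩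
  have hcard : (K.attachFin hlt).card = K.card := Finset.card_attachFin _ _
  refine ⟨K.attachFin hlt, hmap, hcard, ?_, ?_⟩
  · rw [hcard]; exact h0
  · rw [hcard, hmap]; exact h1

/-- Lets constants be absorbed by factors `Real.log n`. -/
theorem half_le_log {n : ℕ} (hn : 2 ≤ n) : 1 / 2 ≤ Real.log n := by
  have h1 : Real.log 2 ≤ Real.log n := Real.log_le_log (by norm_num) (by exact_mod_cast hn)
  have h2 := Real.log_two_gt_d9
  linarith

/-! ### Resource bounds for intervals and for boxes -/

/-- The sweep handles intervals. -/
theorem exists_kernel_intervals : ∃ C : ℝ, ∀ (n w : ℕ), 2 ≤ n → n + 1 < 2 ^ w →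
    ∀ B : Fin n → Box 1, ∃ (t : ℕ) (s : State) (K : Finset (Fin n)),
      Exec w sweep (inputState B) t s ∧ s.Outputs K ∧ IsCoverageKernel B K ∧
      K.card ≤ minKernelSize B ∧ (t : ℝ) ≤ C * (minKernelSize B * n) := by
  obtain ⟨A, hA⟩ := sweepRoundTime_le
  -- Here `15 = 7 + 4 + 4` is the cost outside the rounds, and the factor 2 comes from `OPT + 1 ≤ 2
  -- * OPT`.
  refine ⟨(15 + (4 + A) * 2 : ℕ), fun n w hn hw B => ?_⟩
  obtain ⟨O, hO, hOc⟩ := exists_minKernel B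
  have hOpos := minKernelSize_pos (by omega) B
  have hmem : ∀ (i : Fin n) (x : ℝ), (fun _ : Fin 1 => x) ∈ (B i : Set (Fin 1 → ℝ)) ↔
      lower B 0 i ≤ x ∧ x ≤ upper B 0 i := by
    intro i x
    rw [mem_box_iff]
    simp
  obtain ⟨t, s, he, ht, K, hK, hKc, hcov, h0, h1⟩ := runs_sweep (n := n) (w := w)
    (lo := lower B 0) (hi := upper B 0) (s := inputState B)
    (fun i hi => by
      have h1 := lower_eq B 0 ⟨i, hi⟩
      have h2 := upper_eq B 0 ⟨i, hi⟩
      simp only [Fin.val_zero] at h1 h2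
      rw [h1, h2]
      exact (B ⟨i, hi⟩).fst_le_snd 0)
    hw (by omega) rfl
    (funext fun x => by
      simp only [lower, mul_one, add_zero]; rfl)
    (funext fun x => by
      simp only [upper, mul_one, add_zero]; rfl)
    (by
      simp only [inputState]
      rw [if_neg]
      rintro ⟨h, -⟩
      have h0 : (0 : ℕ) = reg 0 0 := rfl
      rw [h0, reg_inj] at h
      omega)
    (O.map Fin.valEmbedding) (by
      intro i hi
      obtain ⟨a, -, rfl⟩ := Finset.mem_map.1 hi
      exact a.2)
    (by
      intro i hi x hx1 hx2
      obtain ⟨k, hk, hkx⟩ := (isCoverageKernel_iff_forall B O).1 hO ⟨i, hi⟩ (fun _ => x)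
        ((hmem _ _).2 ⟨hx1, hx2⟩)
      exact ⟨k, Finset.mem_map_of_mem _ hk, (hmem _ _).1 hkx⟩)
  rw [Finset.card_map, hOc] at ht hKc
  obtain ⟨K', hmap, hcard, hout⟩ := exists_outputs hK h0 h1
  refine ⟨t, s, K', he, hout, ?_, hcard ▸ hKc, ?_⟩
  · rw [isCoverageKernel_iff_forall]
    intro b p hp
    have hp0 : p = fun _ => p 0 := funext fun j => by rw [Subsingleton.elim j 0]
    rw [hp0, hmem] at hp
    obtain ⟨k, hk, hkp⟩ := hcov b b.2 _ hp.1 hp.2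
    rw [← hmap] at hk
    obtain ⟨k', hk', rfl⟩ := Finset.mem_map.1 hk
    refine ⟨k', hk', ?_⟩
    rw [hp0, hmem]
    exact hkp
  · have h2 := hA n (by omega)
    have h3 : t ≤ (15 + (4 + A) * 2) * (minKernelSize B * n) := by
      refine ht.trans ?_
      set m := minKernelSize B
      have h4 : (4 + sweepRoundTime n) * (m + 1) ≤ ((4 + A) * n) * (2 * m) :=
        Nat.mul_le_mul (by nlinarith) (by omega)
      have h5 : 1 ≤ m * n := Nat.mul_pos hOpos (by omega)
      have h6 : ((4 + A) * n) * (2 * m) = (4 + A) * 2 * (m * n) := by ring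
      rw [add_mul 15 ((4 + A) * 2), ← h6]
      omega
    exact_mod_cast h3

/-- Minimality gives `(s - 1)^2 < n`, hence `s ≤ √n + 1 ≤ 2√n`. -/
theorem step_pow_le {d n s : ℕ} (hs : 1 ≤ s) (hn : 1 ≤ n) (hlt : ∀ t < s, t * t < n) :
    (s : ℝ) ^ d * n ≤ 2 ^ d * (n : ℝ) ^ ((d : ℝ) / 2 + 1) := by
  have hn1 : (1 : ℝ) ≤ n := by exact_mod_cast hn
  have h2 : (s : ℝ) ≤ 2 * Real.sqrt n := by
    have h3 := hlt (s - 1) (by omega)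
    have h4 : ((s - 1 : ℕ) : ℝ) ≤ Real.sqrt n := by
      refine Real.le_sqrt_of_sq_le ?_
      rw [sq]
      exact_mod_cast h3.le
    have h5 : (1 : ℝ) ≤ Real.sqrt n := Real.one_le_sqrt.2 hn1
    rw [Nat.cast_sub hs, Nat.cast_one] at h4
    linarith
  have h3 : (s : ℝ) ^ d ≤ 2 ^ d * (n : ℝ) ^ ((d : ℝ) / 2) := by
    refine (pow_le_pow_left₀ (Nat.cast_nonneg _) h2 d).trans_eq ?_
    rw [mul_pow, Real.sqrt_eq_rpow, ← Real.rpow_natCast ((n : ℝ) ^ (1 / 2 : ℝ)),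
      ← Real.rpow_mul (by linarith)]
    congr 2
    ring
  rw [Real.rpow_add (by linarith), Real.rpow_one, ← mul_assoc]
  exact mul_le_mul_of_nonneg_right h3 (by linarith)

/-- Take logarithms and use `2 * n ≤ n * n`. -/
theorem le_of_one_le_mul_exp {d n k : ℕ} {m : ℝ} (hn : 2 ≤ n) (hm : 0 < m)
    (hk : 1 ≤ ((2 * n : ℕ) : ℝ) ^ d * Real.exp (-(k / m))) :
    (k : ℝ) ≤ 2 * d * (m * Real.log n) := by
  have hn0 : (0 : ℝ) < n := by exact_mod_cast (by omega : 0 < n)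
  have h2 := Real.log_le_log one_pos hk
  rw [Real.log_one, Real.log_mul (by positivity) (Real.exp_pos _).ne', Real.log_exp,
    Real.log_pow] at h2
  have h3 : Real.log ((2 * n : ℕ) : ℝ) ≤ 2 * Real.log n := by
    have : Real.log ((2 * n : ℕ) : ℝ) ≤ Real.log ((n : ℝ) * n) := by
      refine Real.log_le_log (by positivity) ?_
      have : (2 : ℝ) ≤ n := by exact_mod_cast hn
      push_cast
      nlinarith
    rw [Real.log_mul hn0.ne' hn0.ne'] at this
    linarith
  have h4 : (k : ℝ) / m ≤ d * (2 * Real.log n) := by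
    have : (d : ℝ) * Real.log ((2 * n : ℕ) : ℝ) ≤ d * (2 * Real.log n) :=
      mul_le_mul_of_nonneg_left h3 (Nat.cast_nonneg d)
    linarith
  rw [div_le_iff₀ hm] at h4
  linarith

/-- Used with `X = n^(d/2+1)` and `Y = OPT * log n`. The summand `2 * d + 2` is there so that the
same constant also bounds the size of the kernel. -/
theorem total_time_le {d A E X Y R t₁ t₂ : ℝ} (hd : 0 ≤ d) (hA : 0 ≤ A) (hE : 0 ≤ E) (hX : 1 ≤ X)
    (hY : 1 / 2 ≤ Y) (hR : R ≤ 2 * d * Y + 1) (h₁ : t₁ ≤ A * X)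
    (h₂ : t₂ ≤ 11 * X + E * X * (R + 1)) :
    t₁ + t₂ ≤ (2 * d + 2 + (2 * (A + 11) + E * (2 * d + 4))) * (Y * X) := by
  have hR1 : R + 1 ≤ (2 * d + 4) * Y := by linarith
  have h3 : E * X * (R + 1) ≤ E * X * ((2 * d + 4) * Y) :=
    mul_le_mul_of_nonneg_left hR1 (by positivity)
  have h4 : (A + 11) * X ≤ (A + 11) * (2 * (Y * X)) :=
    mul_le_mul_of_nonneg_left (by nlinarith) (by positivity)
  have h5 : 0 ≤ (2 * d + 2) * (Y * X) := by positivity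
  linarith

/-- The greedy algorithm handles boxes in dimension at least two. -/
theorem exists_kernel_boxes (d : ℕ) (hd : 2 ≤ d) : ∃ C : ℝ, ∀ n : ℕ, 2 ≤ n →
    ∀ B : Fin n → Box d, ∃ (t : ℕ) (s : State) (K : Finset (Fin n)),
      Exec ((2 * d + 5) * (Nat.log 2 n + 1)) (.seq (setup d) (greedy d)) (inputState B) t s ∧
      s.Outputs K ∧ IsCoverageKernel B K ∧
      (K.card : ℝ) ≤ C * (minKernelSize B * Real.log n) ∧
      (t : ℝ) ≤ C * (minKernelSize B * Real.log n * (n : ℝ) ^ ((d : ℝ) / 2 + 1)) := by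
  obtain ⟨A₁, hA₁⟩ := setupTime_le d
  obtain ⟨A₂, hA₂⟩ := roundTime_le d (4 + 4 * d)
  refine ⟨2 * d + 2 + (2 * (A₁ + 11) + (4 + A₂ * 2 ^ d) * (2 * d + 4)), fun n hn B => ?_⟩
  obtain ⟨hw1, hw2⟩ := word_length d n hn
  set w := (2 * d + 5) * (Nat.log 2 n + 1)
  obtain ⟨O, hO, hOc⟩ := exists_minKernel B
  have hOpos := minKernelSize_pos (by omega) B
  set m := minKernelSize B
  have hlog := half_le_log hn
  set L := Real.log n with hL
  have hm1 : (1 : ℝ) ≤ m := by exact_mod_cast hOpos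
  have hmL : 1 / 2 ≤ m * L := by nlinarith
  set R := ⌊2 * d * (m * L)⌋₊ + 1 with hRdef
  have hRle : (R : ℝ) ≤ 2 * d * (m * L) + 1 := by
    rw [hRdef]
    push_cast
    have := Nat.floor_le (a := 2 * d * (m * L)) (by positivity)
    linarith
  obtain ⟨t₁, s₁, he₁, ht₁, D, hs, hD, hB, hsel, hN, hm17, hge, hlt⟩ :=
    runs_setup (w := w) B (by omega) (by omega)
  have hDn := hB.n_eq
  have hstep : D.step ≤ n := by
    by_contra h
    have h1 := hlt (D.step - 1) (by omega)
    have h2 := Nat.le_mul_self (D.step - 1)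
    omega
  have hstep1 := hD.step_pos
  -- Since `2 * n ≤ 2 * step^2`, the number of multiples of `step` is itself of order `step`.
  have hM : D.N / D.step + 2 + 4 * d * D.step ≤ (4 + 4 * d) * D.step := by
    have h1 : D.N / D.step ≤ 2 * D.step := by
      refine Nat.div_le_of_le_mul ?_
      rw [hN]
      nlinarith
    nlinarith
  obtain ⟨t₂, s₂, he₂, ht₂, K, hK, hKc, hcov, h0, h1⟩ := runs_greedy (w := w) (R := R)
    (by omega) hD (by rw [hN]; omega) (by rw [hN]; exact hw1) (by omega) (by omega) hM hs hsel hm17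
    (O.map Fin.valEmbedding) (by
      intro i hi
      obtain ⟨a, -, rfl⟩ := Finset.mem_map.1 hi
      rw [hDn]; exact a.2) (by rw [Finset.card_map, hOc]; exact hOpos)
    (by rw [hDn]; exact (hB.isCoverageKernel_iff O).1 hO)
    (by
      intro k hk
      rw [Finset.card_map, hOc, hN] at hk
      rw [hRdef, Nat.add_le_add_iff_right]
      refine Nat.le_floor ?_
      exact le_of_one_le_mul_exp hn (by linarith) hk)
  rw [hDn] at hK hcov ht₂
  obtain ⟨K', hmap, hcard, hout⟩ := exists_outputs hK h0 h1
  have hC1 : (0 : ℝ) ≤ 2 * (A₁ + 11) + (4 + A₂ * 2 ^ d) * (2 * d + 4) := by positivity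
  refine ⟨t₁ + t₂, s₂, K', .seq he₁ he₂, hout, ?_, ?_, ?_⟩
  · rw [hB.isCoverageKernel_iff, hmap]; exact hcov
  · rw [hcard]
    have h2 : (K.card : ℝ) ≤ R := by exact_mod_cast hKc
    have h3 : 0 ≤ (2 * (A₁ + 11) + (4 + A₂ * 2 ^ d) * (2 * d + 4)) * (m * L) :=
      mul_nonneg hC1 (by linarith)
    linarith
  · set X := (n : ℝ) ^ ((d : ℝ) / 2 + 1) with hX
    have hn1 : (1 : ℝ) ≤ n := by exact_mod_cast (by omega : 1 ≤ n)
    have hd2 : (2 : ℝ) ≤ d := by exact_mod_cast hd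
    -- The quadratic preparation fits into the bound because the exponent `d / 2 + 1` is at least 2.
    have hX1 : (n : ℝ) * n ≤ X := by
      have : (n : ℝ) ^ (2 : ℝ) ≤ X := Real.rpow_le_rpow_of_exponent_le hn1 (by linarith)
      rw [Real.rpow_two] at this
      linarith [sq (n : ℝ)]
    have hX2 : (D.step : ℝ) ^ d * n ≤ 2 ^ d * X := step_pow_le hstep1 (by omega) hlt
    have hX0 : 1 ≤ X := le_trans (by nlinarith) hX1
    have hT1 : (t₁ : ℝ) ≤ A₁ * X := by
      have h2 : t₁ ≤ A₁ * (n * n) := ht₁.trans (hA₁ n (by omega))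
      have h3 : (t₁ : ℝ) ≤ A₁ * (n * n) := by exact_mod_cast h2
      exact h3.trans (mul_le_mul_of_nonneg_left hX1 (Nat.cast_nonneg _))
    have hT2 : (t₂ : ℝ) ≤ 11 * X + (4 + A₂ * 2 ^ d) * X * (R + 1) := by
      have h2 := hA₂ n D.N ((4 + 4 * d) * D.step) D.step (by omega) hN.le hstep1 le_rfl
      have h3 : t₂ ≤ 11 + (4 + A₂ * (D.step ^ d * n)) * (R + 1) := by
        have := Nat.mul_le_mul_right (R + 1) (Nat.add_le_add_left h2 4)
        omega
      have h4 : (t₂ : ℝ) ≤ 11 + (4 + A₂ * (D.step ^ d * n)) * (R + 1) := by exact_mod_cast h3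
      have h5 : (A₂ : ℝ) * (D.step ^ d * n) ≤ A₂ * (2 ^ d * X) :=
        mul_le_mul_of_nonneg_left hX2 (Nat.cast_nonneg _)
      have h6 : (4 + (A₂ : ℝ) * (D.step ^ d * n)) * (R + 1) ≤ (4 + A₂ * 2 ^ d) * X * (R + 1) := by
        refine mul_le_mul_of_nonneg_right ?_ (by positivity)
        linarith
      linarith
    rw [Nat.cast_add]
    exact total_time_le (Nat.cast_nonneg d) (Nat.cast_nonneg A₁) (by positivity) hX0 hmL hRle hT1 hT2

end RealRAM

theorem theorem5 (d : ℕ) (hd : 1 ≤ d) :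
    ∃ (prog : RealRAM.Program) (c : ℕ) (C : ℝ),
      ∀ (n : ℕ), 2 ≤ n → ∀ (B : Fin n → Box d),
        ∃ (t : ℕ) (s : RealRAM.State) (K : Finset (Fin n)),
          RealRAM.Exec (c * (Nat.log 2 n + 1)) prog (RealRAM.inputState B) t s ∧
          s.Outputs K ∧
          IsCoverageKernel B K ∧
          (K.card : ℝ) ≤ C * ((minKernelSize B : ℝ) * Real.log n) ∧
          (t : ℝ) ≤
            C * ((minKernelSize B : ℝ) * (n : ℝ) ^ ((d : ℝ) / 2 + 1) * Real.log n ^ 2) := by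
  -- Dimension one is separate: comparing all pairs of intervals would exceed the exponent `3 / 2`.
  rcases Nat.eq_or_lt_of_le hd with rfl | hd
  · obtain ⟨C, h⟩ := RealRAM.exists_kernel_intervals
    -- The word factor is `2 * 1 + 5`. Since `log n ≥ 1/2`, a factor 2 pays for the logarithm in the
    -- size and a factor 4 for its square in the time.
    refine ⟨RealRAM.sweep, 7, 2 + 4 * |C|, fun n hn B => ?_⟩
    obtain ⟨hw1, hw2⟩ := RealRAM.word_length 1 n hn
    obtain ⟨t, s, K, he, ho, hK, hc, ht⟩ := h n (7 * (Nat.log 2 n + 1)) hn (by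
      norm_num at hw2; omega) B
    have hlog := RealRAM.half_le_log hn
    have hn1 : (1 : ℝ) ≤ n := by exact_mod_cast (by omega : 1 ≤ n)
    have hpos : (1 : ℝ) ≤ minKernelSize B := by
      exact_mod_cast RealRAM.minKernelSize_pos (by omega) B
    have hc' : (K.card : ℝ) ≤ minKernelSize B := by exact_mod_cast hc
    refine ⟨t, s, K, he, ho, hK, ?_, ?_⟩
    · have h1 : (minKernelSize B : ℝ) ≤ 2 * (minKernelSize B * Real.log n) := by nlinarith
      have h2 : 0 ≤ 4 * |C| * (minKernelSize B * Real.log n) := by positivity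
      linarith
    · set X := (n : ℝ) ^ (((1 : ℕ) : ℝ) / 2 + 1)
      have hX : (n : ℝ) ≤ X := by
        have : (n : ℝ) ^ (1 : ℝ) ≤ X := Real.rpow_le_rpow_of_exponent_le hn1 (by norm_num)
        rwa [Real.rpow_one] at this
      have h1 : (minKernelSize B : ℝ) * n ≤ 4 * (minKernelSize B * X * Real.log n ^ 2) := by
        have h2 : (1 : ℝ) ≤ 4 * Real.log n ^ 2 := by nlinarith
        have h3 : (minKernelSize B : ℝ) * n ≤ minKernelSize B * X :=
          mul_le_mul_of_nonneg_left hX (by linarith)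
        have h4 : (0 : ℝ) ≤ minKernelSize B * X := by positivity
        nlinarith
      have h2 : C * (minKernelSize B * n) ≤ |C| * (minKernelSize B * n) :=
        mul_le_mul_of_nonneg_right (le_abs_self C) (by positivity)
      have h3 := mul_le_mul_of_nonneg_left h1 (abs_nonneg C)
      have h4 : 0 ≤ 2 * ((minKernelSize B : ℝ) * X * Real.log n ^ 2) := by positivity
      linarith
  · obtain ⟨C, h⟩ := RealRAM.exists_kernel_boxes d hd
    refine ⟨.seq (RealRAM.setup d) (RealRAM.greedy d), 2 * d + 5, 3 * |C|, fun n hn B => ?_⟩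
    obtain ⟨t, s, K, he, ho, hK, hc, ht⟩ := h n hn B
    have hlog := RealRAM.half_le_log hn
    refine ⟨t, s, K, he, ho, hK, hc.trans ?_, ht.trans ?_⟩
    · refine mul_le_mul_of_nonneg_right ?_ (by positivity)
      linarith [le_abs_self C, abs_nonneg C]
    · set X := (n : ℝ) ^ ((d : ℝ) / 2 + 1)
      have h1 : (minKernelSize B : ℝ) * Real.log n * X ≤
          3 * (minKernelSize B * X * Real.log n ^ 2) := by
        -- The greedy algorithm needs only one logarithm in its time bound; the second one is slack.
        have h2 : Real.log n ≤ 3 * Real.log n ^ 2 := by nlinarith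
        have h3 : (0 : ℝ) ≤ minKernelSize B * X := by positivity
        nlinarith
      have h2 : C * ((minKernelSize B : ℝ) * Real.log n * X) ≤
          |C| * ((minKernelSize B : ℝ) * Real.log n * X) :=
        mul_le_mul_of_nonneg_right (le_abs_self C) (by positivity)
      have h3 := mul_le_mul_of_nonneg_left h1 (abs_nonneg C)
      linarith
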